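/- **Setting.** Let $N$ be a lattice (a free abelian group of finite rank) with dual lattice $M$, torus $N_{\mathbb C^*}=N\otimes\mathbb C^*$ with its complex conjugation, and logarithmic map $\log:N_{\mathbb C^*}\to N_{\mathbb R}=N\otimes\mathbb R$, $n\otimes z\mapsto n\otimes\log|z|$. An *oriented real curve* $f:S\dashrightarrow N_{\mathbb C^*}$ consists of a compact connected Riemann surface $\mathbb CC$ with an antiholomorphic involution $\sigma$ such that the complement of the fixed locus of $\sigma$ has exactly two connected components $S$ and $\overline S=\sigma(S)$, one of which, $S$, is chosen, and of a rational map $f:\mathbb CC\dashrightarrow N_{\mathbb C^*}$ (holomorphic outside a finite set, with every monomial $\chi^m\circ f$, $m\in M$, meromorphic) that commutes with the conjugations. For $p\in\mathbb CC$ let $n_p\in N$ be the vector with $\mathrm{ord}_p(\chi^m\circ f)=\langle m,n_p\rangle$ for all $m\in M$; the curve meets the toric boundary at $p$ if $n_p\neq0$. The curve has degree $\Delta=(n_k)_k$, a finite family in $N$, if there are distinct points $p_k$ with $n_{p_k}=n_k$ and $n_p=0$ at all other points $p$ (zero vectors are allowed in $\Delta$). It has *only real intersection points* if $n_p\ne0$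 implies $\sigma(p)=p$. For an integral $2$-form $\varpi\in\Lambda^2M$ on $N$, the logarithmic area is $\mathcal A_{\log}(S,\varpi)=\int_S(\log\circ f)^*\varpi$. If the curve has only real intersection points, its *quantum index* $h(S)$ is the unique class in $\Lambda^2N$ with $\mathcal A_{\log}(S,\varpi)=\frac{\pi^2}{2}\langle h(S),\varpi\rangle$ for all $\varpi\in\Lambda^2 M$. **Proposition.** Let $N',N$ be lattices, let $\alpha:N'_{\mathbb C^*}\to N_{\mathbb C^*}$ be the monomial map associated to an integer linear map $A:N'\to N$, and let $f:S\dashrightarrow N'_{\mathbb C^*}$ be an oriented real curve of degree $\Delta'$. Then $\alpha\circ f:S\dashrightarrow N_{\mathbb C^*}$, denoted $\alpha(S)$, is an oriented real curve of degree $A(\Delta')$. Moreover: - If $f$ has only real intersection points, then the quantum indices $h(S)\in\Lambda^2N'$ and $h(\alpha(S))\in\Lambda^2N$ exist and are unique, and $$h(\alpha(S))=(\Lambda^2A)(h(S))\in\Lambda^2N.$$ - In general, in particular in the presence of non-real intersection points, for every $2$-form $\varpi\in\Lambda^2M$ the integrals defining $\mathcal A_{\log}(\alpha(S),\varpi)$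 and $\mathcal A_{\log}(S,A^*\varpi)$ converge absolutely, and $$\mathcal A_{\log}(\alpha(S),\varpi)=\mathcal A_{\log}(S,A^*\varpi).$$ -/

import Mathlib

open scoped Manifold ContDiff TensorProduct

noncomputable section

namespace QuantumIndex

/-! ### The torus of a lattice -/

/-- The complex torus `N ⊗ ℂ*` of a lattice `N` (the group law is written additively). -/
abbrev Torus (N : Type*) [AddCommGroup N] : Type _ := N ⊗[ℤ] Additive ℂˣ

/-- The monomial map `N' ⊗ ℂ* → N ⊗ ℂ*` of an integer linear map `A : N' → N`. -/
def monomialMap {N' N : Type*} [AddCommGroup N'] [AddCommGroup N] (A : N' →ₗ[ℤ] N)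
    (t : Torus N') : Torus N :=
  A.rTensor (Additive ℂˣ) t

/-- The homomorphism `z ↦ log |z|` from `ℂ*` to `ℝ`. -/
def logAbs : Additive ℂˣ →+ ℝ where
  toFun z := Real.log ‖(z.toMul : ℂ)‖
  map_zero' := by simp
  map_add' z w := by simp [Real.log_mul]

section Lattice

variable {N : Type*} [AddCommGroup N]

/-- The value at a point of the torus of the monomial with exponent `m` in the dual lattice:
`n ⊗ z ↦ z ^ m n`. -/
def monomial (m : Module.Dual ℤ N) (t : Torus N) : ℂ :=
  ((TensorProduct.lid ℤ (Additive ℂˣ) (m.rTensor (Additive ℂˣ) t)).toMul : ℂˣ)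

/-- Complex conjugation of the torus: `n ⊗ z ↦ n ⊗ conj z`. -/
def torusConj (t : Torus N) : Torus N :=
  (MonoidHom.toAdditive (Units.map (starRingEnd ℂ : ℂ →* ℂ))).toIntLinearMap.lTensor N t

/-- The logarithmic map `N ⊗ ℂ* → N_ℝ = N ⊗ ℝ`: `n ⊗ z ↦ n ⊗ log |z|`. -/
def logMap (t : Torus N) : N ⊗[ℤ] ℝ :=
  logAbs.toIntLinearMap.lTensor N t

/-- The real linear coordinate on `N_ℝ` defined by `m` in the dual lattice. -/
def realCoord (m : Module.Dual ℤ N) (v : N ⊗[ℤ] ℝ) : ℝ :=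
  TensorProduct.lid ℤ ℝ (m.rTensor ℝ v)

/-- The pullback by `F : ℂ → N_ℝ` of the constant `2`-form `ϖ`, evaluated at `z` on the positively
oriented frame `(∂/∂x, ∂/∂y)`. In the linear coordinates `x_i` of a basis `b` of `N` one has
`ϖ = ∑_{i < j} ϖ(b_i, b_j) dx_i ∧ dx_j`. -/
def pullbackDensity [Module.Free ℤ N] [Module.Finite ℤ N]
    (ϖ : N [⋀^Fin 2]→ₗ[ℤ] ℤ) (F : ℂ → N ⊗[ℤ] ℝ) (z : ℂ) : ℝ :=
  let b := Module.Free.chooseBasis ℤ N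
  ∑ i, ∑ j, (ϖ ![b i, b j] : ℝ) *
    (fderiv ℝ (fun w => realCoord (b.coord i) (F w)) z 1 *
      fderiv ℝ (fun w => realCoord (b.coord j) (F w)) z Complex.I)

end Lattice

/-! ### Oriented real curves

`X` is a compact connected Riemann surface. A rational map `X ⇢ N ⊗ ℂ*` is given by a function on
`X` whose values at finitely many points are irrelevant. -/

section Curve

variable {X : Type*} [TopologicalSpace X] [ChartedSpace ℂ X]

/-- `σ` is an antiholomorphic involution. -/
structure IsRealStructure (σ : X → X) : Prop where
  continuous : Continuous σ
  involutive : Function.Involutive σ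
  antiholomorphic : ∀ x, DifferentiableAt ℂ
    (fun z => starRingEnd ℂ (chartAt ℂ (σ x) (σ ((chartAt ℂ x).symm z)))) (chartAt ℂ x x)

/-- The complement of the real locus of `σ` has exactly the two connected components `S` and
`σ(S)`. -/
structure IsHalf (σ : X → X) (S : Set X) : Prop where
  isOpen : IsOpen S
  isConnected : IsConnected S
  disjoint : Disjoint S (σ '' S)
  union_eq : S ∪ σ '' S = {x | σ x ≠ x}

variable {N : Type*} [AddCommGroup N]

/-- The monomial `m` along `f`, read in the preferred chart at `x`. -/
def localMonomial (f : X → Torus N) (m : Module.Dual ℤ N) (x : X) (z : ℂ) : ℂ :=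
  monomial m (f ((chartAt ℂ x).symm z))

/-- `f` is an oriented real curve: `σ` is a real structure on the Riemann surface `X`, of type I
with chosen half `S`, and `f : X ⇢ N ⊗ ℂ*` is a rational map that commutes with the
conjugations. -/
structure IsOrientedRealCurve (σ : X → X) (S : Set X) (f : X → Torus N) : Prop where
  isRealStructure : IsRealStructure σ
  isHalf : IsHalf σ S
  meromorphic : ∀ m x, MeromorphicAt (localMonomial f m x) (chartAt ℂ x x)
  exists_punctures : ∃ P : Set X, P.Finite ∧ (∀ x, σ x ∈ P ↔ x ∈ P) ∧
    (∀ m, ∀ x ∉ P, MDifferentiableAt 𝓘(ℂ) 𝓘(ℂ) (fun y => monomial m (f y)) x) ∧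
    ∀ x ∉ P, f (σ x) = torusConj (f x)

/-- `n` is the cocharacter of `f` at `x`: every monomial `m` has order `⟨m, n⟩` at `x`. The
curve meets the toric boundary at `x` exactly if the cocharacter there is non-zero. -/
def IsCocharacterAt (f : X → Torus N) (x : X) (n : N) : Prop :=
  ∀ m : Module.Dual ℤ N,
    meromorphicOrderAt (localMonomial f m x) (chartAt ℂ x x) = ((m n : ℤ) : WithTop ℤ)

/-- `f` has degree `Δ`: the cocharacters at suitable distinct points of the curve are the members
of the family `Δ`, and every other point is mapped to the torus. Zero vectors are allowed
in `Δ`; their points are also mapped to the torus. -/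
def HasDegree {ι : Type*} (f : X → Torus N) (Δ : ι → N) : Prop :=
  ∃ p : ι ↪ X, (∀ k, IsCocharacterAt f (p k) (Δ k)) ∧
    ∀ x ∉ Set.range p, IsCocharacterAt f x 0

/-- All intersection points with the toric boundary are real. -/
def HasOnlyRealIntersections (σ : X → X) (f : X → Torus N) : Prop :=
  ∀ x, ¬ IsCocharacterAt f x 0 → σ x = x

/-! ### Logarithmic area and quantum index -/

variable (X) in
/-- A partition of `X` into finitely many Borel sets, each of them contained in the domain of a
chart. -/
structure ChartPartition where
  size : ℕ
  chart : Fin size → OpenPartialHomeomorph X ℂ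
  piece : Fin size → Set X
  chart_mem : ∀ i, chart i ∈ atlas ℂ X
  measurable : ∀ i, @MeasurableSet X (borel X) (piece i)
  subset : ∀ i, piece i ⊆ (chart i).source
  disjoint : Pairwise fun i j => Disjoint (piece i) (piece j)
  covers : ⋃ i, piece i = Set.univ

theorem nonempty_chartPartition [CompactSpace X] : Nonempty (ChartPartition X) := by
  obtain ⟨t, ht⟩ := isCompact_univ.elim_finite_subcover
    (fun x : X => (chartAt ℂ x).source) (fun x => (chartAt ℂ x).open_source)
    (fun x _ => Set.mem_iUnion.2 ⟨x, mem_chart_source ℂ x⟩)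
  let e := t.equivFin.symm
  let s : Fin t.card → Set X := fun i => (chartAt ℂ (e i : X)).source
  refine ⟨⟨t.card, fun i => chartAt ℂ (e i : X), fun i => s i \ ⋃ j < i, s j,
    fun i => chart_mem_atlas ℂ _, fun i => ?_, fun i => Set.sdiff_subset, ?_, ?_⟩⟩
  · let _ : MeasurableSpace X := borel X
    have : BorelSpace X := ⟨rfl⟩
    refine MeasurableSet.diff (chartAt ℂ _).open_source.measurableSet ?_
    exact (isOpen_biUnion fun j _ => (chartAt ℂ _).open_source).measurableSet
  · have key : ∀ i j, i < j →
        Disjoint (s i \ ⋃ k < i, s k) (s j \ ⋃ k < j, s k) := fun i j hij =>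
      Set.disjoint_left.2 fun x hi hj => hj.2 (Set.mem_biUnion hij hi.1)
    intro i j hij
    rcases lt_or_gt_of_ne hij with h | h
    · exact key i j h
    · exact (key j i h).symm
  · classical
    refine Set.eq_univ_of_forall fun x => ?_
    obtain ⟨y, hy, hx⟩ := Set.mem_iUnion₂.1 (ht (Set.mem_univ x))
    have hne : ∃ i, x ∈ s i := ⟨e.symm ⟨y, hy⟩, by simpa [s] using hx⟩
    obtain ⟨i, hi, hmin⟩ := WellFounded.has_min (wellFounded_lt (α := Fin t.card))
      {i | x ∈ s i} hne
    refine Set.mem_iUnion.2 ⟨i, hi, fun h => ?_⟩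
    obtain ⟨j, hj, hxj⟩ := Set.mem_iUnion₂.1 h
    exact hmin j hxj hj

variable [Module.Free ℤ N] [Module.Finite ℤ N]

/-- The integral over `S`, with its complex orientation, of the `2`-form `(log ∘ f)^* ϖ` converges
absolutely and equals `a`. The integral is computed piece by piece in charts, and the value is the
same for all decompositions. -/
def HasLogArea (S : Set X) (f : X → Torus N) (ϖ : N [⋀^Fin 2]→ₗ[ℤ] ℤ) (a : ℝ) : Prop :=
  ∀ P : ChartPartition X,
    (∀ i, MeasureTheory.IntegrableOn
      (pullbackDensity ϖ fun z => logMap (f ((P.chart i).symm z)))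
      (P.chart i '' (P.piece i ∩ S))) ∧
    ∑ i, ∫ z in P.chart i '' (P.piece i ∩ S),
      pullbackDensity ϖ (fun z => logMap (f ((P.chart i).symm z))) z = a

theorem HasLogArea.unique [CompactSpace X] {S : Set X} {f : X → Torus N}
    {ϖ : N [⋀^Fin 2]→ₗ[ℤ] ℤ} {a a' : ℝ} (h : HasLogArea S f ϖ a) (h' : HasLogArea S f ϖ a') :
    a = a' := by
  obtain ⟨P⟩ := nonempty_chartPartition (X := X)
  exact (h P).2.symm.trans (h' P).2

/-- The logarithmic area `∫_S (log ∘ f)^* ϖ`. -/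
def logArea (S : Set X) (f : X → Torus N) (ϖ : N [⋀^Fin 2]→ₗ[ℤ] ℤ) : ℝ :=
  Classical.epsilon (HasLogArea S f ϖ)

/-- `h` computes the logarithmic area of `S` for every `2`-form `ϖ`, as `(π² / 2) ⟨h, ϖ⟩`. -/
def IsQuantumIndex (S : Set X) (f : X → Torus N) (h : ⋀[ℤ]^2 N) : Prop :=
  ∀ ϖ : N [⋀^Fin 2]→ₗ[ℤ] ℤ,
    logArea S f ϖ = Real.pi ^ 2 / 2 * (exteriorPower.alternatingMapLinearEquiv ϖ h : ℤ)

/-- The quantum index `h(S)`: the class in `Λ² N` that computes the logarithmic areas. -/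
def quantumIndex (S : Set X) (f : X → Torus N) : ⋀[ℤ]^2 N :=
  Classical.epsilon (IsQuantumIndex S f)

end Curve

end QuantumIndex

end

/-! Everything except the existence of the quantum index is naturality plus a convergence estimate.
Monomials, conjugation and the logarithm are natural in the lattice: `χ^m ∘ α = χ^(m ∘ A)` and `log
∘ α = A_ℝ ∘ log`. Hence α ∘ f is a real curve of degree A(Δ'), and the two area integrands agree
wherever the coordinates of log ∘ f are differentiable, that is off a finite set
(`pullbackDensity_rTensor`). For convergence, the density of dlog|g| ∧ dlog|h| is the imaginary part
of (g'/g) · conj(h'/h). At a common zero or pole its most singular term n m / |z - z₀|² is real, so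
what remains is O(1/|z - z₀|), which is integrable in the plane
(`exists_integrableOn_wedgeDensity`).

A quantum index exists because ∫_S dlog|x| ∧ dlog|y| is an integral multiple of π²/2 whenever x and
y are real functions with only real zeros and poles (`exists_setIntegral_eq`). If dx = 0 the
integral is 0. Otherwise consider the part of S over the upper half plane, with coordinate w = log x
in the strip 0 < Im w < π. The map x is proper there, since the real points bounding S have real
values (`eventually_fiber_subset`). The norm of y along x, the product of y over the points of S
above exp w, is therefore holomorphic without zeros off the critical values. It stays bounded above
and below near these, so it extends and has a logarithm F on the whole strip
(`exists_log_fiberProd`). Summing over the sheets, the area is the integral of -Im F'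
(`setIntegral_upperHalf`), and by integration along horizontal lines it depends only on the limits
of Im F at the two ends of the strip (`setIntegral_strip_im_deriv`).

The end Re w → -∞ sees the zeros of x. Near such a zero there is a coordinate t in which x = ±t^a, S
is the upper half disc and y ~ c t^b with c real (`exists_localForm`). The sheets are t = exp((w +
kπi)/a), so Im F tends to an explicit affine function of Im w, up to a multiple of π
(`HasStripEnd.exists_tendsto_im`). The upper and lower half planes, that is x and -x, together use
every k < a once, and the zero contributes ab · π²/2. The other end is the same statement for -1/x.
The multiples of π contribute multiples of π².

Applied to the coordinates of a basis, this gives the coefficients of h(S). Uniqueness holds because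
2-forms separate the points of the free module Λ²N, and Λ²A h(S) has the property that characterizes
h(α(S)). -/

noncomputable section

namespace QuantumIndex

open Set Filter Topology

/-! ### Meromorphic functions on a Riemann surface and their normal forms. -/

section Meromorphic

variable {X : Type*} [TopologicalSpace X] [ChartedSpace ℂ X]

/-- `x` is holomorphic and does not vanish at `p`. -/
def RegularAt (x : X → ℂ) (p : X) : Prop :=
  MDifferentiableAt 𝓘(ℂ) 𝓘(ℂ) x p ∧ x p ≠ 0

/-- `x` read in the preferred chart at `p`. -/
def chartRep (x : X → ℂ) (p : X) (z : ℂ) : ℂ := x ((chartAt ℂ p).symm z)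

/-- The order at `p` of a function on `X`. -/
def ordAt (x : X → ℂ) (p : X) : WithTop ℤ :=
  meromorphicOrderAt (chartRep x p) (chartAt ℂ p p)

/-- A meromorphic function on `X`, not vanishing identically near any point, with the value `0` at
its poles. -/
structure IsNormalMeromorphic (x : X → ℂ) : Prop where
  normalForm : ∀ p, MeromorphicNFAt (chartRep x p) (chartAt ℂ p p)
  ord_ne_top : ∀ p, ordAt x p ≠ ⊤

theorem chartRep_self (x : X → ℂ) (p : X) : chartRep x p (chartAt ℂ p p) = x p := by
  simp [chartRep]

theorem tendsto_chart_nhdsNE (p : X) :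
    Tendsto (chartAt ℂ p) (𝓝[≠] p) (𝓝[≠] (chartAt ℂ p p)) := by
  refine tendsto_nhdsWithin_iff.2 ⟨((chartAt ℂ p).continuousAt (mem_chart_source ℂ p)).tendsto.mono_left
    nhdsWithin_le_nhds, ?_⟩
  have h : ∀ᶠ q in 𝓝[≠] p, q ∈ (chartAt ℂ p).source :=
    eventually_nhdsWithin_of_eventually_nhds (chart_source_mem_nhds ℂ p)
  filter_upwards [h, self_mem_nhdsWithin] with q hq hqp he
  exact hqp ((chartAt ℂ p).injOn hq (mem_chart_source ℂ p) he)

theorem tendsto_chart_symm_nhdsNE (p : X) :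
    Tendsto (chartAt ℂ p).symm (𝓝[≠] (chartAt ℂ p p)) (𝓝[≠] p) := by
  have hc := (chartAt ℂ p).continuousAt_symm (mem_chart_target ℂ p)
  unfold ContinuousAt at hc
  rw [(chartAt ℂ p).left_inv (mem_chart_source ℂ p)] at hc
  refine tendsto_nhdsWithin_iff.2 ⟨hc.mono_left nhdsWithin_le_nhds, ?_⟩
  have h : ∀ᶠ z in 𝓝[≠] (chartAt ℂ p p), z ∈ (chartAt ℂ p).target :=
    eventually_nhdsWithin_of_eventually_nhds (chart_target_mem_nhds ℂ p)
  filter_upwards [h, self_mem_nhdsWithin] with z hz hzp he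
  apply hzp
  have := congrArg (chartAt ℂ p) (show (chartAt ℂ p).symm z = p from he)
  rwa [(chartAt ℂ p).right_inv hz] at this

theorem eventually_nhdsNE_of_chart {p : X} {Q : X → Prop}
    (h : ∀ᶠ z in 𝓝[≠] (chartAt ℂ p p), Q ((chartAt ℂ p).symm z)) : ∀ᶠ q in 𝓝[≠] p, Q q := by
  have h' : ∀ᶠ q in 𝓝[≠] p, q ∈ (chartAt ℂ p).source :=
    eventually_nhdsWithin_of_eventually_nhds (chart_source_mem_nhds ℂ p)
  filter_upwards [(tendsto_chart_nhdsNE p).eventually h, h'] with q hq hs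
  rwa [(chartAt ℂ p).left_inv hs] at hq

theorem nhdsNE_neBot (p : X) : (𝓝[≠] p).NeBot :=
  (tendsto_chart_symm_nhdsNE p).neBot

-- A compact space is covered by finitely many neighbourhoods, each meeting the set in at most its
-- centre.
omit [ChartedSpace ℂ X] in
theorem finite_of_eventually_nhdsNE [CompactSpace X] {s : Set X}
    (h : ∀ p, ∀ᶠ q in 𝓝[≠] p, q ∉ s) : s.Finite := by
  have := isCompact_univ.induction_on (p := fun A : Set X => (A ∩ s).Finite) (by simp)
    (fun A B hAB hB => hB.subset (inter_subset_inter_left _ hAB))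
    (fun A B hA hB => by rw [union_inter_distrib_right]; exact hA.union hB)
    (fun p _ => by
      obtain ⟨U, hU, hUs⟩ := (eventually_nhdsWithin_iff.1 (h p)).exists_mem
      refine ⟨U, mem_nhdsWithin_of_mem_nhds hU, (finite_singleton p).subset fun q hq => ?_⟩
      by_contra hqp
      exact hUs q hq.1 hqp hq.2)
  simpa using this

omit [ChartedSpace ℂ X] in
theorem eventually_nhdsNE_of_finite [T1Space X] {s : Set X} (hs : s.Finite) (p : X) :
    ∀ᶠ q in 𝓝[≠] p, q ∉ s := by
  have h : (s \ {p})ᶜ ∈ 𝓝 p :=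
    (hs.subset sdiff_subset).isClosed.isOpen_compl.mem_nhds (by simp)
  filter_upwards [mem_nhdsWithin_of_mem_nhds h, self_mem_nhdsWithin] with q hq hqp hqs
  exact hq ⟨hqs, hqp⟩

variable [IsManifold 𝓘(ℂ) 1 X]

theorem mdifferentiableAt_iff_chart {e : OpenPartialHomeomorph X ℂ} (he : e ∈ atlas ℂ X)
    {x : X → ℂ} {q : X} (hq : q ∈ e.source) :
    MDifferentiableAt 𝓘(ℂ) 𝓘(ℂ) x q ↔ DifferentiableAt ℂ (fun z => x (e.symm z)) (e q) := by
  rw [← mdifferentiableAt_iff_differentiableAt]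
  constructor
  · intro h
    refine MDifferentiableAt.comp (e q) (I' := 𝓘(ℂ)) (g := x) (f := e.symm) ?_
      (mdifferentiableAt_atlas_symm he (e.map_source hq))
    rwa [e.left_inv hq]
  · intro h
    have := MDifferentiableAt.comp q h (mdifferentiableAt_atlas he hq)
    refine this.congr_of_eventuallyEq ?_
    filter_upwards [e.open_source.mem_nhds hq] with q' hq'
    simp [e.left_inv hq']

theorem eventually_regularAt_of_chartRep {x : X → ℂ} {p : X}
    (hm : MeromorphicAt (chartRep x p) (chartAt ℂ p p)) (ht : ordAt x p ≠ ⊤) :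
    ∀ᶠ q in 𝓝[≠] p, RegularAt x q := by
  apply eventually_nhdsNE_of_chart
  have h : ∀ᶠ z in 𝓝[≠] (chartAt ℂ p p), z ∈ (chartAt ℂ p).target :=
    eventually_nhdsWithin_of_eventually_nhds (chart_target_mem_nhds ℂ p)
  filter_upwards [h, hm.eventually_analyticAt,
    (meromorphicOrderAt_ne_top_iff_eventually_ne_zero hm).1 ht] with z hz ha h0
  refine ⟨?_, h0⟩
  rw [mdifferentiableAt_iff_chart (chart_mem_atlas ℂ p) ((chartAt ℂ p).map_target hz),
    (chartAt ℂ p).right_inv hz]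
  exact ha.differentiableAt

namespace IsNormalMeromorphic

variable {x : X → ℂ} (hx : IsNormalMeromorphic x)
include hx

theorem eventually_regularAt (p : X) : ∀ᶠ q in 𝓝[≠] p, RegularAt x q :=
  eventually_regularAt_of_chartRep (hx.normalForm p).meromorphicAt (hx.ord_ne_top p)

theorem finite_not_regularAt [CompactSpace X] : {p | ¬ RegularAt x p}.Finite :=
  finite_of_eventually_nhdsNE fun p => by simpa using hx.eventually_regularAt p

omit [IsManifold 𝓘(ℂ) 1 X] in
theorem analyticAt_iff (p : X) : 0 ≤ ordAt x p ↔ AnalyticAt ℂ (chartRep x p) (chartAt ℂ p p) :=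
  (hx.normalForm p).meromorphicOrderAt_nonneg_iff_analyticAt

theorem mdifferentiableAt {p : X} (h : 0 ≤ ordAt x p) : MDifferentiableAt 𝓘(ℂ) 𝓘(ℂ) x p :=
  (mdifferentiableAt_iff_chart (chart_mem_atlas ℂ p) (mem_chart_source ℂ p)).2
    ((hx.analyticAt_iff p).1 h).differentiableAt

-- In normal form the value is 0 at zeros and at poles alike, so a non-zero value detects a point
-- that is neither. All later statements of the form `x p ≠ 0` rely on this convention.
omit [IsManifold 𝓘(ℂ) 1 X] in
theorem ordAt_eq_zero_iff {p : X} : ordAt x p = 0 ↔ x p ≠ 0 := by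
  rw [← chartRep_self x p]
  exact (hx.normalForm p).meromorphicOrderAt_eq_zero_iff

theorem regularAt_iff {p : X} : RegularAt x p ↔ x p ≠ 0 :=
  ⟨fun h => h.2, fun h => ⟨hx.mdifferentiableAt (hx.ordAt_eq_zero_iff.2 h).ge, h⟩⟩

omit [IsManifold 𝓘(ℂ) 1 X] in
theorem neg : IsNormalMeromorphic (-x) := by
  have h (p : X) : chartRep (-x) p = (fun _ => (-1 : ℂ)) * chartRep x p := by
    ext z; simp [chartRep]
  constructor
  · intro p
    rw [h]
    exact (meromorphicNFAt_mul_iff_right analyticAt_const (by simp)).2 (hx.normalForm p)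
  · intro p
    have := hx.ord_ne_top p
    rw [ordAt, h, meromorphicOrderAt_mul_of_ne_zero analyticAt_const (by simp)]
    exact this

omit [IsManifold 𝓘(ℂ) 1 X] in
theorem inv : IsNormalMeromorphic x⁻¹ := by
  have h (p : X) : chartRep x⁻¹ p = (chartRep x p)⁻¹ := by
    ext z; simp [chartRep]
  constructor
  · intro p
    rw [h]
    exact (hx.normalForm p).inv
  · intro p
    have := hx.ord_ne_top p
    rw [ordAt, h, meromorphicOrderAt_inv]
    unfold ordAt at this
    lift meromorphicOrderAt (chartRep x p) (chartAt ℂ p p) to ℤ using this with n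
    exact WithTop.coe_ne_top

end IsNormalMeromorphic

/-- The meromorphic function with values changed to the normal ones. -/
def normalize (x : X → ℂ) (p : X) : ℂ :=
  toMeromorphicNFAt (chartRep x p) (chartAt ℂ p p) (chartAt ℂ p p)

/-- Regularity at nearby points is needed because analyticity comes from complex differentiability
on a whole neighbourhood. -/
theorem normalize_eq_of_regularAt {x : X → ℂ} {p : X} (h : RegularAt x p)
    (hm : ∀ᶠ q in 𝓝[≠] p, RegularAt x q) : normalize x p = x p := by
  have ha : AnalyticAt ℂ (chartRep x p) (chartAt ℂ p p) := by
    rw [Complex.analyticAt_iff_eventually_differentiableAt]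
    have h' : ∀ᶠ q in 𝓝 p, RegularAt x q := by
      rw [eventually_nhdsWithin_iff] at hm
      filter_upwards [hm] with q hq
      by_cases hqp : q = p
      · exact hqp ▸ h
      · exact hq hqp
    have hc := (chartAt ℂ p).continuousAt_symm (mem_chart_target ℂ p)
    unfold ContinuousAt at hc
    rw [(chartAt ℂ p).left_inv (mem_chart_source ℂ p)] at hc
    filter_upwards [hc.eventually h', chart_target_mem_nhds ℂ p] with z hz ht
    have := (mdifferentiableAt_iff_chart (chart_mem_atlas ℂ p)
      ((chartAt ℂ p).map_target ht)).1 hz.1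
    rwa [(chartAt ℂ p).right_inv ht] at this
  rw [normalize, toMeromorphicNFAt_eq_self.2 ha.meromorphicNFAt, chartRep_self]

/-- The values of `normalize` at different points come from different preferred charts. Near `p`
this does no harm: off `p` both sides are the unchanged function, and at `p` they agree by
definition. -/
theorem chartRep_normalize [T1Space X] {x : X → ℂ} {p : X}
    (hm : MeromorphicAt (chartRep x p) (chartAt ℂ p p)) (ht : ordAt x p ≠ ⊤) :
    chartRep (normalize x) p =ᶠ[𝓝 (chartAt ℂ p p)]
      toMeromorphicNFAt (chartRep x p) (chartAt ℂ p p) := by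
  apply eventuallyEq_nhds_of_eventuallyEq_nhdsNE
  · have h1 : ∀ᶠ q in 𝓝[≠] p, normalize x q = x q := by
      have := eventually_regularAt_of_chartRep hm ht
      filter_upwards [this, eventually_eventually_nhdsWithin.2 this, self_mem_nhdsWithin]
        with q h1 h2 h3
      rw [isOpen_compl_singleton.nhdsWithin_eq h3] at h2
      exact normalize_eq_of_regularAt h1 (h2.filter_mono nhdsWithin_le_nhds)
    filter_upwards [(tendsto_chart_symm_nhdsNE p).eventually h1, hm.eq_nhdsNE_toMeromorphicNFAt]
      with z h1 h2
    rw [← h2]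
    exact h1
  · simp [chartRep, normalize]

theorem isNormalMeromorphic_normalize [T1Space X] {x : X → ℂ}
    (hm : ∀ p, MeromorphicAt (chartRep x p) (chartAt ℂ p p)) (ht : ∀ p, ordAt x p ≠ ⊤) :
    IsNormalMeromorphic (normalize x) := by
  constructor
  · intro p
    rw [meromorphicNFAt_congr (chartRep_normalize (hm p) (ht p))]
    exact meromorphicNFAt_toMeromorphicNFAt
  · intro p
    rw [ordAt, meromorphicOrderAt_congr ((chartRep_normalize (hm p) (ht p)).filter_mono
      nhdsWithin_le_nhds), (hm p).meromorphicOrderAt_toMeromorphicNFAt]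
    exact ht p

theorem ordAt_normalize [T1Space X] {x : X → ℂ} {p : X}
    (hm : MeromorphicAt (chartRep x p) (chartAt ℂ p p)) (ht : ordAt x p ≠ ⊤) :
    ordAt (normalize x) p = ordAt x p := by
  rw [ordAt, meromorphicOrderAt_congr ((chartRep_normalize hm ht).filter_mono
      nhdsWithin_le_nhds), hm.meromorphicOrderAt_toMeromorphicNFAt, ordAt]

end Meromorphic

end QuantumIndex

end

/-! ### Integration of du ∧ dv over a surface, independently of charts. -/

noncomputable section

namespace QuantumIndex

open Set Filter Topology MeasureTheory

/-- The coefficient of `du ∧ dv` with respect to `dx ∧ dy`. -/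
def wedgeDensity (u v : ℂ → ℝ) (z : ℂ) : ℝ :=
  fderiv ℝ u z 1 * fderiv ℝ v z Complex.I - fderiv ℝ u z Complex.I * fderiv ℝ v z 1

theorem measurable_wedgeDensity (u v : ℂ → ℝ) : Measurable (wedgeDensity u v) := by
  unfold wedgeDensity
  exact ((measurable_fderiv_apply_const ℝ u 1).mul (measurable_fderiv_apply_const ℝ v _)).sub
    ((measurable_fderiv_apply_const ℝ u _).mul (measurable_fderiv_apply_const ℝ v 1))

theorem wedgeDensity_congr {u v u' v' : ℂ → ℝ} {z : ℂ} (hu : u =ᶠ[𝓝 z] u') (hv : v =ᶠ[𝓝 z] v') :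
    wedgeDensity u v z = wedgeDensity u' v' z := by
  simp [wedgeDensity, hu.fderiv_eq, hv.fderiv_eq]

/-- The real Jacobian determinant of a holomorphic map is |φ'|² ≥ 0, so the coefficient of a 2-form
transforms exactly as in the change of variables formula, without sign. -/
theorem wedgeDensity_comp {u v : ℂ → ℝ} {φ : ℂ → ℂ} {c z : ℂ} (hφ : HasDerivAt φ c z)
    (hu : DifferentiableAt ℝ u (φ z)) (hv : DifferentiableAt ℝ v (φ z)) :
    wedgeDensity (u ∘ φ) (v ∘ φ) z = ‖c‖ ^ 2 * wedgeDensity u v (φ z) := by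
  have hφ' := hφ.hasFDerivAt.restrictScalars ℝ
  have key (u : ℂ → ℝ) (hu : DifferentiableAt ℝ u (φ z)) (t : ℂ) :
      fderiv ℝ (u ∘ φ) z t = (t * c).re * fderiv ℝ u (φ z) 1
        + (t * c).im * fderiv ℝ u (φ z) Complex.I := by
    rw [(hu.hasFDerivAt.comp z hφ').fderiv]
    have h : t * c = (t * c).re • (1 : ℂ) + (t * c).im • Complex.I := by
      apply Complex.ext <;> simp
    simp only [ContinuousLinearMap.comp_apply, ContinuousLinearMap.coe_restrictScalars',
      ContinuousLinearMap.toSpanSingleton_apply, smul_eq_mul]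
    conv_lhs => rw [h]
    rw [map_add, map_smul, map_smul]
    simp
  simp only [wedgeDensity, key u hu, key v hv]
  rw [← Complex.normSq_eq_norm_sq, Complex.normSq_apply]
  simp
  ring

theorem det_toSpanSingleton_restrictScalars (c : ℂ) :
    ((ContinuousLinearMap.toSpanSingleton ℂ c).restrictScalars ℝ).det = ‖c‖ ^ 2 := by
  simp [ContinuousLinearMap.det, LinearMap.det_restrictScalars,
      Algebra.norm_complex_eq, Complex.normSq_eq_norm_sq]

variable {X : Type*} [TopologicalSpace X] [ChartedSpace ℂ X]

/-- `u` is real differentiable at `q`, in every chart. -/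
def RealDifferentiableAt (u : X → ℝ) (q : X) : Prop :=
  ∀ e ∈ atlas ℂ X, q ∈ e.source → DifferentiableAt ℝ (fun z => u (e.symm z)) (e q)

section Measure

variable [MeasurableSpace X] [BorelSpace X]

theorem ChartPartition.measurableSet_piece (Q : ChartPartition X) (i : Fin Q.size) :
    MeasurableSet (Q.piece i) := by
  have := Q.measurable i
  rwa [← BorelSpace.measurable_eq (α := X)] at this

omit [ChartedSpace ℂ X] in
theorem measurableSet_chart_image (e : OpenPartialHomeomorph X ℂ) {E : Set X}
    (hE : MeasurableSet E) (hs : E ⊆ e.source) : MeasurableSet (e '' E) := by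
  have h1 : e '' E = Subtype.val '' ((fun z : e.target => e.symm z) ⁻¹' E) := by
    rw [e.image_eq_target_inter_inv_preimage hs]
    ext z
    simp [and_comm]
  rw [h1]
  refine (MeasurableEmbedding.subtype_coe e.open_target.measurableSet).measurableSet_image.2 ?_
  exact (continuousOn_iff_continuous_domRestrict.1 e.continuousOn_symm).measurable hE

variable (Q : ChartPartition X)

/-- Lebesgue measure in the charts of a partition. -/
def areaMeasure : Measure X :=
  ∑ i, (volume.restrict (Q.chart i '' Q.piece i)).map (Q.chart i).symm

/-- The density of `du ∧ dv` with respect to `areaMeasure Q`. -/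
def areaDensity (u v : X → ℝ) (p : X) : ℝ :=
  ∑ i, (Q.piece i).indicator (fun p => wedgeDensity (fun z => u ((Q.chart i).symm z))
    (fun z => v ((Q.chart i).symm z)) (Q.chart i p)) p

theorem measurable_areaDensity (u v : X → ℝ) : Measurable (areaDensity Q u v) := by
  classical
  refine Finset.measurable_fun_sum _ fun i _ => ?_
  have h : Measurable ((Q.piece i).piecewise (Q.chart i) (fun _ => (0 : ℂ))) :=
    ((Q.chart i).continuousOn.mono (Q.subset i)).measurable_piecewise continuousOn_const
      (Q.measurableSet_piece i)
  have h' := ((measurable_wedgeDensity (fun z => u ((Q.chart i).symm z))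
    (fun z => v ((Q.chart i).symm z))).comp h).indicator (Q.measurableSet_piece i)
  convert h' using 1
  ext p
  by_cases hp : p ∈ Q.piece i <;> simp [hp]

omit [MeasurableSpace X] [BorelSpace X] in
theorem areaDensity_of_mem (u v : X → ℝ) {i : Fin Q.size} {p : X} (hp : p ∈ Q.piece i) :
    areaDensity Q u v p = wedgeDensity (fun z => u ((Q.chart i).symm z))
    (fun z => v ((Q.chart i).symm z)) (Q.chart i p) := by
  rw [areaDensity, Finset.sum_eq_single i, indicator_of_mem hp]
  · intro j _ hj
    exact indicator_of_notMem (fun h => (Q.disjoint hj).le_bot ⟨h, hp⟩) _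
  · simp

omit [MeasurableSpace X] [BorelSpace X] in
theorem ChartPartition.image_inter (E : Set X) (i : Fin Q.size) :
    Q.chart i '' (Q.piece i ∩ E) = (Q.chart i).symm ⁻¹' E ∩ Q.chart i '' Q.piece i := by
  ext z
  constructor
  · rintro ⟨p, ⟨hp, hE⟩, rfl⟩
    refine ⟨?_, p, hp, rfl⟩
    simpa [(Q.chart i).left_inv (Q.subset i hp)] using hE
  · rintro ⟨hE, p, hp, rfl⟩
    refine ⟨p, ⟨hp, ?_⟩, rfl⟩
    simpa [(Q.chart i).left_inv (Q.subset i hp)] using hE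

theorem aemeasurable_chart_symm (i : Fin Q.size) :
    AEMeasurable (Q.chart i).symm (volume.restrict (Q.chart i '' Q.piece i)) :=
  ((Q.chart i).continuousOn_symm.mono (by
    rintro _ ⟨p, hp, rfl⟩
    exact (Q.chart i).map_source (Q.subset i hp))).aemeasurable
    (measurableSet_chart_image _ (Q.measurableSet_piece i) (Q.subset i))

theorem areaMeasure_restrict {E : Set X} (hE : MeasurableSet E) :
    (areaMeasure Q).restrict E =
      ∑ i, (volume.restrict (Q.chart i '' (Q.piece i ∩ E))).map (Q.chart i).symm := by
  have h (i : Fin Q.size) : (volume.restrict (Q.chart i '' (Q.piece i ∩ E))).map (Q.chart i).symm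
      = ((volume.restrict (Q.chart i '' (Q.piece i))).map (Q.chart i).symm).restrict E := by
    rw [Measure.restrict_map_of_aemeasurable (aemeasurable_chart_symm Q i) hE,
      Measure.restrict_restrict' (measurableSet_chart_image _ (Q.measurableSet_piece i) (Q.subset i)),
      Q.image_inter]
  simp_rw [h]
  ext A hA
  simp [areaMeasure, Measure.restrict_apply hA, Measure.finsetSum_apply]

/-- `areaMeasure` and `areaDensity` both depend on the partition, but together they represent du ∧
dv. They turn the sums over charts into integrals of one function over `X`, to which additivity and
null sets apply. -/
theorem integrableOn_areaDensity_iff (u v : X → ℝ) {E : Set X} (hE : MeasurableSet E) :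
    IntegrableOn (areaDensity Q u v) E (areaMeasure Q) ↔
      ∀ i, IntegrableOn (wedgeDensity (fun z => u ((Q.chart i).symm z))
        (fun z => v ((Q.chart i).symm z))) (Q.chart i '' (Q.piece i ∩ E)) := by
  rw [IntegrableOn, areaMeasure_restrict Q hE, integrable_finsetSum_measure]
  simp only [Finset.mem_univ, true_implies]
  refine forall_congr' fun i => ?_
  have hm : AEMeasurable (Q.chart i).symm (volume.restrict (Q.chart i '' (Q.piece i ∩ E))) :=
    (aemeasurable_chart_symm Q i).mono_measure (Measure.restrict_mono (image_mono inter_subset_left) le_rfl)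
  rw [integrable_map_measure (measurable_areaDensity Q u v).aestronglyMeasurable hm]
  refine integrableOn_congr_fun ?_ (measurableSet_chart_image _
    ((Q.measurableSet_piece i).inter hE) (inter_subset_left.trans (Q.subset i)))
  rintro _ ⟨p, hp, rfl⟩
  simp only [Function.comp_apply, (Q.chart i).left_inv (Q.subset i hp.1)]
  exact areaDensity_of_mem Q u v hp.1

theorem setIntegral_areaDensity (u v : X → ℝ) {E : Set X} (hE : MeasurableSet E)
    (hi : IntegrableOn (areaDensity Q u v) E (areaMeasure Q)) :
    ∫ p in E, areaDensity Q u v p ∂areaMeasure Q =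
      ∑ i, ∫ z in Q.chart i '' (Q.piece i ∩ E), wedgeDensity (fun z => u ((Q.chart i).symm z))
        (fun z => v ((Q.chart i).symm z)) z := by
  rw [IntegrableOn, areaMeasure_restrict Q hE, integrable_finsetSum_measure] at hi
  rw [areaMeasure_restrict Q hE, integral_finsetSum_measure hi]
  refine Finset.sum_congr rfl fun i _ => ?_
  have hm : AEMeasurable (Q.chart i).symm (volume.restrict (Q.chart i '' (Q.piece i ∩ E))) :=
    (aemeasurable_chart_symm Q i).mono_measure (Measure.restrict_mono (image_mono inter_subset_left) le_rfl)
  rw [integral_map hm (measurable_areaDensity Q u v).aestronglyMeasurable]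
  refine setIntegral_congr_fun (measurableSet_chart_image _
    ((Q.measurableSet_piece i).inter hE) (inter_subset_left.trans (Q.subset i))) ?_
  rintro _ ⟨p, hp, rfl⟩
  simp only [(Q.chart i).left_inv (Q.subset i hp.1)]
  exact areaDensity_of_mem Q u v hp.1

theorem areaMeasure_finite {F : Set X} (hF : F.Finite) (hFm : MeasurableSet F) :
    areaMeasure Q F = 0 := by
  rw [← Measure.restrict_eq_zero, areaMeasure_restrict Q hFm]
  refine Finset.sum_eq_zero fun i _ => ?_
  have : volume (Q.chart i '' (Q.piece i ∩ F)) = 0 :=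
    ((hF.subset inter_subset_right).image _).measure_zero _
  simp [Measure.restrict_eq_zero.2 this]

end Measure

section Parametrization

variable [MeasurableSpace X] [BorelSpace X] [T2Space X] [IsManifold 𝓘(ℂ) 1 X] (Q : ChartPartition X)

/-- A holomorphic parametrization `κ` of a part of `X`, defined on `V`. -/
structure IsParametrization (κ : ℂ → X) (V : Set ℂ) : Prop where
  isOpen : IsOpen V
  mdifferentiableAt : ∀ z ∈ V, MDifferentiableAt 𝓘(ℂ) 𝓘(ℂ) κ z
  injOn : InjOn κ V

omit [MeasurableSpace X] [BorelSpace X] [T2Space X] in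
theorem isParametrization_chart_symm {e : OpenPartialHomeomorph X ℂ} (he : e ∈ atlas ℂ X) :
    IsParametrization e.symm e.target :=
  ⟨e.open_target, fun _ hz => mdifferentiableAt_atlas_symm he hz, e.symm.injOn⟩

variable {κ : ℂ → X} {V : Set ℂ} (hκ : IsParametrization κ V)
include hκ

omit [MeasurableSpace X] [BorelSpace X] [T2Space X] [IsManifold 𝓘(ℂ) 1 X] in
theorem IsParametrization.continuousOn : ContinuousOn κ V := fun z hz =>
  (hκ.mdifferentiableAt z hz).continuousAt.continuousWithinAt

omit [IsManifold 𝓘(ℂ) 1 X] in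
theorem IsParametrization.measurableSet_image {T : Set ℂ} (hT : MeasurableSet T) (hTV : T ⊆ V) :
    MeasurableSet (κ '' T) :=
  hT.image_of_continuousOn_injOn (hκ.continuousOn.mono hTV) (hκ.injOn.mono hTV)

omit [IsManifold 𝓘(ℂ) 1 X] [T2Space X] in
theorem IsParametrization.measurableSet_preimage {T : Set ℂ} (hT : MeasurableSet T) (hTV : T ⊆ V)
    {E : Set X} (hE : MeasurableSet E) : MeasurableSet (T ∩ κ ⁻¹' E) := by
  have h1 : T ∩ κ ⁻¹' E = Subtype.val '' ((fun z : T => κ z) ⁻¹' E) := by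
    ext z
    simp [and_comm]
  rw [h1]
  refine (MeasurableEmbedding.subtype_coe hT).measurableSet_image.2 ?_
  exact (continuousOn_iff_continuous_domRestrict.1 (hκ.continuousOn.mono hTV)).measurable hE

omit [T2Space X] in
-- Change of variables along chart ∘ κ, which is holomorphic and injective on the relevant set. The
-- Jacobian cancels against the factor in `wedgeDensity_comp`.
theorem IsParametrization.chart_piece {u v : X → ℝ} {P : Set X} (hP : P.Finite)
    (hu : ∀ q ∉ P, RealDifferentiableAt u q) (hv : ∀ q ∉ P, RealDifferentiableAt v q)
    {T : Set ℂ} (hT : MeasurableSet T) (hTV : T ⊆ V) (i : Fin Q.size) :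
    (IntegrableOn (wedgeDensity (fun z => u ((Q.chart i).symm z))
        (fun z => v ((Q.chart i).symm z))) (Q.chart i '' (Q.piece i ∩ κ '' T)) ↔
      IntegrableOn (wedgeDensity (fun z => u (κ z)) (fun z => v (κ z))) (T ∩ κ ⁻¹' Q.piece i)) ∧
    ∫ z in Q.chart i '' (Q.piece i ∩ κ '' T), wedgeDensity (fun z => u ((Q.chart i).symm z))
        (fun z => v ((Q.chart i).symm z)) z =
      ∫ z in T ∩ κ ⁻¹' Q.piece i, wedgeDensity (fun z => u (κ z)) (fun z => v (κ z)) z := by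
  set T' := T ∩ κ ⁻¹' Q.piece i with hT'
  have hT'm : MeasurableSet T' := hκ.measurableSet_preimage hT hTV (Q.measurableSet_piece i)
  set φ : ℂ → ℂ := fun z => Q.chart i (κ z) with hφ
  have himg : Q.chart i '' (Q.piece i ∩ κ '' T) = φ '' T' := by
    ext w
    constructor
    · rintro ⟨_, ⟨hp, z, hz, rfl⟩, rfl⟩
      exact ⟨z, ⟨hz, hp⟩, rfl⟩
    · rintro ⟨z, ⟨hz, hp⟩, rfl⟩
      exact ⟨κ z, ⟨hp, z, hz, rfl⟩, rfl⟩
  have hinj : InjOn φ T' := fun z hz w hw h =>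
    hκ.injOn (hTV hz.1) (hTV hw.1)
      ((Q.chart i).injOn (Q.subset i hz.2) (Q.subset i hw.2) h)
  have hd : ∀ z ∈ T', HasDerivAt φ (deriv φ z) z := fun z hz => by
    have := (mdifferentiableAt_atlas (Q.chart_mem i) (Q.subset i hz.2)).comp z
      (hκ.mdifferentiableAt z (hTV hz.1))
    exact (mdifferentiableAt_iff_differentiableAt.1 this).hasDerivAt
  have hfd : ∀ z ∈ T', HasFDerivWithinAt φ
      ((ContinuousLinearMap.toSpanSingleton ℂ (deriv φ z)).restrictScalars ℝ) T' z := fun z hz =>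
    ((hd z hz).hasFDerivAt.restrictScalars ℝ).hasFDerivWithinAt
  have hae : (fun z => |((ContinuousLinearMap.toSpanSingleton ℂ (deriv φ z)).restrictScalars ℝ).det| •
      wedgeDensity (fun z => u ((Q.chart i).symm z)) (fun z => v ((Q.chart i).symm z)) (φ z))
      =ᵐ[volume.restrict T'] wedgeDensity (fun z => u (κ z)) (fun z => v (κ z)) := by
    -- The parametrization is injective, so the exceptional points pull back to a finite, hence
    -- null, set.
    have hfin : (T' ∩ κ ⁻¹' P).Finite :=
      Set.Finite.of_finite_image (hP.subset (by rintro _ ⟨z, hz, rfl⟩; exact hz.2))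
        (hκ.injOn.mono fun z hz => hTV hz.1.1)
    have h0 : ∀ᵐ z ∂(volume.restrict T'), z ∉ T' ∩ κ ⁻¹' P :=
      compl_mem_ae_iff.2 (nonpos_iff_eq_zero.1
        ((Measure.restrict_apply_le _ _).trans (hfin.measure_zero volume).le))
    filter_upwards [h0, ae_restrict_mem hT'm] with z hz hzT
    have hzP : κ z ∉ P := fun h => hz ⟨hzT, h⟩
    rw [det_toSpanSingleton_restrictScalars, abs_of_nonneg (by positivity), smul_eq_mul,
      ← wedgeDensity_comp (hd z hzT) (hu _ hzP _ (Q.chart_mem i) (Q.subset i hzT.2))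
        (hv _ hzP _ (Q.chart_mem i) (Q.subset i hzT.2))]
    have hev : ∀ᶠ w in 𝓝 z, (Q.chart i).symm (φ w) = κ w := by
      have := (hκ.mdifferentiableAt z (hTV hzT.1)).continuousAt.eventually
        ((Q.chart i).open_source.mem_nhds (Q.subset i hzT.2))
      filter_upwards [this] with w hw
      exact (Q.chart i).left_inv hw
    apply wedgeDensity_congr
    · filter_upwards [hev] with w hw
      simp [hw]
    · filter_upwards [hev] with w hw
      simp [hw]
  rw [himg]
  constructor
  · rw [integrableOn_image_iff_integrableOn_abs_det_fderiv_smul volume hT'm hfd hinj]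
    exact integrable_congr hae
  · rw [integral_image_eq_integral_abs_det_fderiv_smul volume hT'm hfd hinj]
    exact integral_congr_ae hae

/-- The condition on `T` does not involve `Q`. This and the companion formula for the integral serve
both for the independence of the partition and for integrating over the sheets of x. -/
theorem IsParametrization.integrableOn_iff {u v : X → ℝ} {P : Set X} (hP : P.Finite)
    (hu : ∀ q ∉ P, RealDifferentiableAt u q) (hv : ∀ q ∉ P, RealDifferentiableAt v q)
    {T : Set ℂ} (hT : MeasurableSet T) (hTV : T ⊆ V) :
    IntegrableOn (areaDensity Q u v) (κ '' T) (areaMeasure Q) ↔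
      IntegrableOn (wedgeDensity (fun z => u (κ z)) (fun z => v (κ z))) T := by
  rw [integrableOn_areaDensity_iff Q u v (hκ.measurableSet_image hT hTV)]
  simp_rw [fun i => (hκ.chart_piece Q hP hu hv hT hTV i).1]
  rw [← integrableOn_finite_iUnion, ← inter_iUnion, ← preimage_iUnion, Q.covers, preimage_univ,
    inter_univ]

theorem IsParametrization.setIntegral {u v : X → ℝ} {P : Set X} (hP : P.Finite)
    (hu : ∀ q ∉ P, RealDifferentiableAt u q) (hv : ∀ q ∉ P, RealDifferentiableAt v q)
    {T : Set ℂ} (hT : MeasurableSet T) (hTV : T ⊆ V)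
    (hi : IntegrableOn (areaDensity Q u v) (κ '' T) (areaMeasure Q)) :
    ∫ p in κ '' T, areaDensity Q u v p ∂areaMeasure Q =
      ∫ z in T, wedgeDensity (fun z => u (κ z)) (fun z => v (κ z)) z := by
  have hi' := (hκ.integrableOn_iff Q hP hu hv hT hTV).1 hi
  rw [setIntegral_areaDensity Q u v (hκ.measurableSet_image hT hTV) hi]
  simp_rw [fun i => (hκ.chart_piece Q hP hu hv hT hTV i).2]
  have hU : T = ⋃ i, T ∩ κ ⁻¹' Q.piece i := by
    rw [← inter_iUnion, ← preimage_iUnion, Q.covers, preimage_univ, inter_univ]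
  conv_rhs => rw [hU]
  rw [integral_iUnion_fintype]
  · exact fun i => hκ.measurableSet_preimage hT hTV (Q.measurableSet_piece i)
  · intro i j hij
    exact (((Q.disjoint hij).preimage κ).mono inter_subset_right inter_subset_right)
  · exact fun i => hi'.mono_set inter_subset_left

end Parametrization

end QuantumIndex

end

/-! ### Logarithmic forms and the convergence of the area. -/

noncomputable section

namespace QuantumIndex

open Set Filter Topology MeasureTheory

/-- Locally log|g| = Re log g. Writing it as half the logarithm of |g|² avoids choosing a branch. -/
theorem hasFDerivAt_log_norm {g : ℂ → ℂ} {z : ℂ} (hg : DifferentiableAt ℂ g z) (h0 : g z ≠ 0) :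
    HasFDerivAt (fun w => Real.log ‖g w‖)
      (Complex.reCLM.comp
        ((ContinuousLinearMap.toSpanSingleton ℂ (logDeriv g z)).restrictScalars ℝ)) z := by
  have h1 := (hg.hasDerivAt.hasFDerivAt.restrictScalars ℝ).norm_sq.log
    (pow_ne_zero 2 (norm_ne_zero_iff.2 h0))
  have h2 := h1.const_smul (1 / 2 : ℝ)
  refine (h2.congr_fderiv ?_).congr_of_eventuallyEq ?_
  · ext t
    have hn : Complex.normSq (g z) ≠ 0 := by simpa using h0
    rw [← Complex.normSq_eq_norm_sq]
    simp only [_root_.smul_apply, ContinuousLinearMap.comp_apply, logDeriv_apply,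
      ContinuousLinearMap.coe_restrictScalars', ContinuousLinearMap.toSpanSingleton_apply,
      innerSL_apply_apply, Complex.inner, smul_eq_mul, Complex.reCLM_apply]
    simp only [Complex.mul_re, Complex.mul_im, Complex.div_re, Complex.div_im, Complex.conj_re,
      Complex.conj_im]
    field_simp
    ring
  · filter_upwards with w
    simp [Real.log_pow]

theorem wedgeDensity_log_norm {g h : ℂ → ℂ} {z : ℂ} (hg : DifferentiableAt ℂ g z) (hg0 : g z ≠ 0)
    (hh : DifferentiableAt ℂ h z) (hh0 : h z ≠ 0) :
    wedgeDensity (fun w => Real.log ‖g w‖) (fun w => Real.log ‖h w‖) z =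
      (logDeriv g z * starRingEnd ℂ (logDeriv h z)).im := by
  rw [wedgeDensity, (hasFDerivAt_log_norm hg hg0).fderiv, (hasFDerivAt_log_norm hh hh0).fderiv]
  simp

/-- Write g = (z - z₀)^n h with h(z₀) ≠ 0; then k = h'/h. -/
theorem exists_bound_logDeriv {g : ℂ → ℂ} {z₀ : ℂ} (hm : MeromorphicAt g z₀)
    (ht : meromorphicOrderAt g z₀ ≠ ⊤) :
    ∃ (n : ℤ) (k : ℂ → ℂ), AnalyticAt ℂ k z₀ ∧
      ∀ᶠ z in 𝓝[≠] z₀, DifferentiableAt ℂ g z ∧ g z ≠ 0 ∧ logDeriv g z = n / (z - z₀) + k z := by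
  lift meromorphicOrderAt g z₀ to ℤ using ht with n hn
  obtain ⟨h, ha, h0, he⟩ := (meromorphicOrderAt_eq_int_iff hm).1 hn.symm
  refine ⟨n, logDeriv h, ha.deriv.div ha h0, ?_⟩
  have he' : ∀ᶠ z in 𝓝[≠] z₀, g =ᶠ[𝓝 z] fun z => (z - z₀) ^ n • h z := by
    filter_upwards [eventually_eventually_nhdsWithin.2 he, self_mem_nhdsWithin] with z hz hne
    rwa [isOpen_compl_singleton.nhdsWithin_eq hne] at hz
  have ha' := eventually_nhdsWithin_of_eventually_nhds (s := {z₀}ᶜ) ha.eventually_analyticAt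
  have h0' := eventually_nhdsWithin_of_eventually_nhds (s := {z₀}ᶜ)
    (ha.continuousAt.eventually_ne h0)
  filter_upwards [he', ha', h0', self_mem_nhdsWithin] with z h1 h2 h3 hne
  have hne' : z - z₀ ≠ 0 := sub_ne_zero.2 hne
  have hd : DifferentiableAt ℂ (fun z => (z - z₀) ^ n) z :=
    (differentiableAt_id.sub_const z₀).zpow (Or.inl hne')
  have hd2 : DifferentiableAt ℂ (fun z => (z - z₀) ^ n • h z) z := hd.smul h2.differentiableAt
  refine ⟨h1.differentiableAt_iff.2 hd2, ?_, ?_⟩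
  · rw [h1.eq_of_nhds]
    exact smul_ne_zero (zpow_ne_zero _ hne') h3
  · rw [logDeriv_apply, h1.deriv_eq, h1.eq_of_nhds, ← logDeriv_apply]
    simp only [smul_eq_mul]
    rw [logDeriv_mul (f := fun z => (z - z₀) ^ n) (g := h) z (zpow_ne_zero _ hne') h3 hd h2.differentiableAt]
    congr 1
    have := logDeriv_fun_zpow (f := fun z => z - z₀) (x := z) (by fun_prop) n
    rw [this, logDeriv_apply]
    simp [div_eq_mul_inv]

/-- With g'/g = n/(z - z₀) + k and h'/h = m/(z - z₀) + l, the product of the polar parts in (g'/g) ·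
conj(h'/h) is real. The imaginary part is then bounded by a multiple of 1/|z - z₀|, which is locally
integrable in real dimension two. -/
theorem exists_integrableOn_wedgeDensity {g h : ℂ → ℂ} {z₀ : ℂ} (hg : MeromorphicAt g z₀)
    (hg' : meromorphicOrderAt g z₀ ≠ ⊤) (hh : MeromorphicAt h z₀)
    (hh' : meromorphicOrderAt h z₀ ≠ ⊤) :
    ∃ U ∈ 𝓝 z₀, IntegrableOn
      (wedgeDensity (fun w => Real.log ‖g w‖) (fun w => Real.log ‖h w‖)) U := by
  obtain ⟨n, k, hk, hgk⟩ := exists_bound_logDeriv hg hg'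
  obtain ⟨m, l, hl, hhl⟩ := exists_bound_logDeriv hh hh'
  obtain ⟨K, hK⟩ := hk.continuousAt.norm.isBoundedUnder_le
  obtain ⟨L, hL⟩ := hl.continuousAt.norm.isBoundedUnder_le
  rw [eventually_map] at hK hL
  rw [eventually_nhdsWithin_iff] at hgk hhl
  obtain ⟨r, hr, hball⟩ := Metric.eventually_nhds_iff_ball.1 (hgk.and (hhl.and (hK.and hL)))
  refine ⟨Metric.ball z₀ (min r 1), Metric.ball_mem_nhds _ (by positivity), ?_⟩
  -- The two mixed terms and the regular term. The radius is at most 1 so that the regular term is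
  -- also bounded by a multiple of 1/|z - z₀|.
  set C : ℝ := |(n : ℝ)| * L + |(m : ℝ)| * K + K * L with hC
  have hint : IntegrableOn (fun z : ℂ => C * ‖z - z₀‖⁻¹) (Metric.ball z₀ (min r 1)) := by
    have h1 : LocallyIntegrable (fun z : ℂ => ‖z‖⁻¹) := by
      refine locallyIntegrable_of_norm_le_rpow (E := ℂ) (C := 1) (α := 1) (by simp) (by simp) ?_
        (by fun_prop)
      filter_upwards with z
      simp [Real.rpow_neg_one]
    have h2 : IntegrableOn (fun z : ℂ => ‖z‖⁻¹) (Metric.ball 0 (min r 1)) :=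
      (h1.integrableOn_isCompact (isCompact_closedBall 0 (min r 1))).mono_set
        Metric.ball_subset_closedBall
    have h3 := (measurePreserving_sub_right volume z₀).integrableOn_comp_preimage
      (Homeomorph.subRight z₀).measurableEmbedding (f := fun z : ℂ => ‖z‖⁻¹)
      (s := Metric.ball 0 (min r 1))
    have h4 := h3.2 h2
    have h5 : (fun x => x - z₀) ⁻¹' Metric.ball (0 : ℂ) (min r 1) = Metric.ball z₀ (min r 1) := by
      ext z; simp [dist_eq_norm]
    rw [h5] at h4
    exact h4.const_mul C
  refine hint.mono' (measurable_wedgeDensity _ _).aestronglyMeasurable ?_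
  have hae : ∀ᵐ z ∂(volume.restrict (Metric.ball z₀ (min r 1))), z ≠ z₀ := by
    refine ae_restrict_of_ae ?_
    exact compl_mem_ae_iff.2 (measure_singleton z₀)
  filter_upwards [hae, ae_restrict_mem Metric.isOpen_ball.measurableSet] with z hz hzb
  have hzr : z ∈ Metric.ball z₀ r := Metric.ball_subset_ball (min_le_left _ _) hzb
  have hz1 : ‖z - z₀‖ ≤ 1 := by
    have := Metric.ball_subset_ball (min_le_right _ _) hzb
    rw [Metric.mem_ball, dist_eq_norm] at this
    exact this.le
  obtain ⟨h1, h2, h3, h4⟩ := hball z hzr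
  obtain ⟨hd1, hn1, he1⟩ := h1 hz
  obtain ⟨hd2, hn2, he2⟩ := h2 hz
  rw [wedgeDensity_log_norm hd1 hn1 hd2 hn2, he1, he2]
  have hpos : 0 < ‖z - z₀‖ := norm_pos_iff.2 (sub_ne_zero.2 hz)
  -- The term n m / |z - z₀|² disappears here, being real.
  have hexp : ((n / (z - z₀) + k z) * starRingEnd ℂ (m / (z - z₀) + l z)).im =
      (n / (z - z₀) * starRingEnd ℂ (l z) + k z * starRingEnd ℂ (m / (z - z₀))
        + k z * starRingEnd ℂ (l z)).im := by
    have : (n / (z - z₀) * starRingEnd ℂ (m / (z - z₀))).im = 0 := by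
      have : (n / (z - z₀) * starRingEnd ℂ (m / (z - z₀)) : ℂ) =
          ((n * m * (Complex.normSq (z - z₀))⁻¹ : ℝ) : ℂ) := by
        simp only [map_div₀, map_intCast]
        push_cast
        rw [← Complex.mul_conj]
        field_simp
      rw [this, Complex.ofReal_im]
    rw [map_add, add_mul, mul_add, mul_add]
    simp only [Complex.add_im] at this ⊢
    rw [this]
    ring
  rw [hexp, Real.norm_eq_abs]
  refine (Complex.abs_im_le_norm _).trans ?_
  have hK0 : 0 ≤ K := (norm_nonneg _).trans h3
  have hL0 : 0 ≤ L := (norm_nonneg _).trans h4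
  have a1 : ‖(n / (z - z₀) * starRingEnd ℂ (l z) : ℂ)‖ ≤ |(n : ℝ)| * L * ‖z - z₀‖⁻¹ := by
    rw [norm_mul, norm_div, Complex.norm_conj, Complex.norm_intCast, div_mul_eq_mul_div, div_eq_mul_inv]
    gcongr
  have a2 : ‖(k z * starRingEnd ℂ (m / (z - z₀)) : ℂ)‖ ≤ |(m : ℝ)| * K * ‖z - z₀‖⁻¹ := by
    rw [norm_mul, Complex.norm_conj, norm_div, Complex.norm_intCast, mul_div_assoc', mul_comm,
      div_eq_mul_inv]
    gcongr
  have a3 : ‖(k z * starRingEnd ℂ (l z) : ℂ)‖ ≤ K * L * ‖z - z₀‖⁻¹ := by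
    rw [norm_mul, Complex.norm_conj]
    calc ‖k z‖ * ‖l z‖ ≤ K * L * 1 := by rw [mul_one]; gcongr
      _ ≤ K * L * ‖z - z₀‖⁻¹ := by
        gcongr
        exact (one_le_inv₀ hpos).2 hz1
  calc _ ≤ _ := norm_add₃_le
    _ ≤ _ := add_le_add_three a1 a2 a3
    _ = _ := by rw [hC]; ring

variable {X : Type*} [TopologicalSpace X] [ChartedSpace ℂ X] [IsManifold 𝓘(ℂ) 1 X]

theorem RegularAt.realDifferentiableAt {x : X → ℂ} {q : X} (h : RegularAt x q) :
    RealDifferentiableAt (fun p => Real.log ‖x p‖) q := by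
  intro e he hq
  refine (hasFDerivAt_log_norm ((mdifferentiableAt_iff_chart he hq).1 h.1) ?_).differentiableAt
  rw [e.left_inv hq]
  exact h.2

variable [MeasurableSpace X] [BorelSpace X] [T2Space X] [CompactSpace X] (Q : ChartPartition X)

/-- Local integrability in the preferred charts, together with compactness. -/
theorem integrable_areaDensity {x y : X → ℂ}
    (hx : ∀ p, MeromorphicAt (chartRep x p) (chartAt ℂ p p)) (hx' : ∀ p, ordAt x p ≠ ⊤)
    (hy : ∀ p, MeromorphicAt (chartRep y p) (chartAt ℂ p p)) (hy' : ∀ p, ordAt y p ≠ ⊤) :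
    Integrable (areaDensity Q (fun p => Real.log ‖x p‖) (fun p => Real.log ‖y p‖))
      (areaMeasure Q) := by
  have hP : {p | ¬ RegularAt x p ∨ ¬ RegularAt y p}.Finite := by
    refine finite_of_eventually_nhdsNE fun p => ?_
    filter_upwards [eventually_regularAt_of_chartRep (hx p) (hx' p),
      eventually_regularAt_of_chartRep (hy p) (hy' p)] with q h1 h2
    simp [h1, h2]
  have hloc : LocallyIntegrable (areaDensity Q (fun p => Real.log ‖x p‖)
      (fun p => Real.log ‖y p‖)) (areaMeasure Q) := by
    intro p
    obtain ⟨U, hU, hUi⟩ := exists_integrableOn_wedgeDensity (hx p) (hx' p) (hy p) (hy' p)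
    obtain ⟨V, hVU, hV, hpV⟩ := mem_nhds_iff.1 (inter_mem hU (chart_target_mem_nhds ℂ p))
    have hκ := isParametrization_chart_symm (chart_mem_atlas ℂ p)
    refine ⟨(chartAt ℂ p).symm '' V, ?_, ?_⟩
    · have := (chartAt ℂ p).symm.isOpen_image_of_subset_source hV (fun z hz => (hVU hz).2)
      exact this.mem_nhds ⟨_, hpV, (chartAt ℂ p).left_inv (mem_chart_source ℂ p)⟩
    · rw [hκ.integrableOn_iff Q hP (fun q hq => ?_) (fun q hq => ?_) hV.measurableSet
        (fun z hz => (hVU hz).2)]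
      · exact hUi.mono_set fun z hz => (hVU hz).1
      · exact RegularAt.realDifferentiableAt (by by_contra h; exact hq (Or.inl h))
      · exact RegularAt.realDifferentiableAt (by by_contra h; exact hq (Or.inr h))
  simpa using hloc.integrableOn_isCompact isCompact_univ

end QuantumIndex

end

/-! ### Local coordinates adapted to a function, and critical points. -/

noncomputable section

namespace QuantumIndex

open Set Filter Topology

/-- Dividing by g(z₁) moves the value to 1, where the principal logarithm is analytic; c is a root
of g(z₁). -/
theorem exists_analyticAt_pow_eq {g : ℂ → ℂ} {z₁ : ℂ} (hg : AnalyticAt ℂ g z₁) (h0 : g z₁ ≠ 0)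
    {n : ℕ} (hn : n ≠ 0) :
    ∃ k : ℂ → ℂ, AnalyticAt ℂ k z₁ ∧ k z₁ ≠ 0 ∧ ∀ᶠ z in 𝓝 z₁, k z ^ n = g z := by
  obtain ⟨c, hc⟩ := IsAlgClosed.exists_pow_nat_eq (g z₁) (Nat.pos_of_ne_zero hn)
  have hc0 : c ≠ 0 := by
    rintro rfl
    rw [zero_pow hn] at hc
    exact h0 hc.symm
  refine ⟨fun z => c * Complex.exp (Complex.log (g z / g z₁) / n), ?_, by simp [hc0, h0], ?_⟩
  · have h1 : AnalyticAt ℂ (fun z => g z / g z₁) z₁ := hg.div analyticAt_const h0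
    have h2 : AnalyticAt ℂ (fun z => Complex.log (g z / g z₁)) z₁ := h1.clog (by simp [h0])
    exact analyticAt_const.mul (h2.div analyticAt_const (by simpa using hn)).cexp
  · filter_upwards [hg.continuousAt.eventually_ne h0] with z hz
    rw [mul_pow, ← Complex.exp_nat_mul, mul_div_cancel₀ _ (by simpa using hn),
      Complex.exp_log (div_ne_zero hz h0), hc]
    field_simp

variable {X : Type*} [TopologicalSpace X] [ChartedSpace ℂ X] [IsManifold 𝓘(ℂ) 1 X]

/-- A holomorphic coordinate near `p`, given in the preferred chart by a function with non-zero
derivative. -/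
theorem exists_coordinate {p : X} {h : ℂ → ℂ} (ha : AnalyticAt ℂ h (chartAt ℂ p p))
    (hd : deriv h (chartAt ℂ p p) ≠ 0) {O : Set X} (hO : O ∈ 𝓝 p) :
    ∃ Ψ : OpenPartialHomeomorph X ℂ, p ∈ Ψ.source ∧ Ψ.source ⊆ O ∧
      (∀ q ∈ Ψ.source, Ψ q = h (chartAt ℂ p q)) ∧
      (∀ z ∈ Ψ.target, MDifferentiableAt 𝓘(ℂ) 𝓘(ℂ) Ψ.symm z) ∧
      AnalyticAt ℂ (fun z => chartAt ℂ p (Ψ.symm z)) (h (chartAt ℂ p p)) ∧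
      deriv (fun z => chartAt ℂ p (Ψ.symm z)) (h (chartAt ℂ p p)) ≠ 0 := by
  set e := chartAt ℂ p with he
  have hsd := ha.hasStrictDerivAt
  have hfd := hsd.hasStrictFDerivAt_equiv hd
  set Φ := hfd.toOpenPartialHomeomorph h with hΦ
  have hpΦ : e p ∈ Φ.source := hfd.mem_toOpenPartialHomeomorph_source
  have hcoe : (Φ : ℂ → ℂ) = h := rfl
  have hsymm : AnalyticAt ℂ Φ.symm (h (e p)) := by
    have hc : ContDiffAt ℂ ω h (e p) := ha.contDiffAt
    have := Φ.contDiffAt_symm (n := ω) (hfd.image_mem_toOpenPartialHomeomorph_target)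
      (f₀' := (ContinuousLinearEquiv.unitsEquivAut ℂ (Units.mk0 _ hd)))
      (by
        have h1 : Φ.symm (h (e p)) = e p := Φ.left_inv hpΦ
        rw [h1]
        exact hfd.hasFDerivAt)
      (by
        have h1 : Φ.symm (h (e p)) = e p := Φ.left_inv hpΦ
        rw [h1]
        exact hc)
    exact this.analyticAt
  have hsd' : HasStrictDerivAt Φ.symm (deriv h (e p))⁻¹ (h (e p)) := hsd.to_localInverse hd
  obtain ⟨W, hWs, hWo, hpW⟩ := mem_nhds_iff.1 hO
  obtain ⟨W', hWs', hWo', hpW'⟩ := mem_nhds_iff.1 hsymm.eventually_analyticAt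
  -- Two restrictions: the source is cut down to fit into `O`, the target to the set where the
  -- inverse is analytic, so that the inverse is holomorphic on all of the target.
  set Ψ₀ := (e.restrOpen W hWo).trans Φ with hΨ₀
  set Ψ := (Ψ₀.symm.restrOpen W' hWo').symm with hΨ
  have hpe : p ∈ e.source := mem_chart_source ℂ p
  have hpΨ₀ : p ∈ Ψ₀.source := by simp [hΨ₀, hpe, hpW, hpΦ]
  have hsrc : ∀ q, q ∈ Ψ.source ↔ q ∈ Ψ₀.source ∧ h (e q) ∈ W' := by
    intro q
    change q ∈ (Ψ₀.symm.restrOpen W' hWo').target ↔ _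
    simp [OpenPartialHomeomorph.restrOpen, hΨ₀, hcoe]
  have hsymmeq (z : ℂ) : Ψ.symm z = e.symm (Φ.symm z) := rfl
  have htgt : ∀ z ∈ Ψ.target, z ∈ W' ∧ Φ.symm z ∈ e.target := by
    intro z hz
    change z ∈ (Ψ₀.symm.restrOpen W' hWo').source at hz
    simp [hΨ₀] at hz
    tauto
  refine ⟨Ψ, ?_, ?_, ?_, ?_, ?_, ?_⟩
  · exact (hsrc p).2 ⟨hpΨ₀, hpW'⟩
  · intro q hq
    have := ((hsrc q).1 hq).1
    simp [hΨ₀] at this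
    exact hWs this.1.2
  · intro q hq
    rfl
  · intro z hz
    have h1 := mdifferentiableAt_atlas_symm (I := 𝓘(ℂ)) (chart_mem_atlas ℂ p) (htgt z hz).2
    have h2 : MDifferentiableAt 𝓘(ℂ) 𝓘(ℂ) Φ.symm z :=
      mdifferentiableAt_iff_differentiableAt.2 (hWs' (htgt z hz).1).differentiableAt
    exact MDifferentiableAt.comp (I' := 𝓘(ℂ)) (g := e.symm) (f := Φ.symm) z h1 h2
  all_goals
    have hev : (fun z => e (Ψ.symm z)) =ᶠ[𝓝 (h (e p))] Φ.symm := by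
      have h1 : Φ.symm (h (e p)) ∈ e.target := by
        rw [show Φ.symm (h (e p)) = e p from Φ.left_inv hpΦ]
        exact mem_chart_target ℂ p
      filter_upwards [hsymm.continuousAt.eventually (e.open_target.mem_nhds h1)] with z hz
      rw [hsymmeq, e.right_inv hz]
  · exact hsymm.congr hev.symm
  · rw [hev.deriv_eq, hsd'.hasDerivAt.deriv]
    exact inv_ne_zero hd

/-- A holomorphic coordinate near `p` in which `x - z₀` is a power. -/
theorem exists_root_coordinate {p : X} {x : X → ℂ} {z₀ : ℂ} {n : ℕ} (hn : n ≠ 0)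
    (ha : AnalyticAt ℂ (chartRep x p) (chartAt ℂ p p))
    (ho : analyticOrderAt (fun z => chartRep x p z - z₀) (chartAt ℂ p p) = n)
    {O : Set X} (hO : O ∈ 𝓝 p) :
    ∃ Ψ : OpenPartialHomeomorph X ℂ, p ∈ Ψ.source ∧ Ψ.source ⊆ O ∧ Ψ p = 0 ∧
      (∀ q ∈ Ψ.source, x q = z₀ + Ψ q ^ n) ∧
      (∀ z ∈ Ψ.target, MDifferentiableAt 𝓘(ℂ) 𝓘(ℂ) Ψ.symm z) ∧
      AnalyticAt ℂ (fun z => chartAt ℂ p (Ψ.symm z)) 0 ∧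
      deriv (fun z => chartAt ℂ p (Ψ.symm z)) 0 ≠ 0 := by
  obtain ⟨g, hg, hg0, hge⟩ := (AnalyticAt.analyticOrderAt_eq_natCast
    (ha.sub analyticAt_const)).1 ho
  obtain ⟨k, hk, hk0, hke⟩ := exists_analyticAt_pow_eq hg hg0 hn
  set w := chartAt ℂ p p with hw
  -- If x - z₀ = (z - w)^n g and k^n = g, then (z - w) k is an n-th root of x - z₀ with derivative
  -- k(w) ≠ 0 at w.
  have hh : AnalyticAt ℂ (fun z => (z - w) * k z) w :=
    (analyticAt_id.sub analyticAt_const).mul hk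
  have hd : HasDerivAt (fun z => (z - w) * k z) (k w) w := by
    have := ((hasDerivAt_id w).sub_const w).fun_mul hk.differentiableAt.hasDerivAt
    simpa only [id, one_mul, sub_self, zero_mul, add_zero] using this
  have hO' : O ∩ ((chartAt ℂ p).source ∩ {q | chartRep x p (chartAt ℂ p q) - z₀ =
      (chartAt ℂ p q - w) ^ n • g (chartAt ℂ p q) ∧
      k (chartAt ℂ p q) ^ n = g (chartAt ℂ p q)}) ∈ 𝓝 p := by
    refine inter_mem hO (inter_mem (chart_source_mem_nhds ℂ p) ?_)
    exact ((chartAt ℂ p).continuousAt (mem_chart_source ℂ p)).eventually (hge.and hke)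
  obtain ⟨Ψ, h1, h2, h3, h4, h5, h6⟩ := exists_coordinate hh (by rw [hd.deriv]; exact hk0) hO'
  simp only [← hw, sub_self, zero_mul] at h5 h6
  refine ⟨Ψ, h1, h2.trans inter_subset_left, ?_, fun q hq => ?_, h4, h5, h6⟩
  · rw [h3 p h1]
    simp [hw]
  · obtain ⟨-, hs, he1, he2⟩ := h2 hq
    rw [h3 q hq, mul_pow, he2, ← smul_eq_mul, ← he1]
    simp [chartRep, (chartAt ℂ p).left_inv hs]

theorem mfderiv_eq_zero_iff_chart {e : OpenPartialHomeomorph X ℂ} (he : e ∈ atlas ℂ X)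
    {x : X → ℂ} {q : X} (hq : q ∈ e.source) (hx : MDifferentiableAt 𝓘(ℂ) 𝓘(ℂ) x q) :
    mfderiv 𝓘(ℂ) 𝓘(ℂ) x q = 0 ↔ deriv (fun z => x (e.symm z)) (e q) = 0 := by
  have hem : e.MDifferentiable 𝓘(ℂ) 𝓘(ℂ) := mdifferentiable_of_mem_atlas he
  have hsymm := mdifferentiableAt_atlas_symm (I := 𝓘(ℂ)) he (e.map_source hq)
  have hxs : MDifferentiableAt 𝓘(ℂ) 𝓘(ℂ) x (e.symm (e q)) := by rwa [e.left_inv hq]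
  have hc := mfderiv_comp (I' := 𝓘(ℂ)) (e q) hxs hsymm
  have hc' : fderiv ℂ (fun z => x (e.symm z)) (e q) =
      (mfderiv 𝓘(ℂ) 𝓘(ℂ) x (e.symm (e q))).comp (mfderiv 𝓘(ℂ) 𝓘(ℂ) e.symm (e q)) := by
    rw [← hc, mfderiv_eq_fderiv]; rfl
  have hsurj := hem.symm.mfderiv_surjective (x := e q) (e.map_source hq)
  rw [← fderiv_apply_one_eq_deriv]
  have h0 : mfderiv 𝓘(ℂ) 𝓘(ℂ) x q = 0 ↔ mfderiv 𝓘(ℂ) 𝓘(ℂ) x (e.symm (e q)) = 0 := by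
    rw [e.left_inv hq]
  rw [h0]
  constructor
  · intro h
    rw [hc', h]
    rfl
  · intro h
    have h1 : fderiv ℂ (fun z => x (e.symm z)) (e q) = 0 := by
      ext
      simpa using h
    refine ContinuousLinearMap.ext fun v => ?_
    obtain ⟨w, rfl⟩ := hsurj v
    have := congrArg (fun L : ℂ →L[ℂ] ℂ => L w) (hc'.symm.trans h1)
    exact this

/-- A meromorphic function on a connected Riemann surface is either constant or has isolated
critical points. -/
theorem IsNormalMeromorphic.mfderiv_dichotomy [T1Space X] [ConnectedSpace X] {x : X → ℂ}
    (hx : IsNormalMeromorphic x) :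
    (∀ p, ∀ᶠ q in 𝓝[≠] p, mfderiv 𝓘(ℂ) 𝓘(ℂ) x q = 0) ∨
      (∀ p, ∀ᶠ q in 𝓝[≠] p, mfderiv 𝓘(ℂ) 𝓘(ℂ) x q ≠ 0) := by
  set A := {p | ∀ᶠ q in 𝓝[≠] p, mfderiv 𝓘(ℂ) 𝓘(ℂ) x q = 0} with hA
  set B := {p | ∀ᶠ q in 𝓝[≠] p, mfderiv 𝓘(ℂ) 𝓘(ℂ) x q ≠ 0} with hB
  -- Both alternatives define open sets. They cover `X` because the derivative is meromorphic, and
  -- are disjoint because punctured neighbourhoods are non-empty; connectedness then decides.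
  have hopen (R : X → Prop) : IsOpen {p | ∀ᶠ q in 𝓝[≠] p, R q} := by
    rw [isOpen_iff_mem_nhds]
    intro p hp
    have h1 : ∀ᶠ q in 𝓝[≠] p, ∀ᶠ r in 𝓝[≠] q, R r := by
      filter_upwards [eventually_eventually_nhdsWithin.2 hp, self_mem_nhdsWithin] with q hq hne
      rw [isOpen_compl_singleton.nhdsWithin_eq hne] at hq
      exact hq.filter_mono nhdsWithin_le_nhds
    rw [eventually_nhdsWithin_iff] at h1
    filter_upwards [h1] with q hq
    by_cases hqp : q = p
    · rw [hqp]; exact hp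
    · exact hq hqp
  have hun : A ∪ B = univ := by
    refine eq_univ_of_forall fun p => ?_
    have hreg := hx.eventually_regularAt p
    have hsrc : ∀ᶠ q in 𝓝[≠] p, q ∈ (chartAt ℂ p).source :=
      eventually_nhdsWithin_of_eventually_nhds (chart_source_mem_nhds ℂ p)
    have hiff : ∀ᶠ q in 𝓝[≠] p, mfderiv 𝓘(ℂ) 𝓘(ℂ) x q = 0 ↔
        deriv (chartRep x p) (chartAt ℂ p q) = 0 := by
      filter_upwards [hreg, hsrc] with q h1 h2
      exact mfderiv_eq_zero_iff_chart (chart_mem_atlas ℂ p) h2 h1.1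
    rcases (hx.normalForm p).meromorphicAt.deriv.eventually_eq_zero_or_eventually_ne_zero with h | h
    · left
      filter_upwards [hiff, (tendsto_chart_nhdsNE p).eventually h] with q h1 h2
      exact h1.2 h2
    · right
      filter_upwards [hiff, (tendsto_chart_nhdsNE p).eventually h] with q h1 h2
      exact fun h => h2 (h1.1 h)
  have hdisj : Disjoint A B := by
    rw [disjoint_left]
    intro p h1 h2
    have := nhdsNE_neBot p
    rw [hA, mem_ofPred_eq] at h1
    rw [hB, mem_ofPred_eq] at h2
    obtain ⟨q, h3, h4⟩ := (h1.and h2).exists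
    exact h4 h3
  have hcl : IsClopen A := ⟨by
    rw [← compl_compl A, ← (isCompl_iff.2 ⟨hdisj, codisjoint_iff.2 hun⟩).compl_eq.symm]
    exact (hopen _).isClosed_compl, hopen _⟩
  rcases isClopen_iff.1 hcl with h | h
  · right
    intro p
    have : p ∈ A ∪ B := hun ▸ mem_univ p
    rw [h, empty_union] at this
    exact this
  · left
    intro p
    have : p ∈ A := h.symm ▸ mem_univ p
    exact this

end QuantumIndex

end

/-! ### Real functions and properness of x on the chosen half. -/

noncomputable section

namespace QuantumIndex

open Set Filter Topology

variable {X : Type*} [TopologicalSpace X] [ChartedSpace ℂ X]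

/-- A real meromorphic function all of whose zeros and poles are real points. -/
structure IsRealFunction (σ : X → X) (x : X → ℂ) : Prop where
  normal : IsNormalMeromorphic x
  conj : ∀ p, ∀ᶠ q in 𝓝[≠] p, x (σ q) = starRingEnd ℂ (x q)
  ne_zero : ∀ p, σ p ≠ p → x p ≠ 0

namespace IsRealFunction

variable {σ : X → X} {x : X → ℂ} (hx : IsRealFunction σ x)
include hx

theorem neg : IsRealFunction σ (-x) :=
  ⟨hx.normal.neg, fun p => by filter_upwards [hx.conj p] with q hq; simp [hq],
    fun p hp => by simpa using hx.ne_zero p hp⟩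

theorem inv : IsRealFunction σ x⁻¹ :=
  ⟨hx.normal.inv, fun p => by filter_upwards [hx.conj p] with q hq; simp [hq],
    fun p hp => by simpa using hx.ne_zero p hp⟩

variable [IsManifold 𝓘(ℂ) 1 X]

/-- The conjugation identity is only known on punctured neighbourhoods, so it is passed to the
limit. At zeros and poles the normal value 0 is real anyway. -/
theorem im_eq_zero (hσ : Continuous σ) {p : X} (hp : σ p = p) : (x p).im = 0 := by
  by_cases h0 : x p = 0
  · simp [h0]
  have hc := (hx.normal.regularAt_iff.2 h0).1.continuousAt
  have hc' : Tendsto (fun q => x (σ q)) (𝓝[≠] p) (𝓝 (x p)) := by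
    have : Tendsto (fun q => x (σ q)) (𝓝 p) (𝓝 (x (σ p))) := by
      refine ContinuousAt.comp (g := x) (f := σ) ?_ hσ.continuousAt
      rwa [hp]
    rw [hp] at this
    exact this.mono_left nhdsWithin_le_nhds
  have hc'' : Tendsto (fun q => starRingEnd ℂ (x q)) (𝓝[≠] p) (𝓝 (starRingEnd ℂ (x p))) :=
    ((Complex.continuous_conj.continuousAt.tendsto.comp hc.tendsto)).mono_left nhdsWithin_le_nhds
  have := nhdsNE_neBot p
  have h := tendsto_nhds_unique (hc'.congr' (hx.conj p)) hc''
  exact Complex.conj_eq_iff_im.1 h.symm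

end IsRealFunction

namespace IsHalf

variable {σ : X → X} {S : Set X} (hS : IsHalf σ S)
include hS

omit [ChartedSpace ℂ X] in
theorem ne_of_mem {p : X} (hp : p ∈ S) : σ p ≠ p := by
  have : p ∈ S ∪ σ '' S := Or.inl hp
  rw [hS.union_eq] at this
  exact this

omit [ChartedSpace ℂ X] in
theorem isOpen_image (hσ : Continuous σ) (hi : Function.Involutive σ) : IsOpen (σ '' S) := by
  rw [image_eq_preimage_of_inverse hi.leftInverse hi.rightInverse]
  exact hS.isOpen.preimage hσ

omit [ChartedSpace ℂ X] in
theorem mem_or {p : X} (hp : p ∉ σ '' S) : p ∈ S ∨ σ p = p := by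
  by_contra! h
  have : p ∈ S ∪ σ '' S := by rw [hS.union_eq]; exact h.2
  exact this.elim h.1 hp

end IsHalf

section Proper

variable [IsManifold 𝓘(ℂ) 1 X] {σ : X → X} {S : Set X} {x : X → ℂ}

/-- Properness: points of S over values tending to z₀ accumulate outside the open set σ(S), and any
limit that is not a pole lies over z₀. The condition on the order excludes poles, whose normal value
0 would place them in the fibre over z₀ = 0. -/
theorem eventually_fiber_subset [CompactSpace X] (hσ : Continuous σ)
    (hi : Function.Involutive σ) (hS : IsHalf σ S) (hx : IsRealFunction σ x) {z₀ : ℂ} {W : Set X}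
    (hW : IsOpen W) (hfib : ∀ p ∉ σ '' S, 0 ≤ ordAt x p → x p = z₀ → p ∈ W) :
    ∀ᶠ z in 𝓝 z₀, ∀ q ∈ S, x q = z → q ∈ W := by
  have := isCompact_univ.eventually_forall_of_forall_eventually (x₀ := z₀) (K := (univ : Set X))
    (P := fun z q => q ∈ S → x q = z → q ∈ W) (fun p _ => ?_)
  · filter_upwards [this] with z hz q hq
    exact hz q (mem_univ q) hq
  rw [nhds_prod_eq]
  by_cases hpW : p ∈ W
  · filter_upwards [tendsto_snd.eventually (hW.mem_nhds hpW)] with a ha _ _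
    exact ha
  by_cases hpS : p ∈ σ '' S
  · filter_upwards [tendsto_snd.eventually ((hS.isOpen_image hσ hi).mem_nhds hpS)] with a ha h _
    exact (hS.disjoint.le_bot ⟨h, ha⟩).elim
  by_cases ho : 0 ≤ ordAt x p
  · have hne : x p ≠ z₀ := fun h => hpW (hfib p hpS ho h)
    have hc := (hx.normal.mdifferentiableAt ho).continuousAt
    have h2 : Tendsto (fun a : ℂ × X => x a.2 - a.1) (𝓝 z₀ ×ˢ 𝓝 p) (𝓝 (x p - z₀)) :=
      (hc.tendsto.comp tendsto_snd).sub tendsto_fst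
    filter_upwards [h2.eventually_ne (sub_ne_zero.2 hne)] with a ha _ h
    exact absurd (sub_eq_zero.2 h) ha
  -- Near a pole |x| exceeds any bound, and the pole itself, not being a regular point, is not in S.
  · have hlt : ordAt x p < 0 := not_le.1 ho
    have hx0 : x p = 0 := by
      by_contra h
      exact hlt.ne (hx.normal.ordAt_eq_zero_iff.2 h)
    have hpS' : p ∉ S := fun h => hx.ne_zero p (hS.ne_of_mem h) hx0
    have ht : Tendsto (fun q => ‖x q‖) (𝓝[≠] p) atTop := by
      have h1 := (tendsto_norm_cobounded_atTop.comp
        (tendsto_cobounded_of_meromorphicOrderAt_neg hlt)).comp (tendsto_chart_nhdsNE p)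
      refine h1.congr' ?_
      have h' : ∀ᶠ q in 𝓝[≠] p, q ∈ (chartAt ℂ p).source :=
        eventually_nhdsWithin_of_eventually_nhds (chart_source_mem_nhds ℂ p)
      filter_upwards [h'] with q hq
      simp [chartRep, (chartAt ℂ p).left_inv hq]
    have h1 := eventually_nhdsWithin_iff.1 (ht.eventually (eventually_gt_atTop (‖z₀‖ + 1)))
    have h2 : ∀ᶠ z in 𝓝 z₀, ‖z‖ < ‖z₀‖ + 1 :=
      continuous_norm.continuousAt.eventually_lt_const (lt_add_one _)
    filter_upwards [tendsto_snd.eventually h1, tendsto_fst.eventually h2] with a h1 h2 h3 h4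
    by_cases hap : a.2 = p
    · exact (hpS' (hap ▸ h3)).elim
    · have := h1 hap
      rw [h4] at this
      linarith

end Proper

/-- The punctured disc is the image of a half plane under exp. -/
theorem isPreconnected_ball_diff_zero (r : ℝ) :
    IsPreconnected (Metric.ball (0 : ℂ) r \ {0}) := by
  rcases le_or_gt r 0 with hr | hr
  · rw [Metric.ball_eq_empty.2 hr, empty_sdiff]
    exact isPreconnected_empty
  have : Metric.ball (0 : ℂ) r \ {0} = Complex.exp '' {w | w.re < Real.log r} := by
    ext z
    constructor
    · rintro ⟨h1, h2⟩
      refine ⟨Complex.log z, ?_, Complex.exp_log h2⟩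
      simp only [Metric.mem_ball, dist_zero_right] at h1
      simpa [Complex.log_re] using Real.log_lt_log (norm_pos_iff.2 h2) h1
    · rintro ⟨w, hw, rfl⟩
      refine ⟨?_, Complex.exp_ne_zero w⟩
      simp only [Metric.mem_ball, dist_zero_right, Complex.norm_exp]
      exact (Real.lt_log_iff_exp_lt hr).1 hw
  rw [this]
  exact ((convex_halfSpace_re_lt _).isPreconnected).image _ Complex.continuous_exp.continuousOn

/-- Near a real zero of `x`, in the coordinate given by `τ`, the function `x` is `ε t ^ a`, the half
`S` is the upper half disc and the leading term of `y` is `c t ^ b`. -/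
structure IsLocalForm (S : Set X) (x y : X → ℂ) (p : X) (a : ℕ) (b : ℤ) (ε : ℂ) (c : ℝ) (r : ℝ)
    (τ : ℂ → X) : Prop where
  exponent_ne_zero : a ≠ 0
  sign : ε = 1 ∨ ε = -1
  coeff_ne_zero : c ≠ 0
  radius_pos : 0 < r
  injOn : InjOn τ (Metric.ball 0 r)
  image_mem_nhds : τ '' Metric.ball 0 r ∈ 𝓝 p
  apply_eq : ∀ t ∈ Metric.ball 0 r, x (τ t) = ε * t ^ a
  mem_iff : ∀ t ∈ Metric.ball 0 r, τ t ∈ S ↔ 0 < t.im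
  tendsto : Tendsto (fun t => y (τ t) / (c * t ^ b)) (𝓝[≠] 0) (𝓝 1)

omit [ChartedSpace ℂ X] in
theorem IsLocalForm.neg {S : Set X} {x y : X → ℂ} {p : X} {a : ℕ} {b : ℤ} {ε : ℂ} {c r : ℝ}
    {τ : ℂ → X} (h : IsLocalForm S x y p a b ε c r τ) :
    IsLocalForm S (-x) y p a b (-ε) c r τ :=
  { h with
    sign := by rcases h.sign with h | h <;> simp [h]
    apply_eq := fun t ht => by simp [h.apply_eq t ht] }

end QuantumIndex

end

/-! ### The local form of a pair of real functions at a zero of the first. -/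

noncomputable section

namespace QuantumIndex

open Set Filter Topology

/-- The quotient ρ(t)/t is continuous on the connected punctured disc with values in the finite set
of a-th roots of unity. -/
theorem exists_eq_mul_of_pow_eq {ρ : ℂ → ℂ} {r : ℝ} {a : ℕ} (ha : a ≠ 0)
    (hρ : ContinuousOn ρ (Metric.ball 0 r)) (h : ∀ t ∈ Metric.ball 0 r, ρ t ^ a = t ^ a) :
    ∃ ζ : ℂ, ζ ^ a = 1 ∧ ∀ t ∈ Metric.ball 0 r, ρ t = ζ * t := by
  have hfin : {z : ℂ | z ^ a = 1}.Finite := by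
    have := (Polynomial.nthRootsFinset a (1 : ℂ)).finite_toSet
    refine this.subset fun z hz => ?_
    simpa [Polynomial.mem_nthRootsFinset (Nat.pos_of_ne_zero ha)] using hz
  obtain ⟨ζ, hζ, hζe⟩ := (isPreconnected_ball_diff_zero r).eqOn_const_of_mapsTo
    (f := fun t => ρ t / t) (T := {z : ℂ | z ^ a = 1})
    hfin.isDiscrete ((hρ.mono sdiff_subset).div continuousOn_id fun t ht => ht.2)
    (fun t ht => by
      have h0 : t ≠ 0 := ht.2
      change (ρ t / t) ^ a = 1
      rw [div_pow, h t ht.1, div_self (pow_ne_zero a h0)]) ⟨1, by simp⟩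
  refine ⟨ζ, hζ, fun t ht => ?_⟩
  by_cases h0 : t = 0
  · have := h t ht
    rw [h0, zero_pow ha, pow_eq_zero_iff ha] at this
    simp [h0, this]
  · have := hζe ⟨ht, h0⟩
    simp only [Function.const_apply] at this
    rw [← this, div_mul_cancel₀ _ h0]

variable {X : Type*} [TopologicalSpace X] [ChartedSpace ℂ X] [IsManifold 𝓘(ℂ) 1 X]

/-- Take a coordinate in which x is a pure a-th power. There the conjugate of σ has the same a-th
power as t, so it is t ↦ ζt with ζ^a = 1. Rotating by a square root η of ζ turns σ into complex
conjugation, and the sign of η is free to make S the upper half disc. -/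
theorem exists_localForm {σ : X → X} {S : Set X} {x y : X → ℂ} (hσ : Continuous σ)
    (hi : Function.Involutive σ) (hS : IsHalf σ S) (hx : IsRealFunction σ x)
    (hy : IsRealFunction σ y) {p : X} (hp : 0 < ordAt x p) {O : Set X} (hO : O ∈ 𝓝 p) :
    ∃ a b ε c r τ, IsLocalForm S x y p a b ε c r τ ∧ τ '' Metric.ball 0 r ⊆ O := by
  have hx0 : x p = 0 := by
    by_contra h
    exact hp.ne' (hx.normal.ordAt_eq_zero_iff.2 h)
  have hfix : σ p = p := by
    by_contra h
    exact hx.ne_zero p h hx0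
  have han := (hx.normal.analyticAt_iff p).1 hp.le
  obtain ⟨a, ha⟩ : ∃ a : ℕ, analyticOrderAt (chartRep x p) (chartAt ℂ p p) = a := by
    have h1 := hx.normal.ord_ne_top p
    rw [ordAt, han.meromorphicOrderAt_eq] at h1
    refine ENat.ne_top_iff_exists.1 (fun h => h1 ?_) |>.imp fun _ h => h.symm
    rw [h]
    rfl
  have ha0 : a ≠ 0 := by
    rintro rfl
    rw [ordAt, han.meromorphicOrderAt_eq, ha] at hp
    simp at hp
  -- The coordinate disc is chosen so small that the conjugation identities hold on it away from p.
  have hO' : O ∩ {q | q = p ∨ (x (σ q) = starRingEnd ℂ (x q) ∧ y (σ q) = starRingEnd ℂ (y q))}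
      ∈ 𝓝 p := by
    refine inter_mem hO ?_
    filter_upwards [eventually_nhdsWithin_iff.1 ((hx.conj p).and (hy.conj p))] with q hq
    exact or_iff_not_imp_left.2 hq
  obtain ⟨Ψ, hpΨ, hΨO, hΨ0, hΨx, hΨd, hΨa, hΨd'⟩ := exists_root_coordinate ha0 han
    (z₀ := 0) (by simpa using ha) hO'
  have hΨs : Ψ.symm 0 = p := by rw [← hΨ0, Ψ.left_inv hpΨ]
  have h0t : (0 : ℂ) ∈ Ψ.target := hΨ0 ▸ Ψ.map_source hpΨ
  have hcs : ContinuousAt Ψ.symm 0 := Ψ.continuousAt_symm h0t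
  -- a disc on which everything is defined
  have hev : ∀ᶠ t in 𝓝 (0 : ℂ), t ∈ Ψ.target ∧ σ (Ψ.symm t) ∈ Ψ.source := by
    refine Filter.Eventually.and (Ψ.open_target.mem_nhds h0t) ?_
    have : ContinuousAt (fun t => σ (Ψ.symm t)) 0 := hσ.continuousAt.comp hcs
    refine this.eventually (Ψ.open_source.mem_nhds ?_)
    simpa only [hΨs, hfix] using hpΨ
  obtain ⟨r, hr, hball⟩ := Metric.eventually_nhds_iff_ball.1 hev
  have hne : ∀ t ∈ Metric.ball (0 : ℂ) r, t ≠ 0 → Ψ.symm t ≠ p := by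
    intro t ht h0 h
    apply h0
    rw [← Ψ.right_inv (hball t ht).1, h, hΨ0]
  have hρ : ContinuousOn (fun t => starRingEnd ℂ (Ψ (σ (Ψ.symm t)))) (Metric.ball 0 r) := by
    intro t ht
    refine ContinuousAt.continuousWithinAt ?_
    refine Complex.continuous_conj.continuousAt.comp ?_
    refine (Ψ.continuousAt (hball t ht).2).comp (f := fun t => σ (Ψ.symm t)) ?_
    exact hσ.continuousAt.comp (Ψ.continuousAt_symm (hball t ht).1)
  obtain ⟨ζ, hζ, hζt⟩ := exists_eq_mul_of_pow_eq ha0 hρ (fun t ht => by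
    by_cases h0 : t = 0
    · simp [h0, hΨs, hfix, hΨ0]
    have hs : Ψ.symm t ∈ Ψ.source := Ψ.map_target (hball t ht).1
    have hc := ((hΨO hs).2.resolve_left (hne t ht h0)).1
    have h1 := hΨx _ (hball t ht).2
    have h2 := hΨx _ hs
    rw [zero_add] at h1 h2
    rw [← map_pow, ← h1, hc, Complex.conj_conj, h2, Ψ.right_inv (hball t ht).1])
  have hζn : ‖ζ‖ = 1 := by
    have : ‖ζ‖ ^ a = 1 := by rw [← norm_pow, hζ, norm_one]
    exact (pow_eq_one_iff_of_nonneg (norm_nonneg _) ha0).1 this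
  have hη : ∀ η : ℂ, η ^ 2 = ζ → ‖η‖ = 1 := fun η h => by
    have : ‖η‖ ^ 2 = 1 := by rw [← norm_pow, h, hζn]
    exact (pow_eq_one_iff_of_nonneg (norm_nonneg _) two_ne_zero).1 this
  have hmem : ∀ η : ℂ, η ^ 2 = ζ → ∀ t ∈ Metric.ball (0 : ℂ) r, t / η ∈ Metric.ball (0 : ℂ) r := by
    intro η h t ht
    simpa [hη η h] using ht
  have hστ : ∀ η : ℂ, η ^ 2 = ζ → ∀ t ∈ Metric.ball (0 : ℂ) r,
      σ (Ψ.symm (t / η)) = Ψ.symm (starRingEnd ℂ t / η) := by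
    intro η h t ht
    have h1 := hζt _ (hmem η h t ht)
    have h2 : Ψ (σ (Ψ.symm (t / η))) = starRingEnd ℂ t / η := by
      have hηc : η * starRingEnd ℂ η = 1 := by
        rw [Complex.mul_conj, Complex.normSq_eq_norm_sq, hη η h]; simp
      have hη0 : η ≠ 0 := left_ne_zero_of_mul_eq_one hηc
      have hηc0 : starRingEnd ℂ η ≠ 0 := right_ne_zero_of_mul_eq_one hηc
      have h3 := congrArg (starRingEnd ℂ) h1
      rw [Complex.conj_conj, map_mul, map_div₀, ← h, map_pow] at h3
      rw [h3]
      field_simp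
      linear_combination (starRingEnd ℂ t) * hηc
    rw [← h2, Ψ.left_inv (hball _ (hmem η h t ht)).2]
  obtain ⟨η₀, hη₀⟩ := IsAlgClosed.exists_pow_nat_eq ζ (n := 2) two_pos
  -- the upper half disc is contained in `S` or in `σ(S)`
  obtain ⟨η, hηζ, hup⟩ : ∃ η : ℂ, η ^ 2 = ζ ∧
      ∀ t ∈ Metric.ball (0 : ℂ) r, 0 < t.im → Ψ.symm (t / η) ∈ S := by
    have hconv : IsPreconnected (Metric.ball (0 : ℂ) r ∩ {t | 0 < t.im}) :=
      ((convex_ball _ _).inter (convex_halfSpace_im_gt 0)).isPreconnected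
    have hcont : ContinuousOn (fun t => Ψ.symm (t / η₀)) (Metric.ball (0 : ℂ) r ∩ {t | 0 < t.im}) := by
      intro t ht
      refine ContinuousAt.continuousWithinAt ?_
      exact (Ψ.continuousAt_symm (hball _ (hmem η₀ hη₀ t ht.1)).1).comp
        (f := fun t => t / η₀) (continuousAt_id.div_const _)
    have hsub : (fun t => Ψ.symm (t / η₀)) '' (Metric.ball (0 : ℂ) r ∩ {t | 0 < t.im}) ⊆
        S ∪ σ '' S := by
      rintro _ ⟨t, ⟨ht, him⟩, rfl⟩
      rw [hS.union_eq]
      intro h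
      simp only at h
      rw [hστ η₀ hη₀ t ht] at h
      have ht' : starRingEnd ℂ t ∈ Metric.ball (0 : ℂ) r := by simpa using ht
      have h4 := Ψ.symm.injOn (hball _ (hmem η₀ hη₀ _ ht')).1 (hball _ (hmem η₀ hη₀ t ht)).1 h
      have hη0 : η₀ ≠ 0 := by
        rw [← norm_ne_zero_iff, hη η₀ hη₀]; exact one_ne_zero
      rw [div_left_inj' hη0] at h4
      exact him.ne' (Complex.conj_eq_iff_im.1 h4)
    rcases (hconv.image _ hcont).subset_or_subset hS.isOpen (hS.isOpen_image hσ hi) hS.disjoint hsub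
      with h | h
    · exact ⟨η₀, hη₀, fun t ht him => h ⟨t, ⟨ht, him⟩, rfl⟩⟩
    -- The upper half disc went to σ(S). The point with parameter -t/η₀ is the conjugate of the one
    -- with parameter -t̄/η₀, and -t̄ is again in the upper half disc, so replacing η₀ by -η₀ leads
    -- to S.
    · refine ⟨-η₀, by rw [neg_sq, hη₀], fun t ht him => ?_⟩
      have ht' : -starRingEnd ℂ t ∈ Metric.ball (0 : ℂ) r := by simpa using ht
      obtain ⟨s, hs, hse⟩ := h ⟨-starRingEnd ℂ t, ⟨ht', by simpa using him⟩, rfl⟩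
      have h5 := hστ η₀ hη₀ _ ht'
      simp only at hse
      rw [← hse, hi s] at h5
      rw [div_neg, ← neg_div]
      rw [map_neg, Complex.conj_conj] at h5
      rwa [← h5]
  have hη1 : ‖η‖ = 1 := hη η hηζ
  have hη0 : η ≠ 0 := by rw [← norm_ne_zero_iff, hη1]; exact one_ne_zero
  -- the leading term of `y`
  have hyo : ∃ b : ℤ, ∃ g : ℂ → ℂ, AnalyticAt ℂ g 0 ∧ g 0 ≠ 0 ∧
      ∀ᶠ t in 𝓝[≠] (0 : ℂ), y (Ψ.symm t) = t ^ b * g t := by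
    have hA : ∀ᶠ t in 𝓝 (0 : ℂ), chartRep y p (chartAt ℂ p (Ψ.symm t)) = y (Ψ.symm t) := by
      have : ∀ᶠ t in 𝓝 (0 : ℂ), Ψ.symm t ∈ (chartAt ℂ p).source :=
        hcs.eventually (by rw [hΨs]; exact chart_source_mem_nhds ℂ p)
      filter_upwards [this] with t ht
      simp [chartRep, (chartAt ℂ p).left_inv ht]
    have hmer : MeromorphicAt (chartRep y p) (chartAt ℂ p (Ψ.symm 0)) := by
      rw [hΨs]
      exact (hy.normal.normalForm p).meromorphicAt
    have hord := meromorphicOrderAt_comp_of_deriv_ne_zero (f := chartRep y p) hΨa hΨd'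
    simp only [hΨs] at hord hmer
    have hmer' : MeromorphicAt (chartRep y p ∘ fun z => chartAt ℂ p (Ψ.symm z)) 0 := by
      refine MeromorphicAt.comp_analyticAt ?_ hΨa
      simpa only [hΨs] using hmer
    have htop := hy.normal.ord_ne_top p
    unfold ordAt at htop
    lift meromorphicOrderAt (chartRep y p) (chartAt ℂ p p) to ℤ using htop with b hb
    obtain ⟨g, hg, hg0, hge⟩ := (meromorphicOrderAt_eq_int_iff hmer').1 hord
    refine ⟨b, g, hg, hg0, ?_⟩
    filter_upwards [hge, eventually_nhdsWithin_of_eventually_nhds hA] with t h1 h2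
    rw [← h2]
    simpa using h1
  obtain ⟨b, g, hg, hg0, hge⟩ := hyo
  have hdiv : Tendsto (fun t : ℂ => t / η) (𝓝[≠] 0) (𝓝[≠] 0) := by
    refine tendsto_nhdsWithin_iff.2 ⟨?_, ?_⟩
    · have : Tendsto (fun t : ℂ => t / η) (𝓝 0) (𝓝 (0 / η)) := tendsto_id.div_const η
      rw [zero_div] at this
      exact this.mono_left nhdsWithin_le_nhds
    · filter_upwards [self_mem_nhdsWithin] with t ht
      exact div_ne_zero ht hη0
  have hyτ : ∀ᶠ t in 𝓝[≠] (0 : ℂ), y (Ψ.symm (t / η)) = t ^ b * (η ^ (-b) * g (t / η)) := by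
    filter_upwards [hdiv.eventually hge] with t ht
    rw [ht, div_zpow, zpow_neg]
    field_simp
  have hglim : Tendsto (fun t => η ^ (-b) * g (t / η)) (𝓝[≠] 0) (𝓝 (η ^ (-b) * g 0)) :=
    (((hg.continuousAt.tendsto.mono_left nhdsWithin_le_nhds).comp hdiv).const_mul _)
  -- Along the real axis the points are fixed by σ, so y is real there and its leading coefficient
  -- is a limit of real numbers.
  have hreal : (η ^ (-b) * g 0).im = 0 := by
    have hR : Tendsto (fun s : ℝ => (s : ℂ)) (𝓝[≠] 0) (𝓝[≠] 0) := by
      refine tendsto_nhdsWithin_iff.2 ⟨?_, ?_⟩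
      · have : Tendsto (fun s : ℝ => (s : ℂ)) (𝓝 0) (𝓝 ((0 : ℝ) : ℂ)) :=
          Complex.continuous_ofReal.continuousAt
        rw [Complex.ofReal_zero] at this
        exact this.mono_left nhdsWithin_le_nhds
      · filter_upwards [self_mem_nhdsWithin] with s hs
        simpa using hs
    have h1 := (Complex.continuous_im.continuousAt.tendsto.comp hglim).comp hR
    have h2 : ∀ᶠ s : ℝ in 𝓝[≠] (0 : ℝ),
        (Complex.im ∘ (fun t => η ^ (-b) * g (t / η))) (s : ℂ) = 0 := by
      have hb : ∀ᶠ t in 𝓝[≠] (0 : ℂ), t ∈ Metric.ball (0 : ℂ) r :=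
        eventually_nhdsWithin_of_eventually_nhds (Metric.ball_mem_nhds _ hr)
      filter_upwards [hR.eventually hyτ, hR.eventually hb, self_mem_nhdsWithin] with s hs hsb hs0
      have hs0' : (s : ℂ) ≠ 0 := by simpa using hs0
      have hf : σ (Ψ.symm (s / η)) = Ψ.symm (s / η) := by
        rw [hστ η hηζ _ hsb, Complex.conj_ofReal]
      have hsrc : Ψ.symm (s / η) ∈ Ψ.source := Ψ.map_target (hball _ (hmem η hηζ _ hsb)).1
      have hyr := ((hΨO hsrc).2.resolve_left
        (hne _ (hmem η hηζ _ hsb) (div_ne_zero hs0' hη0))).2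
      rw [hf] at hyr
      have him := Complex.conj_eq_iff_real.1 hyr.symm
      obtain ⟨v, hv⟩ := him
      rw [hv] at hs
      have : η ^ (-b) * g (s / η) = ((v / s ^ b : ℝ) : ℂ) := by
        push_cast
        rw [hs, mul_div_cancel_left₀ _ (zpow_ne_zero _ hs0')]
      simp only [Function.comp_apply]
      rw [this, Complex.ofReal_im]
    have := tendsto_nhds_unique (h1.congr' h2) tendsto_const_nhds
    simpa using this
  obtain ⟨c, hc⟩ : ∃ c : ℝ, (c : ℂ) = η ^ (-b) * g 0 :=
    ⟨(η ^ (-b) * g 0).re, Complex.ext (Complex.ofReal_re _) (by rw [hreal, Complex.ofReal_im])⟩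
  have hc0 : (c : ℂ) ≠ 0 := by
    rw [hc]
    exact mul_ne_zero (zpow_ne_zero _ hη0) hg0
  have hinj : InjOn (fun t => Ψ.symm (t / η)) (Metric.ball 0 r) := by
    intro s hs t ht h
    have := Ψ.symm.injOn (hball _ (hmem η hηζ _ hs)).1 (hball _ (hmem η hηζ _ ht)).1 h
    rwa [div_left_inj' hη0] at this
  -- The sign ε = η^(-a) is indeed ±1, since η^(2a) = ζ^a = 1.
  refine ⟨a, b, (η ^ a)⁻¹, c, r, fun t => Ψ.symm (t / η), ?_, ?_⟩
  · refine ⟨ha0, ?_, by simpa using hc0, hr, hinj, ?_, ?_, ?_, ?_⟩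
    · have : (η ^ a) ^ 2 = 1 := by rw [← pow_mul, mul_comm, pow_mul, hηζ, hζ]
      rcases sq_eq_one_iff.1 this with h | h
      · left; rw [h, inv_one]
      · right; rw [h, inv_neg, inv_one]
    · have himg : (fun t => Ψ.symm (t / η)) '' Metric.ball 0 r = Ψ.symm '' Metric.ball 0 r := by
        ext q
        constructor
        · rintro ⟨t, ht, rfl⟩
          exact ⟨t / η, hmem η hηζ t ht, rfl⟩
        · rintro ⟨t, ht, rfl⟩
          refine ⟨t * η, by simpa [hη1] using ht, ?_⟩
          simp [hη0]
      rw [himg]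
      exact (Ψ.symm.isOpen_image_of_subset_source Metric.isOpen_ball
        (fun t ht => (hball t ht).1)).mem_nhds ⟨0, Metric.mem_ball_self hr, hΨs⟩
    · intro t ht
      have hs := Ψ.map_target (hball _ (hmem η hηζ t ht)).1
      rw [hΨx _ hs, Ψ.right_inv (hball _ (hmem η hηζ t ht)).1, zero_add, div_pow, div_eq_inv_mul]
    · intro t ht
      refine ⟨fun h => ?_, hup t ht⟩
      by_contra him
      have ht' : starRingEnd ℂ t ∈ Metric.ball (0 : ℂ) r := by simpa using ht
      rcases (not_lt.1 him).lt_or_eq with h1 | h1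
      · have h2 := hup _ ht' (by simpa using h1)
        have h3 := hστ η hηζ _ ht'
        rw [Complex.conj_conj] at h3
        exact hS.disjoint.le_bot ⟨h, _, h2, h3⟩
      · refine hS.ne_of_mem h ?_
        rw [hστ η hηζ t ht, Complex.conj_eq_iff_im.2 h1]
    · have h1 := hglim.div_const (c : ℂ)
      rw [← hc, div_self hc0] at h1
      refine h1.congr' ?_
      filter_upwards [hyτ, self_mem_nhdsWithin] with t ht h0
      rw [ht, mul_comm (c : ℂ), mul_div_mul_left _ _ (zpow_ne_zero _ h0)]
  · rintro _ ⟨t, ht, rfl⟩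
    exact (hΨO (Ψ.map_target (hball _ (hmem η hηζ t ht)).1)).1

end QuantumIndex

end

/-! ### The logarithmic strip and the sheets of a power map over it. -/

noncomputable section

namespace QuantumIndex

open Set Filter Topology

/-- The strip `0 < Im w < π`, which `exp` maps onto the upper half plane. -/
def strip : Set ℂ := {w | 0 < w.im ∧ w.im < Real.pi}

theorem isOpen_strip : IsOpen strip :=
  (isOpen_lt continuous_const Complex.continuous_im).inter
    (isOpen_lt Complex.continuous_im continuous_const)

theorem convex_strip : Convex ℝ strip :=
  (convex_halfSpace_im_gt 0).inter (convex_halfSpace_im_lt Real.pi)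

theorem injOn_exp_strip : InjOn Complex.exp strip := by
  intro w hw v hv h
  have h1 := Complex.log_exp (x := w) (by linarith [hw.1, Real.pi_pos]) hw.2.le
  have h2 := Complex.log_exp (x := v) (by linarith [hv.1, Real.pi_pos]) hv.2.le
  rw [← h1, ← h2, h]

theorem exp_im_pos {w : ℂ} (hw : w ∈ strip) : 0 < (Complex.exp w).im := by
  rw [Complex.exp_im]
  exact mul_pos (Real.exp_pos _) (Real.sin_pos_of_pos_of_lt_pi hw.1 hw.2)

theorem log_mem_strip {z : ℂ} (hz : 0 < z.im) : Complex.log z ∈ strip := by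
  refine ⟨?_, ?_⟩
  · rw [Complex.log_im]
    refine lt_of_le_of_ne (Complex.arg_nonneg_iff.2 hz.le) fun h => ?_
    exact hz.ne' (Complex.arg_eq_zero_iff.1 h.symm).2
  · rw [Complex.log_im]
    refine lt_of_le_of_ne (Complex.arg_le_pi z) fun h => ?_
    exact hz.ne' (Complex.arg_eq_pi_iff.1 h).2

/-- Going to the end `Re w → -∞` of the strip. -/
def stripEnd : Filter ℂ := comap Complex.re atBot ⊓ 𝓟 strip

theorem eventually_stripEnd_iff {R : ℂ → Prop} :
    (∀ᶠ w in stripEnd, R w) ↔ ∃ s₀ : ℝ, ∀ w ∈ strip, w.re < s₀ → R w := by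
  rw [stripEnd, eventually_inf_principal, eventually_comap, eventually_atBot]
  constructor
  · rintro ⟨s, hs⟩
    exact ⟨s, fun w hw h => hs w.re h.le w rfl hw⟩
  · rintro ⟨s, hs⟩
    refine ⟨s - 1, fun t ht w hw hws => hs w hws ?_⟩
    rw [hw]
    linarith

/-- The exponents `k` that index the preimages of the upper half plane by `ε t ^ a` in the upper
half plane. -/
def sheetIndices (ε : ℂ) (a : ℕ) : Finset ℕ :=
  letI := Classical.decPred fun k : ℕ => ε * (-1) ^ k = 1
  (Finset.range a).filter fun k => ε * (-1) ^ k = 1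

theorem mem_sheetIndices {ε : ℂ} {a k : ℕ} :
    k ∈ sheetIndices ε a ↔ k < a ∧ ε * (-1) ^ k = 1 := by
  simp [sheetIndices]

/-- For each k exactly one of ε(-1)^k and -ε(-1)^k is 1: every sector of angle π/a lies over exactly
one of the two half planes. -/
theorem sum_sheetIndices_add_neg {ε : ℂ} (hε : ε = 1 ∨ ε = -1) (a : ℕ) (φ : ℕ → ℝ) :
    ∑ k ∈ sheetIndices ε a, φ k + ∑ k ∈ sheetIndices (-ε) a, φ k = ∑ k ∈ Finset.range a, φ k := by
  classical
  have h : ∀ k : ℕ, -ε * (-1) ^ k = 1 ↔ ¬ ε * (-1) ^ k = 1 := by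
    intro k
    rcases hε with rfl | rfl <;> rcases neg_one_pow_eq_or ℂ k with h | h <;> rw [h] <;> norm_num
  have h2 : sheetIndices (-ε) a = (Finset.range a).filter fun k => ¬ ε * (-1) ^ k = 1 := by
    ext k
    rw [mem_sheetIndices, h]
    simp
  have h1 : sheetIndices ε a = (Finset.range a).filter fun k => ε * (-1) ^ k = 1 := by
    ext k
    rw [mem_sheetIndices]
    simp
  rw [h1, h2, Finset.sum_filter_add_sum_filter_not]

/-- The point over `w` on the sheet with index `k`. -/
def sheet (a k : ℕ) (w : ℂ) : ℂ := Complex.exp ((w + k * (Real.pi * Complex.I)) / a)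

theorem sheet_im_pos {a k : ℕ} (hk : k < a) {w : ℂ} (hw : w ∈ strip) : 0 < (sheet a k w).im := by
  have ha : (0 : ℝ) < a := by exact_mod_cast (Nat.zero_le k).trans_lt hk
  have him : ((w + k * (Real.pi * Complex.I)) / a).im = (w.im + k * Real.pi) / a := by
    rw [← Complex.ofReal_natCast a, Complex.div_ofReal_im]
    simp
  apply exp_im_pos
  constructor
  · rw [him]
    have := hw.1
    positivity
  · rw [him, div_lt_iff₀ ha]
    have h1 : (k : ℝ) + 1 ≤ a := by exact_mod_cast hk
    have := hw.2
    nlinarith [Real.pi_pos]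

theorem norm_sheet (a k : ℕ) (w : ℂ) : ‖sheet a k w‖ = Real.exp (w.re / a) := by
  rw [sheet, Complex.norm_exp, ← Complex.ofReal_natCast a, Complex.div_ofReal_re]
  simp

theorem sheet_pow {a : ℕ} (ha : a ≠ 0) (k : ℕ) (w : ℂ) :
    sheet a k w ^ a = (-1) ^ k * Complex.exp w := by
  rw [sheet, ← Complex.exp_nat_mul, mul_div_cancel₀ _ (by exact_mod_cast ha), Complex.exp_add,
    Complex.exp_nat_mul, Complex.exp_pi_mul_I, mul_comm]

theorem sheet_zpow (a k : ℕ) (b : ℤ) (w : ℂ) :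
    sheet a k w ^ b = Complex.exp (b * ((w + k * (Real.pi * Complex.I)) / a)) := by
  rw [sheet, Complex.exp_int_mul]

/-- Compare logarithms: a log t = w + nπi for an integer n, and since Im log t and Im w lie strictly
between 0 and π, necessarily 0 ≤ n < a. -/
theorem exists_sheet_of_pow_eq {ε t w : ℂ} (hε : ε = 1 ∨ ε = -1) {a : ℕ} (ha : a ≠ 0)
    (ht : 0 < t.im) (hw : w ∈ strip) (h : ε * t ^ a = Complex.exp w) :
    ∃ k ∈ sheetIndices ε a, sheet a k w = t := by
  have ht0 : t ≠ 0 := by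
    rintro rfl
    simp at ht
  have ha' : (0 : ℝ) < a := by exact_mod_cast Nat.pos_of_ne_zero ha
  set l := Complex.log t with hl
  have hexp : Complex.exp l = t := Complex.exp_log ht0
  have hls := log_mem_strip ht
  -- Squaring removes the sign ε; this is why n counts multiples of πi rather than of 2πi.
  have h2 : Complex.exp (2 * (a * l)) = Complex.exp (2 * w) := by
    have e1 : Complex.exp (2 * (a * l)) = (t ^ a) ^ 2 := by
      rw [← hexp, ← Complex.exp_nat_mul, ← Complex.exp_nat_mul]
      norm_num
    have e2 : Complex.exp (2 * w) = (Complex.exp w) ^ 2 := by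
      rw [← Complex.exp_nat_mul]
      norm_num
    rw [e1, e2, ← h, mul_pow]
    rcases hε with rfl | rfl <;> norm_num
  obtain ⟨n, hn⟩ := Complex.exp_eq_exp_iff_exists_int.1 h2
  have hn' : a * l = w + n * (Real.pi * Complex.I) := by linear_combination hn / 2
  have him : a * l.im = w.im + n * Real.pi := by
    have := congrArg Complex.im hn'
    simpa using this
  have hpi := Real.pi_pos
  have hn0 : 0 ≤ n := by
    by_contra hneg
    have h3 : (n : ℝ) ≤ -1 := by exact_mod_cast Int.le_sub_one_of_lt (not_le.1 hneg)
    have h4 : 0 < a * l.im := mul_pos ha' hls.1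
    nlinarith [hw.2]
  have hna : n < a := by
    by_contra hge
    have h3 : (a : ℝ) ≤ n := by exact_mod_cast not_lt.1 hge
    have h4 : a * l.im < a * Real.pi := mul_lt_mul_of_pos_left hls.2 ha'
    nlinarith [hw.1]
  lift n to ℕ using hn0 with k
  have hka : k < a := by exact_mod_cast hna
  have hsh : sheet a k w = t := by
    have : (w + k * (Real.pi * Complex.I)) / a = l := by
      rw [div_eq_iff (by exact_mod_cast ha), mul_comm l, hn']
      push_cast
      rfl
    rw [sheet, this, hexp]
  refine ⟨k, mem_sheetIndices.2 ⟨hka, ?_⟩, hsh⟩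
  rw [← hsh, sheet_pow ha, ← mul_assoc] at h
  exact mul_right_cancel₀ (Complex.exp_ne_zero w) (h.trans (one_mul _).symm)

/-- Equal exponentials give k ≡ j modulo 2a, while both indices lie below a. -/
theorem sheet_injOn {a : ℕ} {w : ℂ} : InjOn (fun k => sheet a k w) {k | k < a} := by
  intro k hk j hj h
  have ha : (a : ℂ) ≠ 0 := by
    have : a ≠ 0 := (Nat.zero_le k |>.trans_lt hk).ne'
    exact_mod_cast this
  simp only [sheet] at h
  obtain ⟨n, hn⟩ := Complex.exp_eq_exp_iff_exists_int.1 h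
  have h1 : (k : ℂ) * (Real.pi * Complex.I) = (j + 2 * n * a) * (Real.pi * Complex.I) := by
    field_simp at hn
    linear_combination hn
  have h2 := mul_right_cancel₀ (by simp [Real.pi_ne_zero]) h1
  have h3 : (k : ℤ) = j + 2 * n * a := by exact_mod_cast h2
  have hk' : (k : ℤ) < a := by exact_mod_cast (show k < a from hk)
  have hj' : (j : ℤ) < a := by exact_mod_cast (show j < a from hj)
  have hn0 : n = 0 := by
    by_contra hne
    rcases lt_or_gt_of_ne hne with h | h
    · nlinarith
    · nlinarith
  rw [hn0] at h3
  simpa using h3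

theorem tendsto_sheet {a : ℕ} (ha : a ≠ 0) (k : ℕ) :
    Tendsto (sheet a k) stripEnd (𝓝[≠] 0) := by
  refine tendsto_nhdsWithin_iff.2 ⟨?_, Eventually.of_forall fun w => Complex.exp_ne_zero _⟩
  rw [tendsto_zero_iff_norm_tendsto_zero]
  simp_rw [norm_sheet]
  refine Real.tendsto_exp_atBot.comp ?_
  refine Tendsto.atBot_div_const (by exact_mod_cast Nat.pos_of_ne_zero ha) ?_
  exact tendsto_comap.mono_left inf_le_left

end QuantumIndex

end

/-! ### Asymptotics of the norm at an end of the strip. -/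

noncomputable section

namespace QuantumIndex

open Set Filter Topology

variable {X : Type*}

/-- The points of `S` over `exp w`. -/
def fiber (S : Set X) (x : X → ℂ) (w : ℂ) : Set X := {p | p ∈ S ∧ x p = Complex.exp w}

/-- The norm of `y` along `x`, restricted to `S`. -/
def fiberProd (S : Set X) (x y : X → ℂ) (w : ℂ) : ℂ := ∏ᶠ p ∈ fiber S x w, y p

/-- Up to a real factor, the norm of `y` along `x` is asymptotic to `exp (α w + β i)` at the end of
the strip. -/
def HasStripEnd (S : Set X) (x y : X → ℂ) (α β : ℝ) : Prop :=
  ∃ C : ℝ, C ≠ 0 ∧ Tendsto (fun w => fiberProd S x y w / (C * Complex.exp (α * w + β * Complex.I)))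
    stripEnd (𝓝 1)

variable [TopologicalSpace X] [ChartedSpace ℂ X] [IsManifold 𝓘(ℂ) 1 X] [CompactSpace X]
  {σ : X → X} {S : Set X} {x y : X → ℂ}

/-- By properness at the value 0, all points over exp w eventually lie in the discs around the
zeros, where they are the sheets t = exp((w + kπi)/a). Each contributes a factor asymptotic to c t^b
= c exp(b(w + kπi)/a), and the exponents add up to αw + βi. -/
theorem hasStripEnd_of_localForms (hσ : Continuous σ)
    (hi : Function.Involutive σ) (hS : IsHalf σ S) (hx : IsRealFunction σ x)
    (Z : Finset X) (hZ : ∀ p, 0 < ordAt x p → p ∈ Z)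
    {a : X → ℕ} {b : X → ℤ} {ε : X → ℂ} {c r : X → ℝ} {τ : X → ℂ → X}
    (hloc : ∀ p ∈ Z, IsLocalForm S x y p (a p) (b p) (ε p) (c p) (r p) (τ p))
    (hdisj : ∀ p ∈ Z, ∀ q ∈ Z, p ≠ q →
      Disjoint (τ p '' Metric.ball 0 (r p)) (τ q '' Metric.ball 0 (r q))) :
    HasStripEnd S x y
      (∑ p ∈ Z, ∑ _k ∈ sheetIndices (ε p) (a p), (b p / a p : ℝ))
      (∑ p ∈ Z, ∑ k ∈ sheetIndices (ε p) (a p), (b p / a p * (k * Real.pi) : ℝ)) := by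
  classical
  set T := Z.sigma fun p => sheetIndices (ε p) (a p) with hT
  have hTm : ∀ j ∈ T, j.1 ∈ Z ∧ j.2 < a j.1 ∧ ε j.1 * (-1) ^ j.2 = 1 := by
    intro j hj
    obtain ⟨h1, h2⟩ := Finset.mem_sigma.1 hj
    exact ⟨h1, mem_sheetIndices.1 h2⟩
  have hball : ∀ᶠ w in stripEnd, ∀ j ∈ T, sheet (a j.1) j.2 w ∈ Metric.ball (0 : ℂ) (r j.1) := by
    rw [Finset.eventually_all]
    intro j hj
    have hl := hloc j.1 (hTm j hj).1
    exact ((tendsto_sheet hl.exponent_ne_zero j.2).mono_right nhdsWithin_le_nhds).eventually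
      (Metric.ball_mem_nhds _ hl.radius_pos)
  have hexp : Tendsto Complex.exp stripEnd (𝓝 0) :=
    Complex.tendsto_exp_comap_re_atBot.mono_left inf_le_left
  have hnear : ∀ᶠ w in stripEnd, ∀ q ∈ S, x q = Complex.exp w →
      ∃ p ∈ Z, q ∈ τ p '' Metric.ball 0 (r p) := by
    have h := eventually_fiber_subset hσ hi hS hx (z₀ := 0)
      (W := ⋃ p ∈ Z, interior (τ p '' Metric.ball 0 (r p)))
      (isOpen_biUnion fun p _ => isOpen_interior) (fun p _ ho hp0 => by
        have hpZ : p ∈ Z := hZ p (lt_of_le_of_ne ho fun h => hx.normal.ordAt_eq_zero_iff.1 h.symm hp0)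
        exact mem_biUnion hpZ (mem_interior_iff_mem_nhds.2 (hloc p hpZ).image_mem_nhds))
    filter_upwards [hexp.eventually h] with w hw q hq hqw
    obtain ⟨p, hp, hqp⟩ := mem_iUnion₂.1 (hw q hq hqw)
    exact ⟨p, hp, interior_subset hqp⟩
  have hstrip : ∀ᶠ w in stripEnd, w ∈ strip := mem_inf_of_right (mem_principal_self _)
  have hprod : ∀ᶠ w in stripEnd, fiberProd S x y w =
      ∏ j ∈ T, y (τ j.1 (sheet (a j.1) j.2 w)) := by
    filter_upwards [hball, hnear, hstrip] with w h1 h2 h3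
    have hfib : fiber S x w = ↑(T.image fun j => τ j.1 (sheet (a j.1) j.2 w)) := by
      ext q
      simp only [Finset.coe_image, mem_image, Finset.mem_coe]
      constructor
      · rintro ⟨hq, hqw⟩
        obtain ⟨p, hp, t, ht, rfl⟩ := h2 q hq hqw
        have hl := hloc p hp
        rw [hl.apply_eq t ht] at hqw
        obtain ⟨k, hk, hkt⟩ := exists_sheet_of_pow_eq hl.sign hl.exponent_ne_zero
          ((hl.mem_iff t ht).1 hq) h3 hqw
        exact ⟨⟨p, k⟩, Finset.mem_sigma.2 ⟨hp, hk⟩, by simp only [hkt]⟩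
      · rintro ⟨j, hj, rfl⟩
        have hl := hloc j.1 (hTm j hj).1
        refine ⟨(hl.mem_iff _ (h1 j hj)).2 (sheet_im_pos (hTm j hj).2.1 h3), ?_⟩
        rw [hl.apply_eq _ (h1 j hj), sheet_pow hl.exponent_ne_zero, ← mul_assoc, (hTm j hj).2.2,
          one_mul]
    rw [fiberProd, hfib, finprod_mem_coe_finset, Finset.prod_image]
    rintro ⟨p, k⟩ hj ⟨q, l⟩ hj' h
    have hpq : p = q := by
      by_contra hne
      exact (hdisj p (hTm _ hj).1 q (hTm _ hj').1 hne).le_bot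
        ⟨⟨_, h1 _ hj, rfl⟩, ⟨_, h1 _ hj', h.symm⟩⟩
    subst hpq
    have h4 := (hloc p (hTm _ hj).1).injOn (h1 _ hj) (h1 _ hj') h
    have h5 := sheet_injOn (hTm _ hj).2.1 (hTm _ hj').2.1 h4
    simp only at h5
    rw [h5]
  refine ⟨∏ j ∈ T, c j.1, Finset.prod_ne_zero_iff.2 fun j hj => (hloc _ (hTm j hj).1).coeff_ne_zero,
    ?_⟩
  have hlim : Tendsto (fun w => ∏ j ∈ T, y (τ j.1 (sheet (a j.1) j.2 w)) /
      (c j.1 * sheet (a j.1) j.2 w ^ b j.1)) stripEnd (𝓝 (∏ j ∈ T, (1 : ℂ))) := by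
    refine tendsto_finsetProd T fun j hj => ?_
    have hl := hloc j.1 (hTm j hj).1
    exact hl.tendsto.comp (tendsto_sheet hl.exponent_ne_zero j.2)
  rw [Finset.prod_const_one] at hlim
  refine hlim.congr' ?_
  filter_upwards [hprod] with w hw
  rw [hw, Finset.prod_div_distrib, Finset.prod_mul_distrib]
  congr 1
  push_cast
  congr 1
  simp_rw [sheet_zpow]
  rw [← Complex.exp_sum]
  congr 1
  rw [hT, Finset.sum_sigma, Finset.sum_mul, Finset.sum_mul, ← Finset.sum_add_distrib]
  refine Finset.sum_congr rfl fun p _ => ?_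
  rw [Finset.sum_mul, Finset.sum_mul, ← Finset.sum_add_distrib]
  refine Finset.sum_congr rfl fun k _ => ?_
  ring

omit [IsManifold 𝓘(ℂ) 1 X] [CompactSpace X] in
theorem ordAt_neg (p : X) : ordAt (-x) p = ordAt x p := by
  have h : chartRep (-x) p = (fun _ => (-1 : ℂ)) * chartRep x p := by
    ext z; simp [chartRep]
  rw [ordAt, h, meromorphicOrderAt_mul_of_ne_zero analyticAt_const (by simp)]
  rfl

/-- The contributions of the zeros of `x` to the logarithmic area. -/
theorem exists_hasStripEnd [T2Space X] (hσ : Continuous σ)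
    (hi : Function.Involutive σ) (hS : IsHalf σ S) (hx : IsRealFunction σ x)
    (hy : IsRealFunction σ y) :
    ∃ α β α' β' : ℝ, HasStripEnd S x y α β ∧ HasStripEnd S (-x) y α' β' ∧
      ∃ n : ℤ, (α + α') * (Real.pi ^ 2 / 2) + (β + β') * Real.pi = n * (Real.pi ^ 2 / 2) := by
  classical
  have hfin : {p | 0 < ordAt x p}.Finite := by
    refine hx.normal.finite_not_regularAt.subset fun p hp h => ?_
    exact (show 0 < ordAt x p from hp).ne' (hx.normal.ordAt_eq_zero_iff.2 h.2)
  set Z := hfin.toFinset with hZ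
  have hZm : ∀ p, p ∈ Z ↔ 0 < ordAt x p := fun p => hfin.mem_toFinset
  obtain ⟨U, hU, hUd⟩ := hfin.t2_separation
  have hex : ∀ p, ∃ (a : ℕ) (b : ℤ) (ε : ℂ) (c r : ℝ) (τ : ℂ → X), p ∈ Z →
      (IsLocalForm S x y p a b ε c r τ ∧ τ '' Metric.ball 0 r ⊆ U p) := by
    intro p
    by_cases hp : p ∈ Z
    · obtain ⟨a, b, ε, c, r, τ, h⟩ := exists_localForm hσ hi hS hx hy ((hZm p).1 hp)
        ((hU p).2.mem_nhds (hU p).1)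
      exact ⟨a, b, ε, c, r, τ, fun _ => h⟩
    -- Arbitrary values: only points of `Z` matter.
    · exact ⟨0, 0, 0, 0, 0, fun _ => p, fun h => (hp h).elim⟩
  choose a b ε c r τ h using hex
  have hdisj : ∀ p ∈ Z, ∀ q ∈ Z, p ≠ q →
      Disjoint (τ p '' Metric.ball 0 (r p)) (τ q '' Metric.ball 0 (r q)) := fun p hp q hq hpq =>
    (hUd ((hZm p).1 hp) ((hZm q).1 hq) hpq).mono (h p hp).2 (h q hq).2
  refine ⟨_, _, _, _, hasStripEnd_of_localForms hσ hi hS hx Z (fun p hp => (hZm p).2 hp)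
    (fun p hp => (h p hp).1) hdisj,
    hasStripEnd_of_localForms hσ hi hS hx.neg Z (fun p hp => (hZm p).2 (by
      rwa [ordAt_neg] at hp)) (fun p hp => (h p hp).1.neg) hdisj,
    ∑ p ∈ Z, b p * a p, ?_⟩
  -- Over both signs all k < a occur once, and the sum of (b/a)(π²/2 + kπ²) over these k equals ab ·
  -- π²/2.
  rw [← Finset.sum_add_distrib, ← Finset.sum_add_distrib, Finset.sum_mul, Finset.sum_mul,
    ← Finset.sum_add_distrib]
  push_cast
  rw [Finset.sum_mul]
  refine Finset.sum_congr rfl fun p hp => ?_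
  rw [sum_sheetIndices_add_neg (h p hp).1.sign, sum_sheetIndices_add_neg (h p hp).1.sign]
  have ha : (a p : ℝ) ≠ 0 := by exact_mod_cast (h p hp).1.exponent_ne_zero
  have hsum : ∀ n : ℕ, (∑ k ∈ Finset.range n, (k : ℝ)) = n * (n - 1) / 2 := by
    intro n
    induction n with
    | zero => simp
    | succ n ih => rw [Finset.sum_range_succ, ih]; push_cast; ring
  rw [Finset.sum_const, Finset.card_range, ← Finset.mul_sum, ← Finset.sum_mul, hsum, nsmul_eq_mul]
  field_simp
  ring

end QuantumIndex

end

/-! ### The imaginary part of the logarithm at an end. -/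

noncomputable section

namespace QuantumIndex

open Set Filter Topology

variable {X : Type*} {S : Set X} {x y : X → ℂ}

/-- Subtracting αw + βi from F leaves a function G with exp G = C R, where C is real and R → 1.
Where R is within distance 1 of 1, the imaginary part of G - log R is a continuous function with
values in πℤ on a connected set. Since C may be negative, the constant is a multiple of π only. -/
theorem HasStripEnd.exists_tendsto_im {α β : ℝ} (h : HasStripEnd S x y α β) {F : ℂ → ℂ}
    (hF : ContinuousOn F strip)
    (hexp : ∀ᶠ w in stripEnd, Complex.exp (F w) = fiberProd S x y w) :
    ∃ n : ℤ, Tendsto (fun w => (F w).im - (α * w.im + β)) stripEnd (𝓝 (n * Real.pi)) := by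
  obtain ⟨C, hC, hlim⟩ := h
  have hC' : (C : ℂ) ≠ 0 := by exact_mod_cast hC
  set G : ℂ → ℂ := fun w => F w - (α * w + β * Complex.I) with hG
  set R : ℂ → ℂ := fun w => Complex.exp (G w) / C with hR
  have hRlim : Tendsto R stripEnd (𝓝 1) := by
    refine hlim.congr' ?_
    filter_upwards [hexp] with w hw
    rw [hR, hG, ← hw]
    simp only [Complex.exp_sub]
    rw [div_div, mul_comm]
  obtain ⟨s₀, hs₀⟩ := eventually_stripEnd_iff.1
    (hRlim.eventually (Metric.ball_mem_nhds (1 : ℂ) one_pos))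
  set D : Set ℂ := strip ∩ {w | w.re < s₀} with hD
  have hDp : IsPreconnected D := (convex_strip.inter (convex_halfSpace_re_lt s₀)).isPreconnected
  have hslit : ∀ w ∈ D, R w ∈ Complex.slitPlane := fun w hw =>
    Complex.ball_one_subset_slitPlane (hs₀ w hw.1 hw.2)
  have hGc : ContinuousOn G D := (hF.mono inter_subset_left).sub (by fun_prop)
  have hRc : ContinuousOn R D := hGc.cexp.div_const _
  set H : ℂ → ℝ := fun w => ((G w - Complex.log (R w)).im) / Real.pi with hH
  have hHc : ContinuousOn H D :=
    (Complex.continuous_im.comp_continuousOn (hGc.sub (hRc.clog hslit))).div_const _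
  have hdisc : IsDiscrete (range ((↑) : ℤ → ℝ)) :=
    Int.isClosedEmbedding_coe_real.isInducing.isDiscrete_range
  obtain ⟨_, ⟨n, rfl⟩, hn⟩ := hDp.eqOn_const_of_mapsTo hdisc hHc (fun w hw => by
    have hR0 : R w ≠ 0 := Complex.slitPlane_ne_zero (hslit w hw)
    have h1 : Complex.exp (G w - Complex.log (R w)) = C := by
      rw [Complex.exp_sub, Complex.exp_log hR0, hR]
      field_simp
    have h2 := congrArg Complex.im h1
    rw [Complex.exp_im, Complex.ofReal_im, mul_eq_zero] at h2
    obtain ⟨n, hn⟩ := Real.sin_eq_zero_iff.1 (h2.resolve_left (Real.exp_pos _).ne')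
    refine ⟨n, ?_⟩
    simp only [hH]
    rw [← hn, mul_div_cancel_right₀ _ Real.pi_ne_zero]) ⟨0, 0, by simp⟩
  refine ⟨n, ?_⟩
  have hlog : Tendsto (fun w => (Complex.log (R w)).im + n * Real.pi) stripEnd
      (𝓝 ((Complex.log 1).im + n * Real.pi)) := by
    refine Tendsto.add_const _ ?_
    refine (Complex.continuous_im.continuousAt.tendsto).comp ?_
    exact (continuousAt_clog (by simp)).tendsto.comp hRlim
  rw [Complex.log_one, Complex.zero_im, zero_add] at hlog
  refine hlog.congr' (eventually_stripEnd_iff.2 ⟨s₀, fun w hw hws => ?_⟩)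
  have h1 := hn (show w ∈ D from ⟨hw, hws⟩)
  simp only [hH, Function.const_apply] at h1
  rw [div_eq_iff Real.pi_ne_zero] at h1
  rw [← h1, hG]
  simp

theorem tendsto_stripEnd {θ : ℝ} (h0 : 0 < θ) (h1 : θ < Real.pi) :
    Tendsto (fun s : ℝ => (s : ℂ) + θ * Complex.I) atBot stripEnd := by
  refine tendsto_inf.2 ⟨tendsto_comap_iff.2 ?_, tendsto_principal.2 (Eventually.of_forall ?_)⟩
  · have : Tendsto (fun s : ℝ => s) atBot atBot := tendsto_id
    simpa [Function.comp_def] using this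
  · intro s
    simpa [strip] using ⟨h0, h1⟩

/-- The fibers of `-x⁻¹` are those of `x`, by the reflection `w ↦ π i - w` of the strip. -/
theorem fiberProd_neg_inv (S : Set X) (x y : X → ℂ) (w : ℂ) :
    fiberProd S (-x⁻¹) y w = fiberProd S x y (Real.pi * Complex.I - w) := by
  have : fiber S (-x⁻¹) w = fiber S x (Real.pi * Complex.I - w) := by
    ext p
    simp only [fiber, mem_ofPred_eq, Pi.neg_apply, Pi.inv_apply]
    refine and_congr_right fun _ => ?_
    rw [Complex.exp_sub, Complex.exp_pi_mul_I, neg_eq_iff_eq_neg, inv_eq_iff_eq_inv, inv_neg,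
      neg_div, one_div]
  rw [fiberProd, fiberProd, this]

end QuantumIndex

end

/-! ### Integration over the strip along horizontal lines. -/

noncomputable section

namespace QuantumIndex

open Set Filter Topology MeasureTheory

/-- Im F' is the derivative of Im F in the real direction, so by Fubini each line contributes a
difference of two limits. These are affine in the height, and both θ and π - θ integrate to π²/2
over (0, π). -/
theorem setIntegral_strip_im_deriv {F : ℂ → ℂ} (hF : DifferentiableOn ℂ F strip)
    (hint : IntegrableOn (fun w => (deriv F w).im) strip) {α β B α' β' B' : ℝ}
    (hbot : Tendsto (fun w => (F w).im - (α * w.im + β)) stripEnd (𝓝 B))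
    (htop : Tendsto (fun w => (F (Real.pi * Complex.I - w)).im - (α' * w.im + β')) stripEnd (𝓝 B')) :
    ∫ w in strip, (deriv F w).im =
      (α' * (Real.pi ^ 2 / 2) + β' * Real.pi + B' * Real.pi) -
        (α * (Real.pi ^ 2 / 2) + β * Real.pi + B * Real.pi) := by
  set E := Complex.measurableEquivRealProd.symm with hE
  have hEv : ∀ q : ℝ × ℝ, E q = q.1 + q.2 * Complex.I := fun q => by
    apply Complex.ext <;> simp [hE, Complex.measurableEquivRealProd]
  have hpre : E ⁻¹' strip = univ ×ˢ Ioo 0 Real.pi := by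
    ext q
    simp [hEv, strip]
  have hmp : MeasurePreserving E := Complex.volume_preserving_equiv_real_prod.symm
  have hemb : MeasurableEmbedding E := E.measurableEmbedding
  have hmeas : (volume.restrict (E ⁻¹' strip) : Measure (ℝ × ℝ)) =
      (volume : Measure ℝ).prod (volume.restrict (Ioo 0 Real.pi)) := by
    rw [hpre, Measure.volume_eq_prod, ← Measure.prod_restrict, Measure.restrict_univ]
  rw [← hmp.setIntegral_preimage_emb hemb, hmeas]
  have hint' : Integrable (fun q : ℝ × ℝ => (deriv F (E q)).im)
      ((volume : Measure ℝ).prod (volume.restrict (Ioo 0 Real.pi))) := by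
    rw [← hmeas]
    exact (hmp.integrableOn_comp_preimage hemb).2 hint
  rw [integral_prod_symm _ hint']
  have hline : ∀ᵐ θ ∂(volume.restrict (Ioo 0 Real.pi)), ∫ s : ℝ, (deriv F (E (s, θ))).im =
      (α' * (Real.pi - θ) + β' + B') - (α * θ + β + B) := by
    filter_upwards [hint'.prod_left_ae, ae_restrict_mem measurableSet_Ioo] with θ hθ hθm
    have hmem : ∀ s : ℝ, (s : ℂ) + θ * Complex.I ∈ strip := fun s => by
      simpa [strip] using hθm
    refine integral_of_hasDerivAt_of_tendsto (f := fun s : ℝ => (F (s + θ * Complex.I)).im)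
      (fun s => ?_) hθ ?_ ?_
    · rw [hEv]
      have h1 : HasDerivAt F (deriv F (s + θ * Complex.I)) (s + θ * Complex.I) :=
        (hF.differentiableAt (isOpen_strip.mem_nhds (hmem s))).hasDerivAt
      have h2 : HasDerivAt (fun s : ℝ => (s : ℂ) + θ * Complex.I) 1 s :=
        (Complex.ofRealCLM.hasDerivAt (x := s)).add_const _
      have h3 := h1.comp s h2
      rw [mul_one] at h3
      exact (Complex.imCLM.hasFDerivAt.comp_hasDerivAt s h3)
    · have h1 := (hbot.comp (tendsto_stripEnd hθm.1 hθm.2)).add_const (α * θ + β)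
      rw [add_comm B] at h1
      refine h1.congr fun s => ?_
      simp
    -- The reflection w ↦ πi - w carries the end Re w → +∞ at height θ to the end Re w → -∞ at
    -- height π - θ.
    · have h1 := ((htop.comp (tendsto_stripEnd (θ := Real.pi - θ) (by linarith [hθm.2])
        (by linarith [hθm.1]))).add_const (α' * (Real.pi - θ) + β')).comp tendsto_neg_atTop_atBot
      rw [add_comm B'] at h1
      refine h1.congr fun s => ?_
      have : (Real.pi * Complex.I - (((-s : ℝ) : ℂ) + ((Real.pi - θ : ℝ) : ℂ) * Complex.I)) =
          s + θ * Complex.I := by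
        push_cast
        ring
      simp only [Function.comp_apply, this]
      simp
  rw [integral_congr_ae hline, ← integral_Ioc_eq_integral_Ioo,
    ← intervalIntegral.integral_of_le Real.pi_pos.le]
  have hpoly : ∀ θ ∈ uIcc 0 Real.pi, HasDerivAt
      (fun θ : ℝ => (α' * (Real.pi * θ - θ ^ 2 / 2) + β' * θ + B' * θ) -
        (α * (θ ^ 2 / 2) + β * θ + B * θ))
      ((α' * (Real.pi - θ) + β' + B') - (α * θ + β + B)) θ := by
    intro θ _
    have hsq : HasDerivAt (fun θ : ℝ => θ ^ 2 / 2) θ θ := by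
      have := (hasDerivAt_pow 2 θ).div_const 2
      simpa using this
    have hid := hasDerivAt_id θ
    have := (((((hid.const_mul Real.pi).fun_sub hsq).const_mul α').fun_add (hid.const_mul β')).add
      (hid.const_mul B')).fun_sub (((hsq.const_mul α).fun_add (hid.const_mul β)).fun_add (hid.const_mul B))
    simpa using this
  rw [intervalIntegral.integral_eq_sub_of_hasDerivAt hpoly
    (Continuous.intervalIntegrable (by fun_prop) _ _)]
  ring

end QuantumIndex

end

/-! ### The fibres of x over the upper half plane. -/

noncomputable section

namespace QuantumIndex

open Set Filter Topology

variable {X : Type*} [TopologicalSpace X] [ChartedSpace ℂ X]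

/-- A pair of real functions on a Riemann surface with chosen half `S`, the first of them with
isolated critical points. -/
structure IsRealPair (σ : X → X) (S : Set X) (x y : X → ℂ) : Prop where
  continuous : Continuous σ
  involutive : Function.Involutive σ
  isHalf : IsHalf σ S
  fst : IsRealFunction σ x
  snd : IsRealFunction σ y
  isolated : ∀ p, ∀ᶠ q in 𝓝[≠] p, mfderiv 𝓘(ℂ) 𝓘(ℂ) x q ≠ 0

/-- Sections `κ p`, `p ∈ T`, of `x` over `exp V` that exhaust the points of `S`. -/
structure IsSheets (S : Set X) (x : X → ℂ) (V : Set ℂ) (T : Finset X) (κ : X → ℂ → X) : Prop where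
  isParametrization : ∀ p ∈ T, IsParametrization (κ p) V
  mem_fiber : ∀ p ∈ T, ∀ w ∈ V, κ p w ∈ fiber S x w
  exists_eq : ∀ w ∈ V, ∀ q ∈ fiber S x w, ∃ p ∈ T, κ p w = q
  injOn : ∀ w ∈ V, InjOn (fun p => κ p w) T

/-- The critical values of `x` on `S`, in the logarithmic coordinate of the upper half plane. -/
def criticalValues (S : Set X) (x : X → ℂ) : Set ℂ :=
  {w | w ∈ strip ∧ ∃ p ∈ fiber S x w, mfderiv 𝓘(ℂ) 𝓘(ℂ) x p = 0}

namespace IsRealPair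

variable {σ : X → X} {S : Set X} {x y : X → ℂ} (h : IsRealPair σ S x y)
include h

theorem fst_ne_zero {p : X} (hp : p ∈ S) : x p ≠ 0 := h.fst.ne_zero p (h.isHalf.ne_of_mem hp)

theorem snd_ne_zero {p : X} (hp : p ∈ S) : y p ≠ 0 := h.snd.ne_zero p (h.isHalf.ne_of_mem hp)

theorem finite_criticalValues [CompactSpace X] : (criticalValues S x).Finite := by
  have hfin : {p | mfderiv 𝓘(ℂ) 𝓘(ℂ) x p = 0}.Finite :=
    finite_of_eventually_nhdsNE fun p => by simpa using h.isolated p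
  refine Set.Finite.of_finite_image (f := Complex.exp) ((hfin.image x).subset ?_)
    (injOn_exp_strip.mono fun w hw => hw.1)
  rintro _ ⟨w, ⟨-, p, hp, hc⟩, rfl⟩
  exact ⟨p, hc, hp.2⟩

variable [IsManifold 𝓘(ℂ) 1 X]

theorem fst_mdifferentiableAt {p : X} (hp : p ∈ S) : MDifferentiableAt 𝓘(ℂ) 𝓘(ℂ) x p :=
  (h.fst.normal.regularAt_iff.2 (h.fst_ne_zero hp)).1

theorem snd_mdifferentiableAt {p : X} (hp : p ∈ S) : MDifferentiableAt 𝓘(ℂ) 𝓘(ℂ) y p :=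
  (h.snd.normal.regularAt_iff.2 (h.snd_ne_zero hp)).1

omit [IsManifold 𝓘(ℂ) 1 X] in
theorem fst_analyticAt {p : X} (hp : p ∈ S) :
    AnalyticAt ℂ (chartRep x p) (chartAt ℂ p p) :=
  (h.fst.normal.analyticAt_iff p).1 (h.fst.normal.ordAt_eq_zero_iff.2 (h.fst_ne_zero hp)).ge

/-- Otherwise x would be constant on a punctured neighbourhood of p, which would then consist of
critical points. -/
theorem eventually_ne (c : ℂ) (p : X) :
    ∀ᶠ z in 𝓝[≠] (chartAt ℂ p p), chartRep x p z - c ≠ 0 := by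
  have hm : MeromorphicAt (fun z => chartRep x p z - c) (chartAt ℂ p p) :=
    (h.fst.normal.normalForm p).meromorphicAt.sub (MeromorphicAt.const c _)
  refine hm.eventually_eq_zero_or_eventually_ne_zero.resolve_left fun h0 => ?_
  have hz : ∀ᶠ z in 𝓝[≠] (chartAt ℂ p p), deriv (chartRep x p) z = 0 := by
    filter_upwards [eventually_eventually_nhdsWithin.2 h0, self_mem_nhdsWithin] with z hz hne
    rw [isOpen_compl_singleton.nhdsWithin_eq hne] at hz
    have : chartRep x p =ᶠ[𝓝 z] fun _ => c := by
      filter_upwards [hz] with v hv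
      exact sub_eq_zero.1 hv
    rw [this.deriv_eq, deriv_const]
  have hsrc : ∀ᶠ q in 𝓝[≠] p, q ∈ (chartAt ℂ p).source :=
    eventually_nhdsWithin_of_eventually_nhds (chart_source_mem_nhds ℂ p)
  have := nhdsNE_neBot p
  obtain ⟨q, h1, h2, h3, h4⟩ := (((tendsto_chart_nhdsNE p).eventually hz).and
    ((h.isolated p).and (hsrc.and (h.fst.normal.eventually_regularAt p)))).exists
  exact h2 ((mfderiv_eq_zero_iff_chart (chart_mem_atlas ℂ p) h3 h4.1).2 h1)

theorem finite_fiber [CompactSpace X] (w : ℂ) : (fiber S x w).Finite := by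
  refine finite_of_eventually_nhdsNE fun p => ?_
  apply eventually_nhdsNE_of_chart
  filter_upwards [h.eventually_ne (Complex.exp w) p] with z hz hf
  exact hz (sub_eq_zero.2 hf.2)

/-- Real points have real values, so outside σ(S) only points of S lie over exp w₀, and properness
applies. -/
theorem eventually_fiber [CompactSpace X] {w₀ : ℂ} (hw₀ : w₀ ∈ strip) {W : Set X} (hW : IsOpen W)
    (hfib : fiber S x w₀ ⊆ W) : ∀ᶠ w in 𝓝 w₀, fiber S x w ⊆ W := by
  have := eventually_fiber_subset h.continuous h.involutive h.isHalf h.fst hW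
    (z₀ := Complex.exp w₀) (fun p hp _ hpw => by
      rcases h.isHalf.mem_or hp with hS | hfix
      · exact hfib ⟨hS, hpw⟩
      · have h1 := h.fst.im_eq_zero h.continuous hfix
        have h2 := exp_im_pos hw₀
        rw [hpw] at h1
        exact absurd h1 h2.ne')
  filter_upwards [Complex.continuous_exp.continuousAt.eventually this] with w hw q hq
  exact hw q hq.1 hq.2

/-- Over a disc without critical values, the points of `S` are given by sections of `x`. -/
theorem exists_sections [CompactSpace X] [T2Space X] {w₀ : ℂ} (hw₀ : w₀ ∈ strip)
    (hc : w₀ ∉ criticalValues S x) :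
    ∃ V, IsOpen V ∧ w₀ ∈ V ∧ V ⊆ strip ∧ ∃ (T : Finset X) (κ : X → ℂ → X),
      IsSheets S x V T κ := by
  classical
  have hfin := h.finite_fiber w₀
  obtain ⟨U, hU, hUd⟩ := hfin.t2_separation
  have hex : ∀ p, ∃ Ψ : OpenPartialHomeomorph X ℂ, p ∈ fiber S x w₀ →
      (p ∈ Ψ.source ∧ Ψ.source ⊆ U p ∩ S ∧ (∀ q ∈ Ψ.source, Ψ q = Complex.log (x q)) ∧
      (∀ z ∈ Ψ.target, MDifferentiableAt 𝓘(ℂ) 𝓘(ℂ) Ψ.symm z)) := by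
    intro p
    by_cases hp : p ∈ fiber S x w₀
    swap
    · exact ⟨chartAt ℂ p, fun h => (hp h).elim⟩
    have hslit : chartRep x p (chartAt ℂ p p) ∈ Complex.slitPlane := by
      rw [chartRep_self, hp.2]
      exact Or.inr (exp_im_pos hw₀).ne'
    have han := h.fst_analyticAt hp.1
    have hd0 : deriv (chartRep x p) (chartAt ℂ p p) ≠ 0 := by
      intro h0
      refine hc ⟨hw₀, p, hp, ?_⟩
      exact (mfderiv_eq_zero_iff_chart (chart_mem_atlas ℂ p) (mem_chart_source ℂ p)
        (h.fst_mdifferentiableAt hp.1)).2 h0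
    -- At a non-critical point log x itself is a coordinate; its inverse is the section.
    have hd : deriv (fun z => Complex.log (chartRep x p z)) (chartAt ℂ p p) ≠ 0 := by
      rw [(han.differentiableAt.hasDerivAt.clog hslit).deriv]
      exact div_ne_zero hd0 (Complex.slitPlane_ne_zero hslit)
    obtain ⟨Ψ, h1, h2, h3, h4, -, -⟩ := exists_coordinate (han.clog hslit) hd
      (O := (chartAt ℂ p).source ∩ (U p ∩ S)) (inter_mem (chart_source_mem_nhds ℂ p)
        (((hU p).2.inter h.isHalf.isOpen).mem_nhds ⟨(hU p).1, hp.1⟩))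
    refine ⟨Ψ, fun _ => ⟨h1, fun q hq => (h2 hq).2, fun q hq => ?_, h4⟩⟩
    rw [h3 q hq, chartRep, (chartAt ℂ p).left_inv (h2 hq).1]
  choose Ψ hΨ using hex
  have hmem : ∀ p ∈ hfin.toFinset, p ∈ fiber S x w₀ := fun p hp => hfin.mem_toFinset.1 hp
  have hev1 : ∀ᶠ w in 𝓝 w₀, ∀ p ∈ hfin.toFinset, w ∈ (Ψ p).target := by
    rw [Finset.eventually_all]
    intro p hp
    have h1 := hΨ p (hmem p hp)
    have : Ψ p p = w₀ := by
      rw [h1.2.2.1 p h1.1, (hmem p hp).2, Complex.log_exp (by linarith [hw₀.1, Real.pi_pos]) hw₀.2.le]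
    exact (Ψ p).open_target.mem_nhds (this ▸ (Ψ p).map_source h1.1)
  have hev2 := h.eventually_fiber hw₀ (W := ⋃ p ∈ hfin.toFinset, (Ψ p).source)
    (isOpen_biUnion fun p _ => (Ψ p).open_source)
    (fun p hp => mem_biUnion (hfin.mem_toFinset.2 hp) (hΨ p hp).1)
  obtain ⟨V, hV, hVo, hwV⟩ := mem_nhds_iff.1
    (hev1.and (hev2.and (isOpen_strip.mem_nhds hw₀)))
  have hsec : ∀ p ∈ hfin.toFinset, ∀ w ∈ V, (Ψ p).symm w ∈ fiber S x w := by
    intro p hp w hw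
    have h1 := hΨ p (hmem p hp)
    have hs := (Ψ p).map_target ((hV hw).1 p hp)
    have hqS := (h1.2.1 hs).2
    refine ⟨hqS, ?_⟩
    have h2 := h1.2.2.1 _ hs
    rw [(Ψ p).right_inv ((hV hw).1 p hp)] at h2
    have h3 := congrArg Complex.exp h2
    rw [Complex.exp_log (h.fst_ne_zero hqS)] at h3
    exact h3.symm
  refine ⟨V, hVo, hwV, fun w hw => (hV hw).2.2, hfin.toFinset, fun p => (Ψ p).symm, ?_, hsec, ?_, ?_⟩
  · intro p hp
    refine ⟨hVo, fun z hz => (hΨ p (hmem p hp)).2.2.2 z ((hV hz).1 p hp), ?_⟩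
    exact (Ψ p).symm.injOn.mono fun w hw => (hV hw).1 p hp
  · intro w hw q hq
    obtain ⟨p, hp, hqp⟩ := mem_iUnion₂.1 ((hV hw).2.1 hq)
    refine ⟨p, hp, ?_⟩
    have h1 := (hΨ p (hmem p hp)).2.2.1 q hqp
    have hws := (hV hw).2.2
    rw [hq.2, Complex.log_exp (by linarith [hws.1, Real.pi_pos]) hws.2.le] at h1
    rw [← h1]
    exact (Ψ p).left_inv hqp
  · intro w hw p hp q hq hpq
    by_contra hne
    have h1 := (hΨ p (hmem p hp)).2.1 ((Ψ p).map_target ((hV hw).1 p hp))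
    have h2 := (hΨ q (hmem q hq)).2.1 ((Ψ q).map_target ((hV hw).1 q hq))
    simp only at hpq
    rw [← hpq] at h2
    exact (hUd (hmem p hp) (hmem q hq) hne).le_bot ⟨h1.1, h2.1⟩

/-- The norm of `y` along `x` is bounded above and below, also near critical values. -/
theorem exists_bound_fiberProd [CompactSpace X] {w₀ : ℂ} (hw₀ : w₀ ∈ strip) :
    ∃ B : ℝ, ∀ᶠ w in 𝓝 w₀, ‖fiberProd S x y w‖ ≤ B ∧ ‖(fiberProd S x y w)⁻¹‖ ≤ B := by
  classical
  have hfin := h.finite_fiber w₀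
  -- Near p the function x - exp w₀ is the n-th power of a coordinate, so every fibre has at most n
  -- points there, while y and 1/y are bounded by m.
  have hex : ∀ p, ∃ (n : ℕ) (m : ℝ) (W : Set X), p ∈ fiber S x w₀ → (IsOpen W ∧ p ∈ W ∧ 1 ≤ m ∧
      (∀ q ∈ W, ‖y q‖ ≤ m ∧ ‖(y q)⁻¹‖ ≤ m) ∧ ∀ w, (fiber S x w ∩ W).ncard ≤ n) := by
    intro p
    by_cases hp : p ∈ fiber S x w₀
    swap
    · exact ⟨0, 0, ∅, fun h => (hp h).elim⟩
    have han := h.fst_analyticAt hp.1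
    obtain ⟨n, hn⟩ : ∃ n : ℕ, analyticOrderAt (fun z => chartRep x p z - Complex.exp w₀)
        (chartAt ℂ p p) = n := by
      refine ENat.ne_top_iff_exists.1 (fun htop => ?_) |>.imp fun _ h => h.symm
      have h0 := eventually_nhdsWithin_of_eventually_nhds (s := {chartAt ℂ p p}ᶜ)
        (analyticOrderAt_eq_top.1 htop)
      obtain ⟨z, h1, h2⟩ := (h0.and (h.eventually_ne (Complex.exp w₀) p)).exists
      exact h2 h1
    have hn0 : n ≠ 0 := by
      rintro rfl
      have := (AnalyticAt.analyticOrderAt_eq_zero (han.sub analyticAt_const)).1 hn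
      rw [Pi.sub_apply, chartRep_self, hp.2, sub_self] at this
      exact this rfl
    have hyc := (h.snd_mdifferentiableAt hp.1).continuousAt
    have hy0 := h.snd_ne_zero hp.1
    have hO : {q | ‖y q‖ < ‖y p‖ + ‖(y p)⁻¹‖ + 1 ∧ ‖(y q)⁻¹‖ < ‖y p‖ + ‖(y p)⁻¹‖ + 1} ∈ 𝓝 p := by
      refine Filter.Eventually.and (hyc.norm.eventually_lt_const ?_)
        ((hyc.inv₀ hy0).norm.eventually_lt_const ?_)
      · linarith [norm_nonneg (y p)⁻¹]
      · simp only [Pi.inv_apply]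
        linarith [norm_nonneg (y p)]
    obtain ⟨Ψ, h1, h2, -, h3, -⟩ := exists_root_coordinate hn0 han hn hO
    refine ⟨n, ‖y p‖ + ‖(y p)⁻¹‖ + 1, Ψ.source, fun _ => ⟨Ψ.open_source, h1, ?_, ?_, ?_⟩⟩
    · linarith [norm_nonneg (y p), norm_nonneg (y p)⁻¹]
    · exact fun q hq => ⟨(h2 hq).1.le, (h2 hq).2.le⟩
    · intro w
      have hsub : Ψ '' (fiber S x w ∩ Ψ.source) ⊆
          (Polynomial.nthRoots n (Complex.exp w - Complex.exp w₀)).toFinset := by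
        rintro _ ⟨q, ⟨hq, hqs⟩, rfl⟩
        have h4 := h3 q hqs
        rw [hq.2] at h4
        simp [Polynomial.mem_nthRoots (Nat.pos_of_ne_zero hn0), h4]
      rw [← (Ψ.injOn.mono inter_subset_right).ncard_image]
      refine (ncard_le_ncard hsub (Finset.finite_toSet _)).trans ?_
      rw [ncard_coe_finset]
      exact (Multiset.toFinset_card_le _).trans (Polynomial.card_nthRoots n _)
  choose n m W hW using hex
  have hmem : ∀ p ∈ hfin.toFinset, p ∈ fiber S x w₀ := fun p hp => hfin.mem_toFinset.1 hp
  -- The summand 1 ensures M ≥ 1, so a product with fewer factors is still bounded by the full power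
  -- of M.
  set M : ℝ := 1 + ∑ p ∈ hfin.toFinset, m p with hM
  have hmpos : ∀ p ∈ hfin.toFinset, 0 ≤ m p := fun p hp =>
    zero_le_one.trans (hW p (hmem p hp)).2.2.1
  have hM1 : 1 ≤ M := by
    rw [hM]
    linarith [Finset.sum_nonneg hmpos]
  have hmM : ∀ p ∈ hfin.toFinset, m p ≤ M := fun p hp => by
    have := Finset.single_le_sum hmpos hp
    linarith
  refine ⟨M ^ (∑ p ∈ hfin.toFinset, n p), ?_⟩
  filter_upwards [h.eventually_fiber hw₀ (W := ⋃ p ∈ hfin.toFinset, W p)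
    (isOpen_biUnion fun p hp => (hW p (hmem p hp)).1)
    (fun p hp => mem_biUnion (hfin.mem_toFinset.2 hp) (hW p hp).2.1)] with w hw
  have hfw := h.finite_fiber w
  have hcard : hfw.toFinset.card ≤ ∑ p ∈ hfin.toFinset, n p := by
    have h1 : hfw.toFinset ⊆ hfin.toFinset.biUnion fun p => (hfw.subset
        (inter_subset_left (t := W p))).toFinset := by
      intro q hq
      have hq' := hfw.mem_toFinset.1 hq
      obtain ⟨p, hp, hqp⟩ := mem_iUnion₂.1 (hw hq')
      exact Finset.mem_biUnion.2 ⟨p, hp, by simpa using ⟨hq', hqp⟩⟩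
    refine (Finset.card_le_card h1).trans (Finset.card_biUnion_le.trans ?_)
    refine Finset.sum_le_sum fun p hp => ?_
    rw [← ncard_eq_toFinset_card _ (hfw.subset inter_subset_left)]
    exact (hW p (hmem p hp)).2.2.2.2 w
  have hb : ∀ q ∈ hfw.toFinset, ‖y q‖ ≤ M ∧ ‖(y q)⁻¹‖ ≤ M := by
    intro q hq
    obtain ⟨p, hp, hqp⟩ := mem_iUnion₂.1 (hw (hfw.mem_toFinset.1 hq))
    have h1 := (hW p (hmem p hp)).2.2.2.1 q hqp
    exact ⟨h1.1.trans (hmM p hp), h1.2.trans (hmM p hp)⟩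
  have hgen : ∀ g : X → ℂ, (∀ q ∈ hfw.toFinset, ‖g q‖ ≤ M) →
      ‖∏ q ∈ hfw.toFinset, g q‖ ≤ M ^ (∑ p ∈ hfin.toFinset, n p) := by
    intro g hg
    rw [norm_prod]
    calc ∏ q ∈ hfw.toFinset, ‖g q‖ ≤ ∏ _q ∈ hfw.toFinset, M :=
          Finset.prod_le_prod (fun _ _ => norm_nonneg _) hg
      _ = M ^ hfw.toFinset.card := Finset.prod_const M
      _ ≤ _ := pow_le_pow_right₀ hM1 hcard
  rw [fiberProd, finprod_mem_eq_finite_toFinset_prod _ hfw]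
  refine ⟨hgen _ fun q hq => (hb q hq).1, ?_⟩
  rw [← Finset.prod_inv_distrib]
  exact hgen _ fun q hq => (hb q hq).2

end IsRealPair

end QuantumIndex

end

/-! ### The holomorphic logarithm of the norm. -/

noncomputable section

namespace QuantumIndex

open Set Filter Topology

/-- A holomorphic function on an open set minus a finite set, bounded above and below near each
point, extends without zeros. -/
theorem exists_differentiableOn_extension {G : ℂ → ℂ} {U B : Set ℂ} (hU : IsOpen U) (hB : B.Finite)
    (hG : DifferentiableOn ℂ G (U \ B)) (h0 : ∀ w ∈ U \ B, G w ≠ 0)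
    (hb : ∀ w ∈ U, ∃ M : ℝ, ∀ᶠ v in 𝓝 w, ‖G v‖ ≤ M ∧ ‖(G v)⁻¹‖ ≤ M) :
    ∃ Y : ℂ → ℂ, DifferentiableOn ℂ Y U ∧ (∀ w ∈ U, Y w ≠ 0) ∧ EqOn Y G (U \ B) := by
  have hopen : IsOpen (U \ B) := hU.sdiff hB.isClosed
  set Y : ℂ → ℂ := fun w => limUnder (𝓝[≠] w) G with hY
  have heq : EqOn Y G (U \ B) := fun w hw =>
    ((hG.differentiableAt (hopen.mem_nhds hw)).continuousAt.tendsto.mono_left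
      nhdsWithin_le_nhds).limUnder_eq
  have hloc : ∀ w ∈ U, ∃ M : ℝ, ∃ s ∈ 𝓝 w, s \ {w} ⊆ U \ B ∧
      ∀ v ∈ s, ‖G v‖ ≤ M ∧ ‖(G v)⁻¹‖ ≤ M := by
    intro w hw
    obtain ⟨M, hM⟩ := hb w hw
    have h1 := eventually_nhdsWithin_iff.1 (eventually_nhdsNE_of_finite hB w)
    refine ⟨M, _, hM.and (h1.and (hU.mem_nhds hw)), ?_, fun v hv => hv.1⟩
    exact fun v hv => ⟨hv.1.2.2, hv.1.2.1 hv.2⟩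
  have hd : ∀ w ∈ U, DifferentiableAt ℂ Y w := by
    intro w hw
    obtain ⟨M, s, hs, hsub, hM⟩ := hloc w hw
    have h1 := Complex.differentiableOn_update_limUnder_of_bddAbove hs (hG.mono hsub)
      ⟨M, by rintro _ ⟨v, hv, rfl⟩; exact (hM v hv.1).1⟩
    refine (h1.congr fun v hv => ?_).differentiableAt hs
    by_cases hvw : v = w
    · subst hvw
      simp [hY]
    · rw [Function.update_of_ne hvw]
      exact heq (hsub ⟨hv, hvw⟩)
  refine ⟨Y, fun w hw => (hd w hw).differentiableWithinAt, fun w hw hYw => ?_, heq⟩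
  obtain ⟨M, s, hs, hsub, hM⟩ := hloc w hw
  -- A zero of the extension would make 1/G unbounded: 1 ≤ M|Y v| near w, while the right side would
  -- tend to 0.
  have h1 : Tendsto (fun v => M * ‖Y v‖) (𝓝[≠] w) (𝓝 (M * ‖Y w‖)) :=
    ((hd w hw).continuousAt.norm.tendsto.const_mul M).mono_left nhdsWithin_le_nhds
  rw [hYw, norm_zero, mul_zero] at h1
  have h2 : ∀ᶠ v in 𝓝[≠] w, (1 : ℝ) ≤ M * ‖Y v‖ := by
    filter_upwards [mem_nhdsWithin_of_mem_nhds hs, self_mem_nhdsWithin] with v hv hne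
    have hv' := hsub ⟨hv, hne⟩
    rw [heq hv']
    calc (1 : ℝ) = ‖(G v)⁻¹‖ * ‖G v‖ := by
          rw [← norm_mul, inv_mul_cancel₀ (h0 v hv'), norm_one]
      _ ≤ M * ‖G v‖ := by gcongr; exact (hM v hv).2
  exact absurd (ge_of_tendsto h1 h2) (by norm_num)

/-- A convex set is simply connected, which gives a continuous logarithm. It is holomorphic because
near w it equals F(w) + log(Y/Y(w)) with the principal branch. -/
theorem exists_differentiableOn_log {Y : ℂ → ℂ} {U : Set ℂ} (hU : IsOpen U) (hc : Convex ℝ U)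
    (hne : U.Nonempty) (hY : DifferentiableOn ℂ Y U) (h0 : ∀ w ∈ U, Y w ≠ 0) :
    ∃ F : ℂ → ℂ, DifferentiableOn ℂ F U ∧ ∀ w ∈ U, Complex.exp (F w) = Y w := by
  have := hc.contractibleSpace hne
  have hsc : IsSimplyConnected U := inferInstanceAs (SimplyConnectedSpace U)
  obtain ⟨F, hFc, hF⟩ := Complex.exists_continuousOn_eqOn_exp_comp hsc hU hY.continuousOn
    (by rintro ⟨w, hw, h⟩; exact h0 w hw h)
  refine ⟨F, fun w hw => DifferentiableAt.differentiableWithinAt ?_, hF⟩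
  have hFw := hFc.continuousAt (hU.mem_nhds hw)
  have hYd := hY.differentiableAt (hU.mem_nhds hw)
  have hlog : DifferentiableAt ℂ (fun v => F w + Complex.log (Y v / Y w)) w := by
    refine DifferentiableAt.const_add _ ((hYd.div_const _).clog ?_)
    simp [div_self (h0 w hw)]
  refine hlog.congr_of_eventuallyEq ?_
  have h1 : Tendsto (fun v => (F v - F w).im) (𝓝 w) (𝓝 0) := by
    have := Complex.continuous_im.continuousAt.tendsto.comp (hFw.tendsto.sub_const (F w))
    rwa [sub_self, Complex.zero_im] at this
  filter_upwards [hU.mem_nhds hw, h1.eventually (Ioo_mem_nhds (neg_lt_zero.2 Real.pi_pos)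
    Real.pi_pos)] with v hv him
  have h2 : Y v / Y w = Complex.exp (F v - F w) := by
    rw [Complex.exp_sub, ← hF hv, ← hF hw]
    rfl
  rw [h2, Complex.log_exp him.1 him.2.le]
  ring

variable {X : Type*} [TopologicalSpace X] [ChartedSpace ℂ X]

namespace IsSheets

variable {S : Set X} {x : X → ℂ} {V : Set ℂ} {T : Finset X} {κ : X → ℂ → X}

theorem fiberProd_eq (hκ : IsSheets S x V T κ) (y : X → ℂ) {w : ℂ} (hw : w ∈ V) :
    fiberProd S x y w = ∏ p ∈ T, y (κ p w) := by
  classical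
  have : fiber S x w = ↑(T.image fun p => κ p w) := by
    ext q
    simp only [Finset.coe_image, mem_image, Finset.mem_coe]
    constructor
    · exact fun hq => hκ.exists_eq w hw q hq
    · rintro ⟨p, hp, rfl⟩
      exact hκ.mem_fiber p hp w hw
  rw [fiberProd, this, finprod_mem_coe_finset, Finset.prod_image (hκ.injOn w hw)]

theorem mono (hκ : IsSheets S x V T κ) {V' : Set ℂ} (hV' : IsOpen V') (hsub : V' ⊆ V) :
    IsSheets S x V' T κ where
  isParametrization p hp := ⟨hV', fun w hw => (hκ.isParametrization p hp).mdifferentiableAt w (hsub hw),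
    (hκ.isParametrization p hp).injOn.mono hsub⟩
  mem_fiber p hp w hw := hκ.mem_fiber p hp w (hsub hw)
  exists_eq w hw := hκ.exists_eq w (hsub hw)
  injOn w hw := hκ.injOn w (hsub hw)

end IsSheets

namespace IsRealPair

variable {σ : X → X} {S : Set X} {x y : X → ℂ} (h : IsRealPair σ S x y) [IsManifold 𝓘(ℂ) 1 X]
include h

theorem differentiableAt_sheet {V : Set ℂ} {T : Finset X} {κ : X → ℂ → X}
    (hκ : IsSheets S x V T κ) {p : X} (hp : p ∈ T) {w : ℂ} (hw : w ∈ V) :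
    DifferentiableAt ℂ (fun w => y (κ p w)) w :=
  mdifferentiableAt_iff_differentiableAt.1
    ((h.snd_mdifferentiableAt (hκ.mem_fiber p hp w hw).1).comp w
      ((hκ.isParametrization p hp).mdifferentiableAt w hw))

omit [IsManifold 𝓘(ℂ) 1 X] in
theorem snd_sheet_ne_zero {V : Set ℂ} {T : Finset X} {κ : X → ℂ → X}
    (hκ : IsSheets S x V T κ) {p : X} (hp : p ∈ T) {w : ℂ} (hw : w ∈ V) : y (κ p w) ≠ 0 :=
  h.snd_ne_zero (hκ.mem_fiber p hp w hw).1

theorem exists_sheets [CompactSpace X] [T2Space X] {w : ℂ} (hw : w ∈ strip \ criticalValues S x) :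
    ∃ V, IsOpen V ∧ w ∈ V ∧ V ⊆ strip \ criticalValues S x ∧ ∃ (T : Finset X) (κ : X → ℂ → X),
      IsSheets S x V T κ := by
  obtain ⟨V, hV, hwV, hVs, T, κ, hκ⟩ := h.exists_sections hw.1 hw.2
  have hV' := hV.sdiff h.finite_criticalValues.isClosed
  exact ⟨V \ criticalValues S x, hV', ⟨hwV, hw.2⟩, sdiff_le_sdiff_right hVs, T, κ,
    hκ.mono hV' sdiff_subset⟩

/-- The norm of `y` along `x` has a holomorphic logarithm on the strip. -/
theorem exists_log_fiberProd [CompactSpace X] [T2Space X] :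
    ∃ F : ℂ → ℂ, DifferentiableOn ℂ F strip ∧
      ∀ w ∈ strip \ criticalValues S x, Complex.exp (F w) = fiberProd S x y w := by
  have hloc : ∀ w ∈ strip \ criticalValues S x,
      DifferentiableAt ℂ (fiberProd S x y) w ∧ fiberProd S x y w ≠ 0 := by
    intro w hw
    obtain ⟨V, hV, hwV, -, T, κ, hκ⟩ := h.exists_sheets hw
    constructor
    · have h1 : DifferentiableAt ℂ (fun w => ∏ p ∈ T, y (κ p w)) w :=
        DifferentiableAt.fun_finsetProd fun p hp => h.differentiableAt_sheet hκ hp hwV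
      refine h1.congr_of_eventuallyEq ?_
      filter_upwards [hV.mem_nhds hwV] with v hv
      exact hκ.fiberProd_eq y hv
    · rw [hκ.fiberProd_eq y hwV]
      exact Finset.prod_ne_zero_iff.2 fun p hp => h.snd_sheet_ne_zero hκ hp hwV
  obtain ⟨Y, hY, hY0, hYG⟩ := exists_differentiableOn_extension isOpen_strip
    h.finite_criticalValues (fun w hw => (hloc w hw).1.differentiableWithinAt)
    (fun w hw => (hloc w hw).2) (fun w hw => h.exists_bound_fiberProd hw)
  obtain ⟨F, hF, hFY⟩ := exists_differentiableOn_log isOpen_strip convex_strip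
    ⟨Real.pi / 2 * Complex.I, by
      constructor <;> simp <;> linarith [Real.pi_pos]⟩ hY hY0
  exact ⟨F, hF, fun w hw => (hFY w hw.1).trans (hYG hw)⟩

/-- The derivative of the logarithm of the norm is the sum over the sheets. -/
theorem deriv_log_fiberProd {F : ℂ → ℂ} (hF : DifferentiableOn ℂ F strip)
    (hexp : ∀ w ∈ strip \ criticalValues S x, Complex.exp (F w) = fiberProd S x y w)
    {V : Set ℂ} {T : Finset X} {κ : X → ℂ → X} (hκ : IsSheets S x V T κ) (hV : IsOpen V)
    (hVs : V ⊆ strip \ criticalValues S x) {w : ℂ} (hw : w ∈ V) :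
    deriv F w = ∑ p ∈ T, logDeriv (fun w => y (κ p w)) w := by
  have hFd := hF.differentiableAt (isOpen_strip.mem_nhds (hVs hw).1)
  have h1 : (fun w => Complex.exp (F w)) =ᶠ[𝓝 w] fun w => ∏ p ∈ T, y (κ p w) := by
    filter_upwards [hV.mem_nhds hw] with v hv
    rw [hexp v (hVs hv), hκ.fiberProd_eq y hv]
  have h2 : logDeriv (fun w => Complex.exp (F w)) w = deriv F w := by
    rw [logDeriv_apply, hFd.hasDerivAt.cexp.deriv, mul_div_cancel_left₀ _ (Complex.exp_ne_zero _)]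
  have h3 : logDeriv (fun w => Complex.exp (F w)) w =
      logDeriv (fun w => ∏ p ∈ T, y (κ p w)) w := by
    rw [logDeriv_apply, logDeriv_apply, h1.deriv_eq, h1.eq_of_nhds]
  rw [← h2, h3, logDeriv_prod]
  · exact fun p hp => h.snd_sheet_ne_zero hκ hp hw
  · exact fun p hp => h.differentiableAt_sheet hκ hp hw

end IsRealPair

end QuantumIndex

end

/-! ### The area over the upper half plane as an integral over the strip. -/

noncomputable section

namespace QuantumIndex

open Set Filter Topology MeasureTheory
open scoped Function

/-- The points of `S` over `exp E`. -/
def pointsOver {X : Type*} (S : Set X) (x : X → ℂ) (E : Set ℂ) : Set X :=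
  {p | p ∈ S ∧ ∃ w ∈ E, x p = Complex.exp w}

section pointsOver

variable {X : Type*} {S : Set X} {x : X → ℂ}

theorem pointsOver_union (E E' : Set ℂ) :
    pointsOver S x (E ∪ E') = pointsOver S x E ∪ pointsOver S x E' := by
  ext p
  simp only [pointsOver, mem_union, mem_ofPred_eq, or_and_right, exists_or, and_or_left]

theorem pointsOver_iUnion {ι : Type*} (E : ι → Set ℂ) :
    pointsOver S x (⋃ i, E i) = ⋃ i, pointsOver S x (E i) := by
  ext p
  simp only [pointsOver, mem_iUnion, mem_ofPred_eq]
  constructor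
  · rintro ⟨h, w, ⟨i, hi⟩, hw⟩
    exact ⟨i, h, w, hi, hw⟩
  · rintro ⟨i, h, w, hi, hw⟩
    exact ⟨h, w, ⟨i, hi⟩, hw⟩

theorem disjoint_pointsOver {E E' : Set ℂ} (hE : E ⊆ strip) (hE' : E' ⊆ strip)
    (h : Disjoint E E') : Disjoint (pointsOver S x E) (pointsOver S x E') := by
  refine disjoint_left.2 ?_
  rintro p ⟨-, w, hw, hpw⟩ ⟨-, w', hw', hpw'⟩
  have := injOn_exp_strip (hE hw) (hE' hw') (hpw.symm.trans hpw')
  exact h.le_bot ⟨hw, this ▸ hw'⟩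

theorem pointsOver_strip : pointsOver S x strip = S ∩ {p | 0 < (x p).im} := by
  ext p
  constructor
  · rintro ⟨hp, w, hw, hpw⟩
    exact ⟨hp, by simpa [hpw] using exp_im_pos hw⟩
  · rintro ⟨hp, him⟩
    have him' : 0 < (x p).im := him
    refine ⟨hp, Complex.log (x p), log_mem_strip him', (Complex.exp_log ?_).symm⟩
    rintro h0
    simp [h0] at him'

end pointsOver

variable {X : Type*} [TopologicalSpace X] [ChartedSpace ℂ X]

namespace IsRealPair

variable {σ : X → X} {S : Set X} {x y : X → ℂ} (h : IsRealPair σ S x y) [IsManifold 𝓘(ℂ) 1 X]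
  [CompactSpace X] [T2Space X] [MeasurableSpace X] [BorelSpace X] (Q : ChartPartition X)
include h

theorem integrable : Integrable (areaDensity Q (fun p => Real.log ‖x p‖) (fun p => Real.log ‖y p‖))
    (areaMeasure Q) :=
  integrable_areaDensity Q (fun p => (h.fst.normal.normalForm p).meromorphicAt)
    h.fst.normal.ord_ne_top (fun p => (h.snd.normal.normalForm p).meromorphicAt)
    h.snd.normal.ord_ne_top

variable {F : ℂ → ℂ} (hF : DifferentiableOn ℂ F strip)
  (hexp : ∀ w ∈ strip \ criticalValues S x, Complex.exp (F w) = fiberProd S x y w)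
include hF hexp

/-- On a sheet parametrized by w, log|x| is Re w, so the density is -Im of the logarithmic
derivative of y. Summed over the sheets this is -Im F'. -/
theorem setIntegral_sheets {V : Set ℂ} {T : Finset X} {κ : X → ℂ → X} (hκ : IsSheets S x V T κ)
    (hV : IsOpen V) (hVs : V ⊆ strip \ criticalValues S x) {E : Set ℂ} (hE : MeasurableSet E)
    (hEV : E ⊆ V) :
    IntegrableOn (fun w => (deriv F w).im) E ∧ MeasurableSet (pointsOver S x E) ∧
    ∫ p in pointsOver S x E, areaDensity Q (fun p => Real.log ‖x p‖) (fun p => Real.log ‖y p‖) p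
      ∂areaMeasure Q = -∫ w in E, (deriv F w).im := by
  have hD := h.integrable Q
  have hPf := h.fst.normal.finite_not_regularAt.union h.snd.normal.finite_not_regularAt
  have hu : ∀ q ∉ {p | ¬ RegularAt x p} ∪ {p | ¬ RegularAt y p},
      RealDifferentiableAt (fun p => Real.log ‖x p‖) q := fun q hq =>
    RegularAt.realDifferentiableAt (not_not.1 fun hn => hq (Or.inl hn))
  have hv : ∀ q ∉ {p | ¬ RegularAt x p} ∪ {p | ¬ RegularAt y p},
      RealDifferentiableAt (fun p => Real.log ‖y p‖) q := fun q hq =>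
    RegularAt.realDifferentiableAt (not_not.1 fun hn => hq (Or.inr hn))
  have hover : pointsOver S x E = ⋃ p ∈ T, κ p '' E := by
    ext q
    simp only [mem_iUnion]
    constructor
    · rintro ⟨hq, w, hw, hqw⟩
      obtain ⟨p, hp, rfl⟩ := hκ.exists_eq w (hEV hw) q ⟨hq, hqw⟩
      exact ⟨p, hp, w, hw, rfl⟩
    · rintro ⟨p, hp, w, hw, rfl⟩
      have := hκ.mem_fiber p hp w (hEV hw)
      exact ⟨this.1, w, hw, this.2⟩
  have hmeas : ∀ p ∈ T, MeasurableSet (κ p '' E) := fun p hp =>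
    (hκ.isParametrization p hp).measurableSet_image hE hEV
  have hdens : ∀ p ∈ T, ∀ w ∈ E, wedgeDensity (fun w => Real.log ‖x (κ p w)‖)
      (fun w => Real.log ‖y (κ p w)‖) w = -(logDeriv (fun w => y (κ p w)) w).im := by
    intro p hp w hw
    have h1 : (fun w => Real.log ‖x (κ p w)‖) =ᶠ[𝓝 w] fun w => Real.log ‖Complex.exp w‖ := by
      filter_upwards [hV.mem_nhds (hEV hw)] with v hv
      rw [(hκ.mem_fiber p hp v hv).2]
    rw [wedgeDensity_congr h1 EventuallyEq.rfl, wedgeDensity_log_norm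
      Complex.differentiableAt_exp (Complex.exp_ne_zero w) (h.differentiableAt_sheet hκ hp (hEV hw))
      (h.snd_sheet_ne_zero hκ hp (hEV hw))]
    have : logDeriv (fun w => Complex.exp w) w = 1 := by
      rw [logDeriv_apply, (Complex.hasDerivAt_exp w).deriv, div_self (Complex.exp_ne_zero w)]
    rw [this]
    simp
  have hint : ∀ p ∈ T, IntegrableOn (fun w => (logDeriv (fun w => y (κ p w)) w).im) E := by
    intro p hp
    have h1 := ((hκ.isParametrization p hp).integrableOn_iff Q hPf hu hv hE hEV).1 hD.integrableOn
    have h2 := ((integrableOn_congr_fun (hdens p hp) hE).1 h1).neg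
    simpa using h2
  have hderiv : ∀ w ∈ E, (deriv F w).im = ∑ p ∈ T, (logDeriv (fun w => y (κ p w)) w).im := by
    intro w hw
    rw [h.deriv_log_fiberProd hF hexp hκ hV hVs (hEV hw), Complex.im_sum]
  refine ⟨?_, ?_, ?_⟩
  · refine (integrableOn_congr_fun hderiv hE).2 ?_
    exact integrable_finsetSum T hint
  · rw [hover]
    exact T.measurableSet_biUnion hmeas
  · rw [hover, integral_biUnion_finset T hmeas ?_ fun p _ => hD.integrableOn,
      setIntegral_congr_fun hE hderiv, integral_finsetSum T hint, ← Finset.sum_neg_distrib]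
    · refine Finset.sum_congr rfl fun p hp => ?_
      rw [(hκ.isParametrization p hp).setIntegral Q hPf hu hv hE hEV hD.integrableOn,
        setIntegral_congr_fun hE (hdens p hp), integral_neg]
    · intro p hp q hq hpq
      refine disjoint_left.2 ?_
      rintro _ ⟨w, hw, rfl⟩ ⟨w', hw', hww⟩
      have h1 := (hκ.mem_fiber p hp w (hEV hw)).2
      have h2 := (hκ.mem_fiber q hq w' (hEV hw')).2
      rw [hww, h1] at h2
      have h3 := injOn_exp_strip (hVs (hEV hw)).1 (hVs (hEV hw')).1 h2
      subst h3
      exact hpq (hκ.injOn w (hEV hw) hp hq hww.symm)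

/-- Contributions of different sheets may cancel, hence an inequality. Splitting E by the sign of Im
F' reduces it to |∫| ≤ ∫|·| on each part. It gives the summability needed to pass to a countable
cover. -/
theorem integral_norm_le_of_sheets {V : Set ℂ} {T : Finset X} {κ : X → ℂ → X}
    (hκ : IsSheets S x V T κ)
    (hV : IsOpen V) (hVs : V ⊆ strip \ criticalValues S x) {E : Set ℂ} (hE : MeasurableSet E)
    (hEV : E ⊆ V) :
    ∫ w in E, ‖(deriv F w).im‖ ≤ ∫ p in pointsOver S x E,
      ‖areaDensity Q (fun p => Real.log ‖x p‖) (fun p => Real.log ‖y p‖) p‖ ∂areaMeasure Q := by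
  have hD := h.integrable Q
  have hg : Measurable fun w => (deriv F w).im := Complex.measurable_im.comp (measurable_deriv F)
  set A := E ∩ {w | 0 ≤ (deriv F w).im} with hA
  set B := E ∩ {w | (deriv F w).im < 0} with hB
  have hAm : MeasurableSet A := hE.inter (measurableSet_le measurable_const hg)
  have hBm : MeasurableSet B := hE.inter (measurableSet_lt hg measurable_const)
  have hAB : Disjoint A B := disjoint_left.2 fun w h1 h2 =>
    not_le_of_gt (show (deriv F w).im < 0 from h2.2) h1.2
  have hEAB : E = A ∪ B := by
    ext w
    constructor
    · intro hw
      rcases le_or_gt 0 (deriv F w).im with h1 | h1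
      · exact Or.inl ⟨hw, h1⟩
      · exact Or.inr ⟨hw, h1⟩
    · rintro (hw | hw)
      · exact hw.1
      · exact hw.1
  have hAV : A ⊆ V := inter_subset_left.trans hEV
  have hBV : B ⊆ V := inter_subset_left.trans hEV
  obtain ⟨iA, mA, eA⟩ := h.setIntegral_sheets Q hF hexp hκ hV hVs hAm hAV
  obtain ⟨iB, mB, eB⟩ := h.setIntegral_sheets Q hF hexp hκ hV hVs hBm hBV
  have hdis : Disjoint (pointsOver S x A) (pointsOver S x B) :=
    disjoint_pointsOver (fun w hw => (hVs (hAV hw)).1) (fun w hw => (hVs (hBV hw)).1) hAB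
  have h1 : ∫ w in A, ‖(deriv F w).im‖ = ∫ w in A, (deriv F w).im :=
    setIntegral_congr_fun hAm fun w hw => Real.norm_of_nonneg hw.2
  have h2 : ∫ w in B, ‖(deriv F w).im‖ = -∫ w in B, (deriv F w).im := by
    rw [← integral_neg]
    exact setIntegral_congr_fun hBm fun w hw => Real.norm_of_nonpos (le_of_lt hw.2)
  rw [hEAB, pointsOver_union, setIntegral_union hAB hBm iA.norm iB.norm,
    setIntegral_union hdis mB hD.norm.integrableOn hD.norm.integrableOn, h1, h2]
  have h3 := norm_integral_le_integral_norm (μ := (areaMeasure Q).restrict (pointsOver S x A))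
    (areaDensity Q (fun p => Real.log ‖x p‖) (fun p => Real.log ‖y p‖))
  have h4 := norm_integral_le_integral_norm (μ := (areaMeasure Q).restrict (pointsOver S x B))
    (areaDensity Q (fun p => Real.log ‖x p‖) (fun p => Real.log ‖y p‖))
  rw [eA] at h3
  rw [eB] at h4
  have h5 := neg_le_of_abs_le h3
  have h6 := le_of_abs_le h4
  linarith

/-- The logarithmic area over the upper half plane, as an integral over the strip. -/
theorem setIntegral_upperHalf :
    IntegrableOn (fun w => (deriv F w).im) strip ∧
    ∫ p in S ∩ {p | 0 < (x p).im},
      areaDensity Q (fun p => Real.log ‖x p‖) (fun p => Real.log ‖y p‖) p ∂areaMeasure Q =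
      -∫ w in strip, (deriv F w).im := by
  have hD := h.integrable Q
  set U := strip \ criticalValues S x with hU
  have hex : ∀ w : ℂ, ∃ V : Set ℂ, w ∈ U → IsOpen V ∧ w ∈ V ∧ V ⊆ U ∧
      ∃ (T : Finset X) (κ : X → ℂ → X), IsSheets S x V T κ := by
    intro w
    by_cases hw : w ∈ U
    · obtain ⟨V, hV⟩ := h.exists_sheets hw
      exact ⟨V, fun _ => hV⟩
    · exact ⟨∅, fun h => (hw h).elim⟩
  choose V hVprop using hex
  have hne : U.Nonempty := by
    have hmem : (Real.pi / 2 * Complex.I : ℂ) ∈ strip := by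
      constructor <;> simp <;> linarith [Real.pi_pos]
    exact ((infinite_of_mem_nhds _ (isOpen_strip.mem_nhds hmem)).sdiff
      h.finite_criticalValues).nonempty
  obtain ⟨t, htU, htc, hcov⟩ := TopologicalSpace.countable_cover_nhdsWithin (f := V) (s := U)
    fun w hw => mem_nhdsWithin_of_mem_nhds ((hVprop w hw).1.mem_nhds (hVprop w hw).2.1)
  have htne : t.Nonempty := by
    obtain ⟨w, hw⟩ := hne
    obtain ⟨v, hv, -⟩ := mem_iUnion₂.1 (hcov hw)
    exact ⟨v, hv⟩
  obtain ⟨f, rfl⟩ := htc.exists_eq_range htne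
  have hfU : ∀ n, f n ∈ U := fun n => htU (mem_range_self n)
  -- Sheets exist only locally; a countable cover of the strip minus the critical values, made
  -- disjoint, allows summation.
  set E : ℕ → Set ℂ := disjointed fun n => V (f n) with hE
  have hEV : ∀ n, E n ⊆ V (f n) := fun n => disjointed_subset _ n
  have hEm : ∀ n, MeasurableSet (E n) := fun n =>
    MeasurableSet.disjointed (fun k => (hVprop _ (hfU k)).1.measurableSet) n
  have hEd : Pairwise (Disjoint on E) := disjoint_disjointed _
  have hEU : ⋃ n, E n = U := by
    rw [hE, iUnion_disjointed]
    refine Subset.antisymm (iUnion_subset fun n => (hVprop _ (hfU n)).2.2.1) ?_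
    simpa using hcov
  have hEs : ∀ n, E n ⊆ strip := fun n w hw => ((hVprop _ (hfU n)).2.2.1 (hEV n hw)).1
  have hsheet : ∀ n, IntegrableOn (fun w => (deriv F w).im) (E n) ∧
      MeasurableSet (pointsOver S x (E n)) ∧
      ∫ p in pointsOver S x (E n), areaDensity Q (fun p => Real.log ‖x p‖)
        (fun p => Real.log ‖y p‖) p ∂areaMeasure Q = -∫ w in E n, (deriv F w).im := by
    intro n
    obtain ⟨hVo, -, hVU, T, κ, hκ⟩ := hVprop _ (hfU n)
    exact h.setIntegral_sheets Q hF hexp hκ hVo hVU (hEm n) (hEV n)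
  have hnorm : ∀ n, ∫ w in E n, ‖(deriv F w).im‖ ≤ ∫ p in pointsOver S x (E n),
      ‖areaDensity Q (fun p => Real.log ‖x p‖) (fun p => Real.log ‖y p‖) p‖ ∂areaMeasure Q := by
    intro n
    obtain ⟨hVo, -, hVU, T, κ, hκ⟩ := hVprop _ (hfU n)
    exact h.integral_norm_le_of_sheets Q hF hexp hκ hVo hVU (hEm n) (hEV n)
  have hOm : ∀ n, MeasurableSet (pointsOver S x (E n)) := fun n => (hsheet n).2.1
  have hOd : Pairwise (Disjoint on fun n => pointsOver S x (E n)) := fun m n hmn =>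
    disjoint_pointsOver (hEs m) (hEs n) (hEd hmn)
  have hsum1 := hasSum_integral_iUnion hOm hOd hD.norm.integrableOn
  have hintU : IntegrableOn (fun w => (deriv F w).im) U := by
    rw [← hEU]
    refine integrableOn_iUnion_of_summable_integral_norm (fun n => (hsheet n).1) ?_
    exact Summable.of_nonneg_of_le (fun n => integral_nonneg fun _ => norm_nonneg _) hnorm
      hsum1.summable
  have hsum2 := hasSum_integral_iUnion hOm hOd
    (f := areaDensity Q (fun p => Real.log ‖x p‖) (fun p => Real.log ‖y p‖)) hD.integrableOn
  have hsum3 := (hasSum_integral_iUnion hEm hEd (hEU ▸ hintU)).neg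
  simp_rw [fun n => (hsheet n).2.2] at hsum2
  have hval := hsum2.unique hsum3
  rw [hEU, ← pointsOver_iUnion, hEU] at hval
  -- The critical values and the fibres above them are finite, so they count neither in the strip
  -- nor on the surface.
  have hUs : (U : Set ℂ) =ᵐ[volume] strip :=
    sdiff_null_ae_eq_self (h.finite_criticalValues.measure_zero volume)
  have hfin : (⋃ w ∈ criticalValues S x, fiber S x w).Finite :=
    h.finite_criticalValues.biUnion fun w _ => h.finite_fiber w
  have hPs : pointsOver S x strip = pointsOver S x U ∪ ⋃ w ∈ criticalValues S x, fiber S x w := by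
    ext p
    simp only [mem_union, mem_iUnion]
    constructor
    · rintro ⟨hp, w, hw, hpw⟩
      by_cases hc : w ∈ criticalValues S x
      · exact Or.inr ⟨w, hc, hp, hpw⟩
      · exact Or.inl ⟨hp, w, ⟨hw, hc⟩, hpw⟩
    · rintro (⟨hp, w, hw, hpw⟩ | ⟨w, hc, hp, hpw⟩)
      · exact ⟨hp, w, hw.1, hpw⟩
      · exact ⟨hp, w, hc.1, hpw⟩
  have hPU : pointsOver S x strip =ᵐ[areaMeasure Q] pointsOver S x U := by
    rw [hPs]
    exact union_ae_eq_left_of_ae_eq_empty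
      (ae_eq_empty.2 (areaMeasure_finite Q hfin hfin.measurableSet))
  refine ⟨hintU.congr_set_ae hUs.symm, ?_⟩
  rw [← pointsOver_strip, setIntegral_congr_set hPU, hval, setIntegral_congr_set hUs]

end IsRealPair

end QuantumIndex

end

/-! ### Integrality of the area for real functions. -/

noncomputable section

namespace QuantumIndex

open Set Filter Topology MeasureTheory

theorem volume_im_eq_zero : volume {z : ℂ | z.im = 0} = 0 := by
  have h : LinearMap.ker Complex.imLm ≠ ⊤ := by
    intro h
    have : Complex.I ∈ LinearMap.ker Complex.imLm := h ▸ Submodule.mem_top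
    simp at this
  exact Measure.addHaar_submodule volume _ h

variable {X : Type*} [TopologicalSpace X] [ChartedSpace ℂ X] [IsManifold 𝓘(ℂ) 1 X]
  [T2Space X] [MeasurableSpace X] [BorelSpace X] (Q : ChartPartition X)

theorem IsParametrization.areaMeasure_image_eq_zero {κ : ℂ → X} {V T : Set ℂ}
    (hκ : IsParametrization κ V) (hT : MeasurableSet T) (hTV : T ⊆ V) (h0 : volume T = 0) :
    areaMeasure Q (κ '' T) = 0 := by
  rw [← Measure.restrict_eq_zero, areaMeasure_restrict Q (hκ.measurableSet_image hT hTV)]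
  refine Finset.sum_eq_zero fun i _ => ?_
  have himg : Q.chart i '' (Q.piece i ∩ κ '' T) =
      (fun z => Q.chart i (κ z)) '' (T ∩ κ ⁻¹' Q.piece i) := by
    ext w
    constructor
    · rintro ⟨_, ⟨hp, z, hz, rfl⟩, rfl⟩
      exact ⟨z, ⟨hz, hp⟩, rfl⟩
    · rintro ⟨z, ⟨hz, hp⟩, rfl⟩
      exact ⟨κ z, ⟨hp, z, hz, rfl⟩, rfl⟩
  have : volume (Q.chart i '' (Q.piece i ∩ κ '' T)) = 0 := by
    rw [himg]
    refine addHaar_image_eq_zero_of_differentiableOn_of_addHaar_eq_zero volume (fun z hz => ?_)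
      (measure_mono_null inter_subset_left h0)
    have := (mdifferentiableAt_atlas (Q.chart_mem i) (Q.subset i hz.2)).comp z
      (hκ.mdifferentiableAt z (hTV hz.1))
    exact ((mdifferentiableAt_iff_differentiableAt.1 this).restrictScalars ℝ).differentiableWithinAt
  simp [Measure.restrict_eq_zero.2 this]

namespace IsRealPair

variable [CompactSpace X] {σ : X → X} {S : Set X} {x y : X → ℂ} (h : IsRealPair σ S x y)
include h

/-- Away from the finitely many critical points x is a local coordinate, and in it the set is
contained in the real line. By second countability, being locally null suffices. -/
theorem areaMeasure_real_eq_zero : areaMeasure Q (S ∩ {p | (x p).im = 0}) = 0 := by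
  have : SecondCountableTopology X := ChartedSpace.secondCountable_of_sigmaCompact ℂ X
  have hfin : {p | mfderiv 𝓘(ℂ) 𝓘(ℂ) x p = 0}.Finite :=
    finite_of_eventually_nhdsNE fun p => by simpa using h.isolated p
  suffices hK : areaMeasure Q ((S ∩ {p | (x p).im = 0}) \ {p | mfderiv 𝓘(ℂ) 𝓘(ℂ) x p = 0}) = 0 by
    rw [measure_sdiff_null (areaMeasure_finite Q hfin hfin.measurableSet)] at hK
    exact hK
  refine measure_null_of_locally_null _ fun p hp => ?_
  have hd : deriv (chartRep x p) (chartAt ℂ p p) ≠ 0 := fun h0 => hp.2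
    ((mfderiv_eq_zero_iff_chart (chart_mem_atlas ℂ p) (mem_chart_source ℂ p)
        (h.fst_mdifferentiableAt hp.1.1)).2 h0)
  obtain ⟨Ψ, h1, h2, h3, h4, -, -⟩ := exists_coordinate (h.fst_analyticAt hp.1.1) hd
    (chart_source_mem_nhds ℂ p)
  have hκ : IsParametrization Ψ.symm Ψ.target := ⟨Ψ.open_target, h4, Ψ.symm.injOn⟩
  have hT : MeasurableSet (Ψ.target ∩ {z | z.im = 0}) := Ψ.open_target.measurableSet.inter
    (measurableSet_eq_fun Complex.measurable_im measurable_const)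
  refine ⟨Ψ.symm '' (Ψ.target ∩ {z | z.im = 0}), ?_, hκ.areaMeasure_image_eq_zero Q hT
    inter_subset_left (measure_mono_null inter_subset_right volume_im_eq_zero)⟩
  filter_upwards [mem_nhdsWithin_of_mem_nhds (Ψ.open_source.mem_nhds h1),
    self_mem_nhdsWithin] with q hq hqK
  have hxq : Ψ q = x q := by
    rw [h3 q hq, chartRep, (chartAt ℂ p).left_inv (h2 hq)]
  refine ⟨Ψ q, ⟨Ψ.map_source hq, ?_⟩, Ψ.left_inv hq⟩
  rw [hxq]
  exact hqK.1.2

/-- The logarithmic area over the upper half plane in terms of the ends of the strip. -/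
theorem exists_setIntegral_upperHalf {α β α' β' : ℝ} (hbot : HasStripEnd S x y α β)
    (htop : HasStripEnd S (-x⁻¹) y α' β') :
    ∃ n : ℤ, ∫ p in S ∩ {p | 0 < (x p).im},
      areaDensity Q (fun p => Real.log ‖x p‖) (fun p => Real.log ‖y p‖) p ∂areaMeasure Q =
      (α * (Real.pi ^ 2 / 2) + β * Real.pi) - (α' * (Real.pi ^ 2 / 2) + β' * Real.pi) +
        n * Real.pi ^ 2 := by
  obtain ⟨F, hF, hexp⟩ := h.exists_log_fiberProd
  obtain ⟨hint, hval⟩ := h.setIntegral_upperHalf Q hF hexp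
  -- Finitely many critical values leave both ends of the strip free, so exp F is the norm there.
  obtain ⟨s, hs⟩ := (h.finite_criticalValues.image Complex.re).bddBelow
  obtain ⟨t, ht⟩ := (h.finite_criticalValues.image Complex.re).bddAbove
  have hrefl : ∀ w ∈ strip, Real.pi * Complex.I - w ∈ strip := fun w hw => by
    constructor <;> simp <;> linarith [hw.1, hw.2]
  obtain ⟨n, hn⟩ := hbot.exists_tendsto_im hF.continuousOn
    (eventually_stripEnd_iff.2 ⟨s, fun w hw hws => hexp w ⟨hw, fun hc =>
      not_le_of_gt hws (hs ⟨w, hc, rfl⟩)⟩⟩)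
  obtain ⟨n', hn'⟩ := htop.exists_tendsto_im (F := fun w => F (Real.pi * Complex.I - w))
    (hF.continuousOn.comp (by fun_prop) hrefl)
    (eventually_stripEnd_iff.2 ⟨-t, fun w hw hws => by
      rw [fiberProd_neg_inv]
      refine hexp _ ⟨hrefl w hw, fun hc => ?_⟩
      have := ht ⟨_, hc, rfl⟩
      simp at this
      linarith⟩)
  refine ⟨n - n', ?_⟩
  rw [hval, setIntegral_strip_im_deriv hF hint hn hn']
  push_cast
  ring

omit [T2Space X] [MeasurableSpace X] [BorelSpace X] [IsManifold 𝓘(ℂ) 1 X] [CompactSpace X] in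
theorem neg_fst : IsRealPair σ S (-x) y where
  continuous := h.continuous
  involutive := h.involutive
  isHalf := h.isHalf
  fst := h.fst.neg
  snd := h.snd
  isolated p := by
    filter_upwards [h.isolated p] with q hq
    rw [mfderiv_neg]
    exact neg_ne_zero.2 hq

/-- S splits into the parts over the two half planes and a null set. The lower half plane is the
upper one for -x, and log|-x| = log|x|. Only the combined contributions of x and -x at an end are
integral multiples of π²/2. -/
theorem exists_setIntegral_eq : ∃ n : ℤ, ∫ p in S, areaDensity Q (fun p => Real.log ‖x p‖)
    (fun p => Real.log ‖y p‖) p ∂areaMeasure Q = n * (Real.pi ^ 2 / 2) := by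
  have hD := h.integrable Q
  obtain ⟨α, β, α₁, β₁, hb, hb₁, k, hk⟩ :=
    exists_hasStripEnd h.continuous h.involutive h.isHalf h.fst h.snd
  obtain ⟨α', β', α₁', β₁', ht, ht₁, k', hk'⟩ :=
    exists_hasStripEnd h.continuous h.involutive h.isHalf h.fst.inv.neg h.snd
  obtain ⟨n, hn⟩ := h.exists_setIntegral_upperHalf Q hb ht
  have ht₂ : HasStripEnd S (-(-x)⁻¹) y α₁' β₁' := by
    rwa [inv_neg]
  obtain ⟨n₁, hn₁⟩ := h.neg_fst.exists_setIntegral_upperHalf Q hb₁ ht₂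
  simp only [Pi.neg_apply, norm_neg, Complex.neg_im, Left.neg_pos_iff] at hn₁
  have hc : ContinuousOn (fun p => (x p).im) S := fun p hp =>
    (Complex.continuous_im.continuousAt.comp
      (h.fst_mdifferentiableAt hp).continuousAt).continuousWithinAt
  have hpos : IsOpen (S ∩ {p | 0 < (x p).im}) := hc.isOpen_inter_preimage h.isHalf.isOpen isOpen_Ioi
  have hneg : IsOpen (S ∩ {p | (x p).im < 0}) := hc.isOpen_inter_preimage h.isHalf.isOpen isOpen_Iio
  have hS : S = (S ∩ {p | 0 < (x p).im} ∪ S ∩ {p | (x p).im < 0}) ∪ S ∩ {p | (x p).im = 0} := by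
    ext p
    simp only [mem_union, mem_inter_iff, mem_ofPred_eq]
    rw [← and_or_left, ← and_or_left]
    refine (and_iff_left ?_).symm
    rcases lt_trichotomy (x p).im 0 with h1 | h1 | h1
    · exact Or.inl (Or.inr h1)
    · exact Or.inr h1
    · exact Or.inl (Or.inl h1)
  have hae : S =ᵐ[areaMeasure Q] (S ∩ {p | 0 < (x p).im} ∪ S ∩ {p | (x p).im < 0} : Set X) := by
    conv_lhs => rw [hS]
    exact union_ae_eq_left_of_ae_eq_empty (ae_eq_empty.2 (h.areaMeasure_real_eq_zero Q))
  have hdis : Disjoint (S ∩ {p | 0 < (x p).im}) (S ∩ {p | (x p).im < 0}) :=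
    disjoint_left.2 fun p h1 h2 => lt_asymm (show 0 < (x p).im from h1.2) h2.2
  rw [setIntegral_congr_set hae, setIntegral_union hdis hneg.measurableSet hD.integrableOn
    hD.integrableOn, hn, hn₁]
  -- Zeros contribute k and poles -k'; the ambiguities n, n₁ come with π², which is twice the unit
  -- π²/2.
  refine ⟨k - k' + 2 * n + 2 * n₁, ?_⟩
  push_cast
  linarith

end IsRealPair

/-- The logarithmic area of a half of a real curve is an integral multiple of `π² / 2`, if all zeros
and poles of the coordinates are real. -/
theorem exists_setIntegral_eq [CompactSpace X] [ConnectedSpace X] {σ : X → X} {S : Set X}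
    (hσ : Continuous σ) (hi : Function.Involutive σ) (hS : IsHalf σ S) {x y : X → ℂ}
    (hx : IsRealFunction σ x) (hy : IsRealFunction σ y) :
    ∃ n : ℤ, ∫ p in S, areaDensity Q (fun p => Real.log ‖x p‖)
      (fun p => Real.log ‖y p‖) p ∂areaMeasure Q = n * (Real.pi ^ 2 / 2) := by
  rcases hx.normal.mfderiv_dichotomy with h0 | h1
  -- Where dx = 0, the logarithmic derivative of x and with it the density vanish.
  · refine ⟨0, ?_⟩
    have hfin : ({p | ¬ RegularAt x p} ∪ {p | ¬ RegularAt y p} ∪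
        {p | mfderiv 𝓘(ℂ) 𝓘(ℂ) x p ≠ 0}).Finite :=
      (hx.normal.finite_not_regularAt.union hy.normal.finite_not_regularAt).union
        (finite_of_eventually_nhdsNE fun p => by simpa using h0 p)
    have hae : areaDensity Q (fun p => Real.log ‖x p‖) (fun p => Real.log ‖y p‖)
        =ᵐ[(areaMeasure Q).restrict S] 0 := by
      refine ae_restrict_of_ae ?_
      have hnull := areaMeasure_finite Q hfin hfin.measurableSet
      filter_upwards [compl_mem_ae_iff.2 hnull] with p hp
      simp only [mem_compl_iff, mem_union, mem_ofPred_eq, not_or, not_not] at hp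
      obtain ⟨i, hi⟩ := mem_iUnion.1 (Q.covers ▸ mem_univ p)
      have hps := Q.subset i hi
      have hxd := (mdifferentiableAt_iff_chart (Q.chart_mem i) hps).1 hp.1.1.1
      have hyd := (mdifferentiableAt_iff_chart (Q.chart_mem i) hps).1 hp.1.2.1
      have hx0 : x ((Q.chart i).symm (Q.chart i p)) ≠ 0 := by
        rw [(Q.chart i).left_inv hps]
        exact hp.1.1.2
      have hy0 : y ((Q.chart i).symm (Q.chart i p)) ≠ 0 := by
        rw [(Q.chart i).left_inv hps]
        exact hp.1.2.2
      have hd0 := (mfderiv_eq_zero_iff_chart (Q.chart_mem i) hps hp.1.1.1).1 hp.2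
      rw [areaDensity_of_mem Q _ _ hi, wedgeDensity_log_norm hxd hx0 hyd hy0, logDeriv_apply, hd0]
      simp
    rw [integral_congr_ae hae]
    simp
  · exact IsRealPair.exists_setIntegral_eq Q ⟨hσ, hi, hS, hx, hy, h1⟩

end QuantumIndex

end

/-! ### Naturality of the torus and of constant 2-forms. -/

noncomputable section

namespace QuantumIndex

section Torus

variable {N' N : Type*} [AddCommGroup N'] [AddCommGroup N]

theorem monomial_ne_zero (m : Module.Dual ℤ N) (t : Torus N) : monomial m t ≠ 0 :=
  Units.ne_zero _

theorem monomial_tmul (m : Module.Dual ℤ N) (n : N) (z : Additive ℂˣ) :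
    monomial m (n ⊗ₜ[ℤ] z) = (z.toMul : ℂ) ^ m n := by
  simp [monomial]

theorem monomial_zero (m : Module.Dual ℤ N) : monomial m (0 : Torus N) = 1 := by
  simp [monomial]

theorem monomial_add (m : Module.Dual ℤ N) (s t : Torus N) :
    monomial m (s + t) = monomial m s * monomial m t := by
  simp [monomial]

theorem monomial_monomialMap (A : N' →ₗ[ℤ] N) (m : Module.Dual ℤ N) (t : Torus N') :
    monomial m (monomialMap A t) = monomial (m ∘ₗ A) t := by
  rw [monomial, monomial, monomialMap, LinearMap.rTensor_comp_apply]

theorem monomial_torusConj (m : Module.Dual ℤ N) (t : Torus N) :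
    monomial m (torusConj t) = starRingEnd ℂ (monomial m t) := by
  induction t using TensorProduct.induction_on with
  | zero => simp [torusConj, monomial_zero]
  | tmul n z =>
    rw [torusConj, LinearMap.lTensor_tmul, monomial_tmul, monomial_tmul, map_zpow₀]
    rfl
  | add s t hs ht =>
    rw [monomial_add, map_mul, ← hs, ← ht, ← monomial_add]
    simp [torusConj]

theorem torusConj_monomialMap (A : N' →ₗ[ℤ] N) (t : Torus N') :
    torusConj (monomialMap A t) = monomialMap A (torusConj t) := by
  have h := (LinearMap.lTensor_comp_rTensor _ A
    (MonoidHom.toAdditive (Units.map (starRingEnd ℂ : ℂ →* ℂ))).toIntLinearMap).trans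
    (LinearMap.rTensor_comp_lTensor _ A _).symm
  exact LinearMap.congr_fun h t

theorem logMap_monomialMap (A : N' →ₗ[ℤ] N) (t : Torus N') :
    logMap (monomialMap A t) = A.rTensor ℝ (logMap t) := by
  have h := (LinearMap.lTensor_comp_rTensor _ A logAbs.toIntLinearMap).trans
    (LinearMap.rTensor_comp_lTensor _ A _).symm
  exact LinearMap.congr_fun h t

theorem realCoord_rTensor (A : N' →ₗ[ℤ] N) (m : Module.Dual ℤ N) (v : N' ⊗[ℤ] ℝ) :
    realCoord m (A.rTensor ℝ v) = realCoord (m ∘ₗ A) v := by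
  rw [realCoord, realCoord, LinearMap.rTensor_comp_apply]

/-- This links the invariant logarithm to the analysis above: the coordinates of log ∘ f are the
functions log|χ^m ∘ f|. -/
theorem realCoord_logMap (m : Module.Dual ℤ N) (t : Torus N) :
    realCoord m (logMap t) = Real.log ‖monomial m t‖ := by
  induction t using TensorProduct.induction_on with
  | zero => simp [realCoord, logMap, monomial_zero]
  | tmul n z =>
    rw [monomial_tmul, norm_zpow, Real.log_zpow]
    simp [realCoord, logMap, logAbs]
  | add s t hs ht =>
    rw [monomial_add, norm_mul, Real.log_mul (norm_ne_zero_iff.2 (monomial_ne_zero m s))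
      (norm_ne_zero_iff.2 (monomial_ne_zero m t)), ← hs, ← ht]
    simp [realCoord, logMap]

theorem dual_apply_eq_sum {ι : Type*} [Fintype ι] (b : Module.Basis ι ℤ N) (m : N →ₗ[ℤ] ℤ)
    (n : N) : m n = ∑ i, b.coord i n * m (b i) := by
  conv_lhs => rw [← b.sum_repr n, map_sum]
  simp

theorem realCoord_eq_sum {ι : Type*} [Fintype ι] (b : Module.Basis ι ℤ N) (m : Module.Dual ℤ N)
    (v : N ⊗[ℤ] ℝ) : realCoord m v = ∑ i, (m (b i) : ℝ) * realCoord (b.coord i) v := by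
  induction v using TensorProduct.induction_on with
  | zero => simp [realCoord]
  | tmul n r =>
    simp only [realCoord, LinearMap.rTensor_tmul, TensorProduct.lid_tmul, zsmul_eq_mul]
    rw [dual_apply_eq_sum b m n]
    push_cast
    rw [Finset.sum_mul]
    exact Finset.sum_congr rfl fun i _ => by ring
  | add s t hs ht =>
    have h (m : Module.Dual ℤ N) : realCoord m (s + t) = realCoord m s + realCoord m t := by
      simp [realCoord]
    simp only [h, mul_add, Finset.sum_add_distrib, ← hs, ← ht]

end Torus

section TwoForm

variable {N' N : Type*} [AddCommGroup N'] [AddCommGroup N]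

theorem alternatingMap_eq_sum {ι : Type*} [Fintype ι] (b : Module.Basis ι ℤ N)
    (ϖ : N [⋀^Fin 2]→ₗ[ℤ] ℤ) (v w : N) :
    ϖ ![v, w] = ∑ i, ∑ j, b.coord i v * b.coord j w * ϖ ![b i, b j] := by
  have hu0 (u v w : N) : Function.update ![v, w] 0 u = ![u, w] := by
    ext i
    fin_cases i <;> simp
  have hu1 (u v w : N) : Function.update ![v, w] 1 u = ![v, u] := by
    ext i
    fin_cases i <;> simp
  have h1 (v w : N) : ϖ ![v, w] = ∑ i, b.coord i v * ϖ ![b i, w] := by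
    have h := dual_apply_eq_sum b (ϖ.toMultilinearMap.toLinearMap ![v, w] 0) v
    simpa [hu0] using h
  have h2 (v w : N) : ϖ ![v, w] = ∑ j, b.coord j w * ϖ ![v, b j] := by
    have h := dual_apply_eq_sum b (ϖ.toMultilinearMap.toLinearMap ![v, w] 1) w
    simpa [hu1] using h
  rw [h1]
  refine Finset.sum_congr rfl fun i _ => ?_
  rw [h2, Finset.mul_sum]
  exact Finset.sum_congr rfl fun j _ => by ring

theorem alternatingMap_swap (ϖ : N [⋀^Fin 2]→ₗ[ℤ] ℤ) (v w : N) : ϖ ![w, v] = -ϖ ![v, w] := by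
  have h := ϖ.map_swap ![v, w] (show (0 : Fin 2) ≠ 1 by decide)
  rw [← h]
  congr 1
  ext i
  fin_cases i <;> simp

variable [Module.Free ℤ N'] [Module.Finite ℤ N'] [Module.Free ℤ N] [Module.Finite ℤ N]

/-- Average the defining sum with its version in which i and j are exchanged. The factor 1/2
compensates for summing over ordered pairs. -/
theorem pullbackDensity_eq_sum_wedgeDensity (ϖ : N [⋀^Fin 2]→ₗ[ℤ] ℤ) (F : ℂ → N ⊗[ℤ] ℝ) (z : ℂ) :
    pullbackDensity ϖ F z = ∑ i, ∑ j,
      (ϖ ![Module.Free.chooseBasis ℤ N i, Module.Free.chooseBasis ℤ N j] / 2 : ℝ) *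
      wedgeDensity (fun w => realCoord ((Module.Free.chooseBasis ℤ N).coord i) (F w))
        (fun w => realCoord ((Module.Free.chooseBasis ℤ N).coord j) (F w)) z := by
  set b := Module.Free.chooseBasis ℤ N with hb
  have h1 : pullbackDensity ϖ F z = ∑ i, ∑ j, (ϖ ![b i, b j] : ℝ) *
    (fderiv ℝ (fun w => realCoord (b.coord i) (F w)) z 1 *
      fderiv ℝ (fun w => realCoord (b.coord j) (F w)) z Complex.I) := rfl
  have h2 : pullbackDensity ϖ F z = ∑ i, ∑ j, -(ϖ ![b i, b j] : ℝ) *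
    (fderiv ℝ (fun w => realCoord (b.coord i) (F w)) z Complex.I *
      fderiv ℝ (fun w => realCoord (b.coord j) (F w)) z 1) := by
    rw [h1, Finset.sum_comm]
    refine Finset.sum_congr rfl fun i _ => Finset.sum_congr rfl fun j _ => ?_
    rw [alternatingMap_swap ϖ (b i) (b j)]
    push_cast
    ring
  have h3 : pullbackDensity ϖ F z = (pullbackDensity ϖ F z + pullbackDensity ϖ F z) / 2 := by ring
  rw [h3]
  nth_rewrite 1 [h1]
  rw [h2, ← Finset.sum_add_distrib, Finset.sum_div]
  refine Finset.sum_congr rfl fun i _ => ?_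
  rw [← Finset.sum_add_distrib, Finset.sum_div]
  refine Finset.sum_congr rfl fun j _ => ?_
  rw [wedgeDensity]
  ring

/-- The pullback of a constant form by a linear map. -/
theorem pullbackDensity_rTensor (A : N' →ₗ[ℤ] N) (ϖ : N [⋀^Fin 2]→ₗ[ℤ] ℤ) {F : ℂ → N' ⊗[ℤ] ℝ}
    {z : ℂ} (hF : ∀ i, DifferentiableAt ℝ
      (fun w => realCoord ((Module.Free.chooseBasis ℤ N').coord i) (F w)) z) :
    pullbackDensity ϖ (fun w => A.rTensor ℝ (F w)) z =
      pullbackDensity (ϖ.compLinearMap A) F z := by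
  set b := Module.Free.chooseBasis ℤ N with hb
  set b' := Module.Free.chooseBasis ℤ N' with hb'
  have h1 (k) (t : ℂ) : fderiv ℝ (fun w => realCoord (b.coord k) (A.rTensor ℝ (F w))) z t =
      ∑ i, (b.coord k (A (b' i)) : ℝ) * fderiv ℝ (fun w => realCoord (b'.coord i) (F w)) z t := by
    have h : (fun w => realCoord (b.coord k) (A.rTensor ℝ (F w))) = fun w => ∑ i,
        (b.coord k (A (b' i)) : ℝ) * realCoord (b'.coord i) (F w) := by
      ext w
      rw [realCoord_rTensor, realCoord_eq_sum b']
      rfl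
    rw [h, fderiv_fun_sum fun i _ => (hF i).const_mul _, sum_apply]
    refine Finset.sum_congr rfl fun i _ => ?_
    rw [fderiv_const_mul (hF i)]
    rfl
  have h2 (i j) : (ϖ.compLinearMap A) ![b' i, b' j] =
      ∑ k, ∑ l, b.coord k (A (b' i)) * b.coord l (A (b' j)) * ϖ ![b k, b l] := by
    rw [← alternatingMap_eq_sum b, AlternatingMap.compLinearMap_apply]
    congr 1
    ext i
    fin_cases i <;> rfl
  have h3 : pullbackDensity (ϖ.compLinearMap A) F z =
      ∑ i, ∑ j, ((ϖ.compLinearMap A) ![b' i, b' j] : ℝ) *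
    (fderiv ℝ (fun w => realCoord (b'.coord i) (F w)) z 1 *
      fderiv ℝ (fun w => realCoord (b'.coord j) (F w)) z Complex.I) := rfl
  have h4 : pullbackDensity ϖ (fun w => A.rTensor ℝ (F w)) z = ∑ k, ∑ l, (ϖ ![b k, b l] : ℝ) *
    (fderiv ℝ (fun w => realCoord (b.coord k) (A.rTensor ℝ (F w))) z 1 *
      fderiv ℝ (fun w => realCoord (b.coord l) (A.rTensor ℝ (F w))) z Complex.I) := rfl
  rw [h3, h4]
  simp_rw [h1, h2]
  push_cast
  simp_rw [Finset.sum_mul_sum, Finset.mul_sum, Finset.sum_mul]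
  rw [Finset.sum_congr rfl fun k _ => Finset.sum_comm, Finset.sum_comm]
  refine Finset.sum_congr rfl fun i _ => ?_
  rw [Finset.sum_congr rfl fun k _ => Finset.sum_comm, Finset.sum_comm]
  refine Finset.sum_congr rfl fun j _ => Finset.sum_congr rfl fun k _ =>
    Finset.sum_congr rfl fun l _ => ?_
  ring

end TwoForm

end QuantumIndex

end

/-! ### Areas and quantum indices of real curves. -/

noncomputable section

namespace QuantumIndex

open Set Filter Topology MeasureTheory

variable {X : Type*} [TopologicalSpace X] [ChartedSpace ℂ X]
  {N' N : Type*} [AddCommGroup N'] [AddCommGroup N]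

section Composition

variable (A : N' →ₗ[ℤ] N) {f : X → Torus N'}

theorem localMonomial_monomialMap (m : Module.Dual ℤ N) (p : X) :
    localMonomial (monomialMap A ∘ f) m p = localMonomial f (m ∘ₗ A) p :=
  funext fun _ => monomial_monomialMap A m _

theorem IsOrientedRealCurve.monomialMap_comp {σ : X → X} {S : Set X}
    (hf : IsOrientedRealCurve σ S f) : IsOrientedRealCurve σ S (monomialMap A ∘ f) where
  isRealStructure := hf.isRealStructure
  isHalf := hf.isHalf
  meromorphic m p := by
    rw [localMonomial_monomialMap]
    exact hf.meromorphic _ p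
  exists_punctures := by
    obtain ⟨P, hP, hσ, hd, hc⟩ := hf.exists_punctures
    refine ⟨P, hP, hσ, fun m p hp => ?_, fun p hp => ?_⟩
    · simp only [Function.comp_apply, monomial_monomialMap]
      exact hd _ p hp
    · rw [Function.comp_apply, Function.comp_apply, hc p hp, torusConj_monomialMap]

theorem IsCocharacterAt.monomialMap_comp {p : X} {n : N'} (h : IsCocharacterAt f p n) :
    IsCocharacterAt (monomialMap A ∘ f) p (A n) := fun m => by
  rw [localMonomial_monomialMap, h]
  rfl

theorem HasDegree.monomialMap_comp {ι : Type*} {Δ : ι → N'} (h : HasDegree f Δ) :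
    HasDegree (monomialMap A ∘ f) (A ∘ Δ) := by
  obtain ⟨p, h1, h2⟩ := h
  refine ⟨p, fun k => (h1 k).monomialMap_comp A, fun x hx => ?_⟩
  simpa using (h2 x hx).monomialMap_comp A

end Composition

/-- All monomials along `f` are meromorphic, of finite order at every point. -/
structure IsRationalMap (f : X → Torus N) : Prop where
  meromorphic : ∀ m p, MeromorphicAt (chartRep (fun q => monomial m (f q)) p) (chartAt ℂ p p)
  ord_ne_top : ∀ m p, ordAt (fun q => monomial m (f q)) p ≠ ⊤

theorem HasDegree.isRationalMap {ι : Type*} {Δ : ι → N} {f : X → Torus N} {σ : X → X} {S : Set X}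
    (hΔ : HasDegree f Δ) (hf : IsOrientedRealCurve σ S f) : IsRationalMap f where
  meromorphic := hf.meromorphic
  ord_ne_top m p := by
    obtain ⟨P, h1, h2⟩ := hΔ
    have h : ∃ n, IsCocharacterAt f p n := by
      by_cases hp : p ∈ range P
      · obtain ⟨k, rfl⟩ := hp
        exact ⟨_, h1 k⟩
      · exact ⟨0, h2 p hp⟩
    obtain ⟨n, hn⟩ := h
    have := hn m
    change ordAt (fun q => monomial m (f q)) p = _ at this
    rw [this]
    exact WithTop.coe_ne_top

theorem areaDensity_swap (Q : ChartPartition X) (u v : X → ℝ) (p : X) :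
    areaDensity Q v u p = -areaDensity Q u v p := by
  obtain ⟨i, hi⟩ := mem_iUnion.1 (Q.covers ▸ mem_univ p)
  rw [areaDensity_of_mem Q _ _ hi, areaDensity_of_mem Q _ _ hi, wedgeDensity, wedgeDensity]
  ring

section Integration

variable [MeasurableSpace X] [BorelSpace X] [T2Space X]

theorem areaDensity_ae_eq (Q : ChartPartition X) {u v u' v' : X → ℝ} {F : Set X} (hF : F.Finite)
    (hu : ∀ p ∉ F, u p = u' p) (hv : ∀ p ∉ F, v p = v' p) :
    areaDensity Q u v =ᵐ[areaMeasure Q] areaDensity Q u' v' := by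
  filter_upwards [compl_mem_ae_iff.2 (areaMeasure_finite Q hF hF.measurableSet)] with p hp
  obtain ⟨i, hi⟩ := mem_iUnion.1 (Q.covers ▸ mem_univ p)
  have hs := Q.subset i hi
  have hev : ∀ᶠ z in 𝓝 (Q.chart i p), (Q.chart i).symm z ∉ F := by
    have hc := (Q.chart i).continuousAt_symm ((Q.chart i).map_source hs)
    refine hc.eventually_mem (s := Fᶜ) ?_
    rw [(Q.chart i).left_inv hs]
    exact hF.isClosed.isOpen_compl.mem_nhds hp
  rw [areaDensity_of_mem Q _ _ hi, areaDensity_of_mem Q _ _ hi]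
  refine wedgeDensity_congr ?_ ?_
  · filter_upwards [hev] with z hz using hu _ hz
  · filter_upwards [hev] with z hz using hv _ hz

variable [IsManifold 𝓘(ℂ) 1 X]

/-- The integral of `du ∧ dv` does not depend on the decomposition. -/
theorem sum_setIntegral_wedgeDensity (Q P : ChartPartition X) {u v : X → ℝ} {F : Set X}
    (hF : F.Finite) (hu : ∀ q ∉ F, RealDifferentiableAt u q) (hv : ∀ q ∉ F, RealDifferentiableAt v q)
    (hD : Integrable (areaDensity Q u v) (areaMeasure Q)) {S : Set X} (hS : MeasurableSet S) :
    (∀ i, IntegrableOn (wedgeDensity (fun z => u ((P.chart i).symm z))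
      (fun z => v ((P.chart i).symm z))) (P.chart i '' (P.piece i ∩ S))) ∧
    ∑ i, ∫ z in P.chart i '' (P.piece i ∩ S), wedgeDensity (fun z => u ((P.chart i).symm z))
      (fun z => v ((P.chart i).symm z)) z = ∫ p in S, areaDensity Q u v p ∂areaMeasure Q := by
  have hm : ∀ i, MeasurableSet (P.piece i ∩ S) := fun i => (P.measurableSet_piece i).inter hS
  have hsub : ∀ i, P.piece i ∩ S ⊆ (P.chart i).source := fun i =>
    inter_subset_left.trans (P.subset i)
  have hT : ∀ i, MeasurableSet (P.chart i '' (P.piece i ∩ S)) := fun i =>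
    measurableSet_chart_image _ (hm i) (hsub i)
  have hTV : ∀ i, P.chart i '' (P.piece i ∩ S) ⊆ (P.chart i).target := by
    rintro i _ ⟨p, hp, rfl⟩
    exact (P.chart i).map_source (hsub i hp)
  have himg : ∀ i, (P.chart i).symm '' (P.chart i '' (P.piece i ∩ S)) = P.piece i ∩ S := fun i =>
    (P.chart i).toPartialEquiv.symm_image_image_of_subset_source (hsub i)
  have hU : S = ⋃ i, P.piece i ∩ S := by
    rw [← iUnion_inter, P.covers, univ_inter]
  -- The inverse charts of `P` are treated as parametrizations and measured with the fixed partition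
  -- `Q`.
  refine ⟨fun i => ((isParametrization_chart_symm (P.chart_mem i)).integrableOn_iff Q hF hu hv (hT i)
    (hTV i)).1 hD.integrableOn, ?_⟩
  conv_rhs => rw [hU]
  rw [integral_iUnion_fintype hm (fun i j hij => (P.disjoint hij).mono inter_subset_left
    inter_subset_left) fun i => hD.integrableOn]
  refine Finset.sum_congr rfl fun i _ => ?_
  rw [← (isParametrization_chart_symm (P.chart_mem i)).setIntegral Q hF hu hv (hT i) (hTV i)
    hD.integrableOn, himg]

variable [CompactSpace X]

namespace IsRationalMap

variable {f : X → Torus N} (hf : IsRationalMap f)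
include hf

omit [T2Space X] [MeasurableSpace X] [BorelSpace X] in
theorem finite_not_regularAt (m : Module.Dual ℤ N) :
    {p | ¬ RegularAt (fun q => monomial m (f q)) p}.Finite :=
  finite_of_eventually_nhdsNE fun p => by
    simpa using eventually_regularAt_of_chartRep (hf.meromorphic m p) (hf.ord_ne_top m p)

theorem integrable_areaDensity (Q : ChartPartition X) (m m' : Module.Dual ℤ N) :
    Integrable (areaDensity Q (fun p => Real.log ‖monomial m (f p)‖)
      (fun p => Real.log ‖monomial m' (f p)‖)) (areaMeasure Q) :=
  QuantumIndex.integrable_areaDensity Q (hf.meromorphic m) (hf.ord_ne_top m) (hf.meromorphic m')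
    (hf.ord_ne_top m')

variable [Module.Free ℤ N] [Module.Finite ℤ N]

/-- The logarithmic area converges absolutely. -/
theorem hasLogArea (Q : ChartPartition X) {S : Set X} (hS : MeasurableSet S)
    (ϖ : N [⋀^Fin 2]→ₗ[ℤ] ℤ) :
    HasLogArea S f ϖ (∑ i, ∑ j,
      (ϖ ![Module.Free.chooseBasis ℤ N i, Module.Free.chooseBasis ℤ N j] / 2 : ℝ) *
      ∫ p in S, areaDensity Q
        (fun p => Real.log ‖monomial ((Module.Free.chooseBasis ℤ N).coord i) (f p)‖)
        (fun p => Real.log ‖monomial ((Module.Free.chooseBasis ℤ N).coord j) (f p)‖) p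
        ∂areaMeasure Q) := by
  intro P
  set b := Module.Free.chooseBasis ℤ N with hb
  have hdens : ∀ k, pullbackDensity ϖ (fun z => logMap (f ((P.chart k).symm z))) = fun z =>
      ∑ i, ∑ j, (ϖ ![b i, b j] / 2 : ℝ) * wedgeDensity
        (fun z => Real.log ‖monomial (b.coord i) (f ((P.chart k).symm z))‖)
        (fun z => Real.log ‖monomial (b.coord j) (f ((P.chart k).symm z))‖) z := by
    intro k
    ext z
    rw [pullbackDensity_eq_sum_wedgeDensity]
    simp only [realCoord_logMap, hb]
  have key := fun i j => sum_setIntegral_wedgeDensity Q P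
    ((hf.finite_not_regularAt (b.coord i)).union (hf.finite_not_regularAt (b.coord j)))
    (fun q hq => RegularAt.realDifferentiableAt (not_not.1 fun hn => hq (Or.inl hn)))
    (fun q hq => RegularAt.realDifferentiableAt (not_not.1 fun hn => hq (Or.inr hn)))
    (hf.integrable_areaDensity Q (b.coord i) (b.coord j)) hS
  have hint : ∀ k i j, IntegrableOn (fun z => (ϖ ![b i, b j] / 2 : ℝ) * wedgeDensity
        (fun z => Real.log ‖monomial (b.coord i) (f ((P.chart k).symm z))‖)
        (fun z => Real.log ‖monomial (b.coord j) (f ((P.chart k).symm z))‖) z)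
      (P.chart k '' (P.piece k ∩ S)) := fun k i j => ((key i j).1 k).const_mul _
  constructor
  · intro k
    rw [hdens]
    exact integrable_finsetSum _ fun i _ => integrable_finsetSum _ fun j _ => hint k i j
  · have hk : ∀ k, ∫ z in P.chart k '' (P.piece k ∩ S),
        pullbackDensity ϖ (fun z => logMap (f ((P.chart k).symm z))) z =
        ∑ i, ∑ j, (ϖ ![b i, b j] / 2 : ℝ) * ∫ z in P.chart k '' (P.piece k ∩ S), wedgeDensity
        (fun z => Real.log ‖monomial (b.coord i) (f ((P.chart k).symm z))‖)
        (fun z => Real.log ‖monomial (b.coord j) (f ((P.chart k).symm z))‖) z := by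
      intro k
      rw [hdens, integral_finsetSum _ fun i _ => integrable_finsetSum _ fun j _ => hint k i j]
      refine Finset.sum_congr rfl fun i _ => ?_
      rw [integral_finsetSum _ fun j _ => hint k i j]
      exact Finset.sum_congr rfl fun j _ => integral_const_mul _ _
    simp_rw [hk]
    rw [Finset.sum_comm]
    refine Finset.sum_congr rfl fun i _ => ?_
    rw [Finset.sum_comm]
    refine Finset.sum_congr rfl fun j _ => ?_
    rw [← Finset.mul_sum, (key i j).2]

end IsRationalMap

-- The linear chain rule needs differentiable coordinates, which holds off a finite set. Thus the
-- two densities agree almost everywhere, and the same value serves for both areas.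
omit [T2Space X] in
theorem IsRationalMap.hasLogArea_monomialMap_comp [Module.Free ℤ N] [Module.Finite ℤ N]
    [Module.Free ℤ N'] [Module.Finite ℤ N'] {f : X → Torus N'} (hf : IsRationalMap f)
    (A : N' →ₗ[ℤ] N) {S : Set X} (hS : MeasurableSet S) {ϖ : N [⋀^Fin 2]→ₗ[ℤ] ℤ} {a : ℝ}
    (h : HasLogArea S f (ϖ.compLinearMap A) a) : HasLogArea S (monomialMap A ∘ f) ϖ a := by
  intro P
  set b := Module.Free.chooseBasis ℤ N' with hb
  set F : Set X := ⋃ i, {p | ¬ RegularAt (fun q => monomial (b.coord i) (f q)) p} with hF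
  have hFf : F.Finite := finite_iUnion fun i => hf.finite_not_regularAt (b.coord i)
  have hae : ∀ k, pullbackDensity ϖ (fun z => logMap ((monomialMap A ∘ f) ((P.chart k).symm z)))
      =ᵐ[volume.restrict (P.chart k '' (P.piece k ∩ S))]
      pullbackDensity (ϖ.compLinearMap A) (fun z => logMap (f ((P.chart k).symm z))) := by
    intro k
    have hm : MeasurableSet (P.chart k '' (P.piece k ∩ S)) := measurableSet_chart_image _
      ((P.measurableSet_piece k).inter hS) (inter_subset_left.trans (P.subset k))
    have hnull : volume (P.chart k '' F) = 0 := (hFf.image _).measure_zero volume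
    filter_upwards [ae_restrict_mem hm, ae_restrict_of_ae (compl_mem_ae_iff.2 hnull)] with z hz hzF
    obtain ⟨p, ⟨hp, -⟩, rfl⟩ := hz
    have hpF : p ∉ F := fun hpF => hzF ⟨p, hpF, rfl⟩
    simp only [Function.comp_apply, logMap_monomialMap]
    refine pullbackDensity_rTensor A ϖ fun i => ?_
    simp only [realCoord_logMap]
    have hreg : RegularAt (fun q => monomial (b.coord i) (f q)) p :=
      not_not.1 fun hn => hpF (mem_iUnion.2 ⟨i, hn⟩)
    exact hreg.realDifferentiableAt _ (P.chart_mem k) (P.subset k hp)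
  refine ⟨fun k => ((h P).1 k).congr (hae k).symm, ?_⟩
  rw [← (h P).2]
  exact Finset.sum_congr rfl fun k _ => integral_congr_ae (hae k)

end Integration

section Real

variable [T2Space X] [CompactSpace X] [IsManifold 𝓘(ℂ) 1 X]
  {σ : X → X} {S : Set X} {f : X → Torus N}

omit [T2Space X] in
theorem IsRationalMap.finite_normalize_ne (hr : IsRationalMap f) (m : Module.Dual ℤ N) :
    {p | normalize (fun q => monomial m (f q)) p ≠ monomial m (f p)}.Finite := by
  refine (hr.finite_not_regularAt m).subset fun p hp hreg => hp ?_
  exact normalize_eq_of_regularAt hreg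
    (eventually_regularAt_of_chartRep (hr.meromorphic m p) (hr.ord_ne_top m p))

/-- A monomial along f takes no value 0, even at a zero or pole, so it must be normalized first. At
a non-real point the cocharacter is 0, hence every monomial has order 0 there. -/
theorem IsOrientedRealCurve.isRealFunction (hf : IsOrientedRealCurve σ S f) (hr : IsRationalMap f)
    (hreal : HasOnlyRealIntersections σ f) (m : Module.Dual ℤ N) :
    IsRealFunction σ (normalize fun q => monomial m (f q)) where
  normal := isNormalMeromorphic_normalize (hr.meromorphic m) (hr.ord_ne_top m)
  conj p := by
    obtain ⟨P, hP, -, -, hc⟩ := hf.exists_punctures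
    have hfin := hr.finite_normalize_ne m
    have hfin' := hfin.preimage (f := σ) hf.isRealStructure.involutive.injective.injOn
    filter_upwards [eventually_nhdsNE_of_finite hP p, eventually_nhdsNE_of_finite hfin p,
      eventually_nhdsNE_of_finite hfin' p] with q h1 h2 h3
    have h2' : normalize (fun q => monomial m (f q)) q = monomial m (f q) := not_not.1 h2
    have h3' : normalize (fun q => monomial m (f q)) (σ q) = monomial m (f (σ q)) := not_not.1 h3
    rw [h2', h3', hc q h1, monomial_torusConj]
  ne_zero p hp := by
    have h0 : IsCocharacterAt f p 0 := not_not.1 fun hn => hp (hreal p hn)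
    have hnorm := isNormalMeromorphic_normalize (hr.meromorphic m) (hr.ord_ne_top m)
    refine hnorm.ordAt_eq_zero_iff.1 ?_
    rw [ordAt_normalize (hr.meromorphic m p) (hr.ord_ne_top m p)]
    have := h0 m
    rw [map_zero] at this
    exact this

variable [ConnectedSpace X] [MeasurableSpace X] [BorelSpace X]

theorem IsOrientedRealCurve.exists_setIntegral_eq (hf : IsOrientedRealCurve σ S f)
    (hr : IsRationalMap f) (hreal : HasOnlyRealIntersections σ f) (Q : ChartPartition X)
    (m m' : Module.Dual ℤ N) :
    ∃ n : ℤ, ∫ p in S, areaDensity Q (fun p => Real.log ‖monomial m (f p)‖)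
      (fun p => Real.log ‖monomial m' (f p)‖) p ∂areaMeasure Q = n * (Real.pi ^ 2 / 2) := by
  obtain ⟨n, hn⟩ := QuantumIndex.exists_setIntegral_eq Q hf.isRealStructure.continuous
    hf.isRealStructure.involutive hf.isHalf (hf.isRealFunction hr hreal m)
    (hf.isRealFunction hr hreal m')
  refine ⟨n, ?_⟩
  rw [← hn]
  refine integral_congr_ae (ae_restrict_of_ae (areaDensity_ae_eq Q
    ((hr.finite_normalize_ne m).union (hr.finite_normalize_ne m')) (fun p hp => ?_) fun p hp => ?_))
  · have : normalize (fun q => monomial m (f q)) p = monomial m (f p) :=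
      not_not.1 fun hn => hp (Or.inl hn)
    rw [this]
  · have : normalize (fun q => monomial m' (f q)) p = monomial m' (f p) :=
      not_not.1 fun hn => hp (Or.inr hn)
    rw [this]

end Real

theorem sum_eq_two_mul_sum_lt {ι : Type*} [Fintype ι] [LinearOrder ι] {s : ι → ι → ℝ}
    (hs : ∀ i j, s j i = s i j) (h0 : ∀ i, s i i = 0) :
    ∑ i, ∑ j, s i j = 2 * ∑ i, ∑ j, if i < j then s i j else 0 := by
  have h : ∀ i j, s i j = (if i < j then s i j else 0) + if j < i then s j i else 0 := by
    intro i j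
    rcases lt_trichotomy i j with h | rfl | h
    · simp [h, h.not_gt]
    · simp [h0]
    · simp [h, h.not_gt, hs]
  have h2 : ∑ i, ∑ j, (if j < i then s j i else 0) = ∑ i, ∑ j, if i < j then s i j else 0 :=
    Finset.sum_comm
  calc ∑ i, ∑ j, s i j
      = ∑ i, ∑ j, ((if i < j then s i j else 0) + if j < i then s j i else 0) :=
        Finset.sum_congr rfl fun i _ => Finset.sum_congr rfl fun j _ => h i j
    _ = _ := by
        simp_rw [Finset.sum_add_distrib]
        rw [h2]
        ring

section QuantumIndex

variable [Module.Free ℤ N] [Module.Finite ℤ N] {S : Set X}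

theorem HasLogArea.logArea {f : X → Torus N} {ϖ : N [⋀^Fin 2]→ₗ[ℤ] ℤ} {a : ℝ}
    (h : HasLogArea S f ϖ a) : HasLogArea S f ϖ (logArea S f ϖ) :=
  Classical.epsilon_spec ⟨a, h⟩

theorem HasLogArea.logArea_eq [CompactSpace X] {f : X → Torus N} {ϖ : N [⋀^Fin 2]→ₗ[ℤ] ℤ} {a : ℝ}
    (h : HasLogArea S f ϖ a) : QuantumIndex.logArea S f ϖ = a :=
  h.logArea.unique h

/-- Functionals on Λ²N are the same as 2-forms on N, and they separate points because Λ²N is free.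
-/
theorem IsQuantumIndex.unique {f : X → Torus N} {h h' : ⋀[ℤ]^2 N} (hh : IsQuantumIndex S f h)
    (hh' : IsQuantumIndex S f h') : h = h' := by
  rw [← sub_eq_zero, ← Module.forall_dual_apply_eq_zero_iff ℤ]
  intro φ
  have h1 := (hh (exteriorPower.alternatingMapLinearEquiv.symm φ)).symm.trans
    (hh' (exteriorPower.alternatingMapLinearEquiv.symm φ))
  rw [LinearEquiv.apply_symm_apply] at h1
  have h2 := mul_left_cancel₀ (by positivity) h1
  rw [map_sub, sub_eq_zero]
  exact_mod_cast h2

theorem IsQuantumIndex.existsUnique {f : X → Torus N} {h : ⋀[ℤ]^2 N} (hh : IsQuantumIndex S f h) :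
    ∃! h, IsQuantumIndex S f h :=
  ⟨h, hh, fun _ hh' => hh'.unique hh⟩

theorem IsQuantumIndex.quantumIndex_eq {f : X → Torus N} {h : ⋀[ℤ]^2 N}
    (hh : IsQuantumIndex S f h) : quantumIndex S f = h :=
  IsQuantumIndex.unique (Classical.epsilon_spec ⟨h, hh⟩) hh

omit [Module.Free ℤ N] [Module.Finite ℤ N] in
theorem alternatingMapLinearEquiv_map (A : N' →ₗ[ℤ] N) (ϖ : N [⋀^Fin 2]→ₗ[ℤ] ℤ) (h : ⋀[ℤ]^2 N') :
    exteriorPower.alternatingMapLinearEquiv ϖ (exteriorPower.map 2 A h) =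
      exteriorPower.alternatingMapLinearEquiv (ϖ.compLinearMap A) h := by
  have : (exteriorPower.alternatingMapLinearEquiv ϖ).comp (exteriorPower.map 2 A) =
      exteriorPower.alternatingMapLinearEquiv (ϖ.compLinearMap A) := by
    refine exteriorPower.linearMap_ext ?_
    ext v
    simp only [LinearMap.compAlternatingMap_apply, LinearMap.comp_apply,
      exteriorPower.map_apply_ιMulti, exteriorPower.alternatingMapLinearEquiv_apply_ιMulti,
      AlternatingMap.compLinearMap_apply]
    rfl
  exact LinearMap.congr_fun this h

variable [T2Space X] [CompactSpace X] [ConnectedSpace X] [IsManifold 𝓘(ℂ) 1 X]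

/-- The integers k i j from the areas of the coordinate pairs are antisymmetric, and h is the sum of
k i j · b i ∧ b j over i < j. -/
theorem IsOrientedRealCurve.exists_isQuantumIndex {σ : X → X} {f : X → Torus N}
    (hf : IsOrientedRealCurve σ S f) (hr : IsRationalMap f)
    (hreal : HasOnlyRealIntersections σ f) : ∃ h, IsQuantumIndex S f h := by
  classical
  let _ : MeasurableSpace X := borel X
  have : BorelSpace X := ⟨rfl⟩
  obtain ⟨Q⟩ := nonempty_chartPartition (X := X)
  set b := Module.Free.chooseBasis ℤ N with hb
  choose k hk using fun i j => hf.exists_setIntegral_eq hr hreal Q (b.coord i) (b.coord j)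
  have hswap : ∀ i j, (k j i : ℝ) = -k i j := by
    intro i j
    have h1 := hk j i
    simp_rw [fun p => areaDensity_swap Q
      (fun p => Real.log ‖monomial (b.coord i) (f p)‖)
      (fun p => Real.log ‖monomial (b.coord j) (f p)‖) p] at h1
    rw [integral_neg, hk i j, ← neg_mul] at h1
    exact (mul_right_cancel₀ (by positivity) h1).symm
  -- Any linear order will do; it only picks one of each pair (i, j), (j, i).
  let _ : LinearOrder (Module.Free.ChooseBasisIndex ℤ N) := linearOrderOfSTO WellOrderingRel
  refine ⟨∑ i, ∑ j, if i < j then k i j • exteriorPower.ιMulti ℤ 2 ![b i, b j] else 0, fun ϖ => ?_⟩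
  rw [(hr.hasLogArea Q hf.isHalf.isOpen.measurableSet ϖ).logArea_eq]
  have h1 := sum_eq_two_mul_sum_lt (s := fun i j => (ϖ ![b i, b j] : ℝ) * k i j)
    (fun i j => by
      rw [hswap i j, alternatingMap_swap ϖ (b i) (b j)]
      push_cast
      ring)
    (fun i => by
      have : ϖ ![b i, b i] = 0 := ϖ.map_eq_zero_of_eq _ (i := 0) (j := 1) rfl (by decide)
      simp [this])
  have h2 : (exteriorPower.alternatingMapLinearEquiv ϖ (∑ i, ∑ j,
      if i < j then k i j • exteriorPower.ιMulti ℤ 2 ![b i, b j] else 0) : ℤ) =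
      ∑ i, ∑ j, if i < j then ϖ ![b i, b j] * k i j else 0 := by
    simp only [map_sum]
    refine Finset.sum_congr rfl fun i _ => Finset.sum_congr rfl fun j _ => ?_
    split_ifs
    · rw [map_zsmul, exteriorPower.alternatingMapLinearEquiv_apply_ιMulti, zsmul_eq_mul, mul_comm]
      rfl
    · exact map_zero _
  rw [h2]
  push_cast
  rw [← mul_right_inj' (two_ne_zero (α := ℝ)), mul_left_comm, ← h1, Finset.mul_sum, Finset.mul_sum]
  refine Finset.sum_congr rfl fun i _ => ?_
  rw [Finset.mul_sum, Finset.mul_sum]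
  refine Finset.sum_congr rfl fun j _ => ?_
  rw [hk i j]
  ring

end QuantumIndex

end QuantumIndex

end

/-! ### The proposition. -/

open QuantumIndex in
theorem mainTheorem7
    {N' N : Type*} [AddCommGroup N'] [Module.Free ℤ N'] [Module.Finite ℤ N']
    [AddCommGroup N] [Module.Free ℤ N] [Module.Finite ℤ N]
    (A : N' →ₗ[ℤ] N)
    {X : Type*} [TopologicalSpace X] [T2Space X] [CompactSpace X] [ConnectedSpace X]
    [ChartedSpace ℂ X] [IsManifold 𝓘(ℂ) ω X]
    (σ : X → X) (S : Set X) (f : X → Torus N') (hf : IsOrientedRealCurve σ S f)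
    {ι : Type*} [Finite ι] (Δ' : ι → N') (hΔ : HasDegree f Δ') :
    IsOrientedRealCurve σ S (monomialMap A ∘ f) ∧
    HasDegree (monomialMap A ∘ f) (A ∘ Δ') ∧
    (HasOnlyRealIntersections σ f →
      (∃! h, IsQuantumIndex S f h) ∧
      (∃! h, IsQuantumIndex S (monomialMap A ∘ f) h) ∧
      quantumIndex S (monomialMap A ∘ f) = exteriorPower.map 2 A (quantumIndex S f)) ∧
    (∀ ϖ : N [⋀^Fin 2]→ₗ[ℤ] ℤ,
      HasLogArea S (monomialMap A ∘ f) ϖ (logArea S (monomialMap A ∘ f) ϖ) ∧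
      HasLogArea S f (ϖ.compLinearMap A) (logArea S f (ϖ.compLinearMap A)) ∧
      logArea S (monomialMap A ∘ f) ϖ = logArea S f (ϖ.compLinearMap A)) := by
  have : IsManifold 𝓘(ℂ) 1 X := IsManifold.of_le (n := ω) le_top
  have hr := hΔ.isRationalMap hf
  have harea : ∀ ϖ : N [⋀^Fin 2]→ₗ[ℤ] ℤ,
      HasLogArea S f (ϖ.compLinearMap A) (logArea S f (ϖ.compLinearMap A)) ∧
      HasLogArea S (monomialMap A ∘ f) ϖ (logArea S f (ϖ.compLinearMap A)) := by
    intro ϖ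
    let _ : MeasurableSpace X := borel X
    have : BorelSpace X := ⟨rfl⟩
    obtain ⟨Q⟩ := nonempty_chartPartition (X := X)
    have hS := hf.isHalf.isOpen.measurableSet
    have h1 := (hr.hasLogArea Q hS (ϖ.compLinearMap A)).logArea
    exact ⟨h1, hr.hasLogArea_monomialMap_comp A hS h1⟩
  refine ⟨hf.monomialMap_comp A, hΔ.monomialMap_comp A, fun hreal => ?_, fun ϖ =>
    ⟨(harea ϖ).2.logArea, (harea ϖ).1, (harea ϖ).2.logArea_eq⟩⟩
  obtain ⟨h, hh⟩ := hf.exists_isQuantumIndex hr hreal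
  -- The area identity and the adjunction ⟨Λ²A h, ϖ⟩ = ⟨h, A^*ϖ⟩ exhibit the index of α(S) directly,
  -- so integrality is needed for f only.
  have hA : IsQuantumIndex S (monomialMap A ∘ f) (exteriorPower.map 2 A h) := fun ϖ => by
    rw [(harea ϖ).2.logArea_eq, hh, alternatingMapLinearEquiv_map]
  exact ⟨hh.existsUnique, hA.existsUnique, by rw [hA.quantumIndex_eq, hh.quantumIndex_eq]⟩
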